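/- Let $J_1,J_2\subset\mathbb R$ be open and let $\eta_1=\eta_1(x)$, $x\in J_1$, and $\eta_2=\eta_2(y)$, $y\in J_2$, be smooth functions. Let $\mathcal E$ be the infinite prolongation of the system $$u_{yy}=\frac{\frac12\eta_1'v^2v_x+\frac12\eta_2'uvu_y+(\eta_1-\eta_2)uu_yv_y+u^2v^3}{uv(\eta_1-\eta_2)},\qquad v_{xx}=\frac{\frac12\eta_1'uvv_x+\frac12\eta_2'u^2u_y+(\eta_2-\eta_1)vv_xu_x+u^3v^2}{uv(\eta_2-\eta_1)}$$ on the domain where $x\in J_1$, $y\in J_2$, $\eta_1(x)\ne\eta_2(y)$, $u\neq0$, $v\ne0$. A differential covering with fibre coordinates $w$ is given by smooth functions $w_x$, $w_y$ on the covering space such that the lifted total derivatives $D_x+\sum w_x\,\partial_w$ and $D_y+\sum w_y\,\partial_w$ commute there. The tangent covering $V\mathcal E$ is the system for $(u,v,U,V)$ that consists of the system above and its linearization (in the direction $(U,V)$). A symmetry shadow in a covering is a pair of smooth functions $(U,V)$ on the covering space satisfying the linearized system with respect to the lifted total derivatives. (1) The formulas $$(s_0)_x=\frac{u_y}v,\quad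 (s_0)_y=-\frac{v_x}u,\qquad (s_1)_x=\cos(s_0)\,u,\quad (s_1)_y=v\sin(s_0),\qquad (s_2)_x=-\sin(s_0)\,u,\quad (s_2)_y=v\cos(s_0)$$ define a covering $\mathcal S$ of $\mathcal E$. These formulas together with their linearizations (which define $S_0,S_1,S_2$, the variations of $s_0,s_1,s_2$) define a covering $V\mathcal S$ of $V\mathcal E$, with fibre coordinates $s_i,S_i$. (2) Put $$\tilde U=\eta_1U+\Bigl(\tfrac12\eta_1'\cos s_0+\frac{\sin(s_0)(\eta_2-\eta_1)}{v}u_y\Bigr)S_1+\Bigl(-\tfrac12\eta_1'\sin s_0+\frac{\cos(s_0)(\eta_2-\eta_1)}{v}u_y\Bigr)S_2,$$ $$\tilde V=\eta_2V+\Bigl(\tfrac12\eta_2'\sin s_0-\frac{\cos(s_0)(\eta_2-\eta_1)}{u}v_x\Bigr)S_1+\Bigl(\tfrac12\eta_2'\cos s_0+\frac{\sin(s_0)(\eta_2-\eta_1)}{u}v_x\Bigr)S_2.$$ Then $(u,v,U,V,s_i,S_i)\mapsto(u,v,\tilde U,\tilde V)$ defines a morphism $V\mathcal S\to V\mathcal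 E$: $(\tilde U,\tilde V)$ satisfies the linearized system with all its differential consequences on $V\mathcal S$, and the total derivatives of $V\mathcal S$ project to those of $V\mathcal E$. If moreover $\eta_1$ and $\eta_2$ have no zeros, then this is a Bäcklund auto-transformation of $V\mathcal E$: both the natural projection $V\mathcal S\to V\mathcal E$ and the map above are coverings, each with six-dimensional fibres (in suitable fibre coordinates, $V\mathcal S$ is diffeomorphic to $V\mathcal E\times\mathbb R^6$ over $V\mathcal E$). (3) (Recursion operator.) Let $\mathcal C$ be any covering over $\mathcal S$, and let $(U,V)$ be a symmetry shadow of the system in $\mathcal C$. Adjoin to $\mathcal C$ the nonlocal variables $S_0,S_1,S_2$ defined by the linearized equations for $s_0,s_1,s_2$, into which $(U,V)$ is substituted. This gives a covering $\mathcal C'$ over $\mathcal C$, and the pair $(\tilde U,\tilde V)$ given by the formulas in (2) is a symmetry shadow of the system in $\mathcal C'$. -/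

import Mathlib

open scoped ContDiff Topology

noncomputable section

namespace SDeform

/-! ### Smooth functions of finitely many of possibly infinitely many coordinates -/

section Calculus

variable {I : Type*}

/-- `f` is, near `p`, a smooth function of finitely many of the coordinates
(the space of coordinates carries the product topology). -/
def SmoothAt (f : (I → ℝ) → ℝ) (p : I → ℝ) : Prop :=
  ∃ (s : Finset I) (g : (s → ℝ) → ℝ),
    (∀ᶠ z in 𝓝 (s.restrict p), ContDiffAt ℝ ∞ g z) ∧ ∀ᶠ q in 𝓝 p, f q = g (s.restrict q)

open Classical in
/-- The partial derivative of `f` in the `i`-th coordinate. -/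
def pd (i : I) (f : (I → ℝ) → ℝ) (p : I → ℝ) : ℝ :=
  deriv (fun t => f (Function.update p i t)) (p i)

/-- `∑ i, ξ i * ∂f/∂i` at `p`; only finitely many terms are nonzero where `f` is smooth. -/
def dirDeriv (ξ : I → ℝ) (f : (I → ℝ) → ℝ) (p : I → ℝ) : ℝ :=
  ∑ᶠ i, ξ i * pd i f p

/-- The action of the vector field `∑ i, X i * ∂/∂i` on functions. -/
def along (X : I → (I → ℝ) → ℝ) (f : (I → ℝ) → ℝ) : (I → ℝ) → ℝ :=
  fun p => dirDeriv (fun i => X i p) f p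

end Calculus

/-! ### Infinite jets and infinitely prolonged equations -/

/-- Coordinates on the infinite jets of functions of `x`, `y` with components indexed by `A`:
`jet a i j` stands for the derivative of the component `a`, taken `i` times in `x` and
`j` times in `y`. -/
inductive JetCoord (A : Type*) where
  | x : JetCoord A
  | y : JetCoord A
  | jet (a : A) (i j : ℕ) : JetCoord A

open JetCoord

/-- Coefficients of the total derivative `D_x` on the infinite jet space. -/
def jetX {A : Type*} : JetCoord A → (JetCoord A → ℝ) → ℝ
  | x, _ => 1
  | y, _ => 0
  | jet a i j, q => q (jet a (i + 1) j)

/-- Coefficients of the total derivative `D_y` on the infinite jet space. -/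
def jetY {A : Type*} : JetCoord A → (JetCoord A → ℝ) → ℝ
  | x, _ => 0
  | y, _ => 1
  | jet a i j, q => q (jet a i (j + 1))

/-- The vertical tangent vector with components `φ a i j`. -/
def jetVert {A : Type*} (φ : A → ℕ → ℕ → ℝ) : JetCoord A → ℝ
  | x => 0
  | y => 0
  | jet a i j => φ a i j

/-- Renaming the dependent variables. -/
def JetCoord.map {A B : Type*} (f : A → B) : JetCoord A → JetCoord B
  | x => x
  | y => y
  | jet a i j => jet (f a) i j

/-- A system of differential equations `F k = 0`, `k : K`, considered on the domain `dom`
of the infinite jet space. -/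
structure PDESystem (A K : Type*) where
  dom : Set (JetCoord A → ℝ)
  F : K → (JetCoord A → ℝ) → ℝ

variable {A K A' K' W W' N : Type*}

/-- The infinite prolongation: the points of the jet space that satisfy all differential
consequences of the system. -/
def PDESystem.inf (E : PDESystem A K) : Set (JetCoord A → ℝ) :=
  {q | q ∈ E.dom ∧ ∀ k i j, ((along jetX)^[i] ((along jetY)^[j] (E.F k))) q = 0}

/-- The point of the jet space of `A` below a point of the jet space of `A ⊕ A`. -/
def jetBase (q : JetCoord (A ⊕ A) → ℝ) : JetCoord A → ℝ := fun c => q (c.map Sum.inl)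

/-- The vertical vector encoded by a point of the jet space of `A ⊕ A`. -/
def jetFibre (q : JetCoord (A ⊕ A) → ℝ) : JetCoord A → ℝ :=
  jetVert fun a i j => q (jet (Sum.inr a) i j)

/-- The tangent covering of a system, as a system: the system itself (dependent variables
`Sum.inl a`) together with its linearization (dependent variables `Sum.inr a`). -/
def PDESystem.tangent (E : PDESystem A K) : PDESystem (A ⊕ A) (K ⊕ K) where
  dom := {q | jetBase q ∈ E.dom}
  F := Sum.elim (fun k q => E.F k (jetBase q))
    (fun k q => dirDeriv (jetFibre q) (E.F k) (jetBase q))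

/-! ### Differential coverings in coordinates -/

/-- Data of a differential covering of `E` with fibre coordinates (nonlocal variables) indexed
by `W`: the total derivatives are lifted to `D_x + ∑ w, X w * ∂/∂w` and
`D_y + ∑ w, Y w * ∂/∂w`.  Functions on the covering are given by functions of all jet
coordinates and of the fibre coordinates; `dom` is a region to which the covering is
restricted. -/
structure Cov (E : PDESystem A K) (W : Type*) where
  dom : Set (JetCoord A ⊕ W → ℝ)
  X : W → (JetCoord A ⊕ W → ℝ) → ℝ
  Y : W → (JetCoord A ⊕ W → ℝ) → ℝ

namespace Cov

variable {E : PDESystem A K}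

/-- The covering space: the points lying over the infinitely prolonged equation. -/
def pts (C : Cov E W) : Set (JetCoord A ⊕ W → ℝ) :=
  {p | p ∘ Sum.inl ∈ E.inf ∧ p ∈ C.dom}

/-- The lifted total derivative in `x`. -/
def Dx (C : Cov E W) : ((JetCoord A ⊕ W → ℝ) → ℝ) → (JetCoord A ⊕ W → ℝ) → ℝ :=
  along (Sum.elim (fun c p => jetX c (p ∘ Sum.inl)) C.X)

/-- The lifted total derivative in `y`. -/
def Dy (C : Cov E W) : ((JetCoord A ⊕ W → ℝ) → ℝ) → (JetCoord A ⊕ W → ℝ) → ℝ :=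
  along (Sum.elim (fun c p => jetY c (p ∘ Sum.inl)) C.Y)

/-- The data define a covering: they are smooth, and the lifted total derivatives commute
on the covering space. -/
structure IsCovering (C : Cov E W) : Prop where
  isOpen_dom : IsOpen C.dom
  smooth_X : ∀ w, ∀ p ∈ C.pts, SmoothAt (C.X w) p
  smooth_Y : ∀ w, ∀ p ∈ C.pts, SmoothAt (C.Y w) p
  comm : ∀ w, ∀ p ∈ C.pts, C.Dx (C.Y w) p = C.Dy (C.X w) p

/-- A symmetry shadow of `E` in the covering `C`: a tuple `φ` of smooth functions on the
covering that satisfies the linearized equation on the covering space. -/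
structure IsShadow (C : Cov E W) (φ : A → (JetCoord A ⊕ W → ℝ) → ℝ) : Prop where
  smooth : ∀ a, ∀ p ∈ C.pts, SmoothAt (φ a) p
  lin : ∀ k, ∀ p ∈ C.pts,
    dirDeriv (jetVert fun a i j => (C.Dx^[i] (C.Dy^[j] (φ a))) p) (E.F k) (p ∘ Sum.inl) = 0

/-- Forgetting the fibre coordinates `W'`. -/
def toBase (p : JetCoord A ⊕ (W ⊕ W') → ℝ) : JetCoord A ⊕ W → ℝ :=
  Sum.elim (p ∘ Sum.inl) (fun w => p (Sum.inr (Sum.inl w)))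

/-- A covering over the covering `B`, with additional fibre coordinates `W'`. -/
def extend (B : Cov E W) (dom : Set (JetCoord A ⊕ (W ⊕ W') → ℝ))
    (X Y : W' → (JetCoord A ⊕ (W ⊕ W') → ℝ) → ℝ) : Cov E (W ⊕ W') where
  dom := {p | toBase p ∈ B.dom ∧ p ∈ dom}
  X := Sum.elim (fun w p => B.X w (toBase p)) X
  Y := Sum.elim (fun w p => B.Y w (toBase p)) Y

/-- The point of `JetCoord A ⊕ W` below a point of `JetCoord (A ⊕ A) ⊕ (W ⊕ W)`. -/
def tangentBase (p : JetCoord (A ⊕ A) ⊕ (W ⊕ W) → ℝ) : JetCoord A ⊕ W → ℝ :=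
  Sum.elim (jetBase (p ∘ Sum.inl)) (fun w => p (Sum.inr (Sum.inl w)))

/-- The vertical vector encoded by a point of `JetCoord (A ⊕ A) ⊕ (W ⊕ W)`. -/
def tangentFibre (p : JetCoord (A ⊕ A) ⊕ (W ⊕ W) → ℝ) : JetCoord A ⊕ W → ℝ :=
  Sum.elim (jetFibre (p ∘ Sum.inl)) (fun w => p (Sum.inr (Sum.inr w)))

/-- The tangent covering of a covering `C`, as a covering over the tangent covering of `E`.
Its fibre coordinates are those of `C` (`Sum.inl w`) and their variations (`Sum.inr w`),
the latter being subject to the linearization of the equations that define `C`. -/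
def tangent (C : Cov E W) : Cov E.tangent (W ⊕ W) where
  dom := {p | tangentBase p ∈ C.dom}
  X := Sum.elim (fun w p => C.X w (tangentBase p))
    (fun w p => dirDeriv (tangentFibre p) (C.X w) (tangentBase p))
  Y := Sum.elim (fun w p => C.Y w (tangentBase p))
    (fun w p => dirDeriv (tangentFibre p) (C.Y w) (tangentBase p))

/-- Given a covering `C` over the covering `B` and a tuple `φ` of functions on `C`, adjoin to
`C` the variations `S w` of the fibre coordinates `w` of `B` as new fibre coordinates.  They
are subject to the linearized defining equations of `B`, into which `φ` is substituted for the
variation of the dependent variables. -/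
def adjoinVariations (B : Cov E W) (C : Cov E (W ⊕ W'))
    (φ : A → (JetCoord A ⊕ (W ⊕ W') → ℝ) → ℝ) : Cov E ((W ⊕ W') ⊕ W) :=
  let ξ : (JetCoord A ⊕ ((W ⊕ W') ⊕ W) → ℝ) → JetCoord A ⊕ W → ℝ := fun p =>
    Sum.elim (jetVert fun a i j => (C.Dx^[i] (C.Dy^[j] (φ a))) (toBase p))
      (fun w => p (Sum.inr (Sum.inr w)))
  C.extend Set.univ
    (fun w p => dirDeriv (ξ p) (B.X w) (toBase (toBase p)))
    (fun w p => dirDeriv (ξ p) (B.Y w) (toBase (toBase p)))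

/-! ### Morphisms and Bäcklund transformations -/

/-- The infinite prolongation of a tuple `φ` of functions on the covering `C`. -/
def prol (C : Cov E W) (φ : A' → (JetCoord A ⊕ W → ℝ) → ℝ) (p : JetCoord A ⊕ W → ℝ) :
    JetCoord A' → ℝ
  | x => p (Sum.inl x)
  | y => p (Sum.inl y)
  | jet a i j => (C.Dx^[i] (C.Dy^[j] (φ a))) p

/-- The tuple `φ` of smooth functions on the covering space of `C` defines a morphism to the
infinitely prolonged system `E'`: it satisfies `E'` with all its differential consequences,
and the total derivatives of `C` project to those of `E'`. -/
structure IsMorphism (C : Cov E W) (E' : PDESystem A' K')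
    (φ : A' → (JetCoord A ⊕ W → ℝ) → ℝ) : Prop where
  smooth : ∀ a, ∀ p ∈ C.pts, SmoothAt (φ a) p
  mem_inf : ∀ p ∈ C.pts, C.prol φ p ∈ E'.inf
  Dx_prol : ∀ c, ∀ p ∈ C.pts, C.Dx (fun q => C.prol φ q c) p = jetX c (C.prol φ p)
  Dy_prol : ∀ c, ∀ p ∈ C.pts, C.Dy (fun q => C.prol φ q c) p = jetY c (C.prol φ p)

/-- The morphism given by `φ` makes the covering space of `C` a covering over `E'`, with fibre
coordinates indexed by `N`: there are functions `w` such that `(prol φ, w)` is a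
diffeomorphism of the covering space onto the product of `E'.inf` with the fibre `N → ℝ`;
`ψ` is the inverse diffeomorphism. -/
def IsCoveringOver (C : Cov E W) (E' : PDESystem A' K')
    (φ : A' → (JetCoord A ⊕ W → ℝ) → ℝ) (N : Type*) : Prop :=
  C.IsMorphism E' φ ∧
  ∃ (w : N → (JetCoord A ⊕ W → ℝ) → ℝ)
    (ψ : JetCoord A ⊕ W → (JetCoord A' ⊕ N → ℝ) → ℝ),
    (∀ n, ∀ p ∈ C.pts, SmoothAt (w n) p) ∧
    (∀ c r, r ∘ Sum.inl ∈ E'.inf → SmoothAt (ψ c) r) ∧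
    (∀ p ∈ C.pts, (fun c => ψ c (Sum.elim (C.prol φ p) (fun n => w n p))) = p) ∧
    ∀ r, r ∘ Sum.inl ∈ E'.inf →
      (fun c => ψ c r) ∈ C.pts ∧
      Sum.elim (C.prol φ (fun c => ψ c r)) (fun n => w n (fun c => ψ c r)) = r

/-- The dependent variables of `E`, as functions on a covering of `E`. -/
def depVar (a : A) (p : JetCoord A ⊕ W → ℝ) : ℝ := p (Sum.inl (jet a 0 0))

/-- `C`, a covering of `E`, together with `φ` is a Bäcklund auto-transformation of `E` with
`N`-dimensional fibres: the covering space of `C` covers `E` both by its natural projection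
and by the map that is given by `φ`. -/
def IsBacklundAuto (C : Cov E W) (φ : A → (JetCoord A ⊕ W → ℝ) → ℝ) (N : Type*) : Prop :=
  C.IsCovering ∧ C.IsCoveringOver E depVar N ∧ C.IsCoveringOver E φ N

end Cov

/-! ### The system, its Abelian covering and the recursion operator -/

/-- The two unknown functions. -/
inductive Dep where
  | u : Dep
  | v : Dep

open Dep

/-- The system for `u`, `v`, with `η₁` a function of `x ∈ J₁` and `η₂` a function of `y ∈ J₂`;
each equation is written as left-hand side minus right-hand side. -/
def sysEta (J₁ J₂ : Set ℝ) (η₁ η₂ : ℝ → ℝ) : PDESystem Dep Dep where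
  dom := {q | q x ∈ J₁ ∧ q y ∈ J₂ ∧ η₁ (q x) ≠ η₂ (q y) ∧
    q (jet u 0 0) ≠ 0 ∧ q (jet v 0 0) ≠ 0}
  F
    | Dep.u, q =>
      let e₁ := η₁ (q x)
      let e₂ := η₂ (q y)
      let e₁' := deriv η₁ (q x)
      let e₂' := deriv η₂ (q y)
      let u₀ := q (jet u 0 0)
      let v₀ := q (jet v 0 0)
      let uy := q (jet u 0 1)
      let vx := q (jet v 1 0)
      let vy := q (jet v 0 1)
      q (jet u 0 2) -
        (1 / 2 * e₁' * v₀ ^ 2 * vx + 1 / 2 * e₂' * u₀ * v₀ * uy + (e₁ - e₂) * u₀ * uy * vy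
          + u₀ ^ 2 * v₀ ^ 3) / (u₀ * v₀ * (e₁ - e₂))
    | Dep.v, q =>
      let e₁ := η₁ (q x)
      let e₂ := η₂ (q y)
      let e₁' := deriv η₁ (q x)
      let e₂' := deriv η₂ (q y)
      let u₀ := q (jet u 0 0)
      let v₀ := q (jet v 0 0)
      let ux := q (jet u 1 0)
      let uy := q (jet u 0 1)
      let vx := q (jet v 1 0)
      q (jet v 2 0) -
        (1 / 2 * e₁' * u₀ * v₀ * vx + 1 / 2 * e₂' * u₀ ^ 2 * uy + (e₂ - e₁) * v₀ * vx * ux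
          + u₀ ^ 3 * v₀ ^ 2) / (u₀ * v₀ * (e₂ - e₁))

/-- The covering with nonlocal variables `s₀`, `s₁`, `s₂`. -/
def covS (J₁ J₂ : Set ℝ) (η₁ η₂ : ℝ → ℝ) : Cov (sysEta J₁ J₂ η₁ η₂) (Fin 3) where
  dom := Set.univ
  X := ![fun p => p (Sum.inl (jet u 0 1)) / p (Sum.inl (jet v 0 0)),
    fun p => Real.cos (p (Sum.inr 0)) * p (Sum.inl (jet u 0 0)),
    fun p => -Real.sin (p (Sum.inr 0)) * p (Sum.inl (jet u 0 0))]
  Y := ![fun p => -(p (Sum.inl (jet v 1 0)) / p (Sum.inl (jet u 0 0))),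
    fun p => p (Sum.inl (jet v 0 0)) * Real.sin (p (Sum.inr 0)),
    fun p => p (Sum.inl (jet v 0 0)) * Real.cos (p (Sum.inr 0))]

/-- The right-hand sides of the recursion operator, for a given jet `q` of `u`, `v` and given
values of `s₀`, `U`, `V`, `S₁`, `S₂`. -/
def ro (η₁ η₂ : ℝ → ℝ) (q : JetCoord Dep → ℝ) (s₀ U V S₁ S₂ : ℝ) : Dep → ℝ
  | Dep.u => η₁ (q x) * U
      + (1 / 2 * deriv η₁ (q x) * Real.cos s₀
        + Real.sin s₀ * (η₂ (q y) - η₁ (q x)) / q (jet v 0 0) * q (jet u 0 1)) * S₁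
      + (-(1 / 2) * deriv η₁ (q x) * Real.sin s₀
        + Real.cos s₀ * (η₂ (q y) - η₁ (q x)) / q (jet v 0 0) * q (jet u 0 1)) * S₂
  | Dep.v => η₂ (q y) * V
      + (1 / 2 * deriv η₂ (q y) * Real.sin s₀
        - Real.cos s₀ * (η₂ (q y) - η₁ (q x)) / q (jet u 0 0) * q (jet v 1 0)) * S₁
      + (1 / 2 * deriv η₂ (q y) * Real.cos s₀
        + Real.sin s₀ * (η₂ (q y) - η₁ (q x)) / q (jet u 0 0) * q (jet v 1 0)) * S₂

/-- The recursion operator on the tangent covering of `covS`: the tuple `(u, v, Ũ, Ṽ)`. -/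
def roTangent (η₁ η₂ : ℝ → ℝ) :
    Dep ⊕ Dep → (JetCoord (Dep ⊕ Dep) ⊕ (Fin 3 ⊕ Fin 3) → ℝ) → ℝ
  | Sum.inl a, p => p (Sum.inl (jet (Sum.inl a) 0 0))
  | Sum.inr a, p => ro η₁ η₂ (jetBase (p ∘ Sum.inl)) (p (Sum.inr (Sum.inl 0)))
      (p (Sum.inl (jet (Sum.inr u) 0 0))) (p (Sum.inl (jet (Sum.inr v) 0 0)))
      (p (Sum.inr (Sum.inr 1))) (p (Sum.inr (Sum.inr 2))) a

/-- The recursion operator applied to a pair `φ = (U, V)` of functions on a covering over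
`covS`: the pair `(Ũ, Ṽ)` of functions on the covering with adjoined `S₀`, `S₁`, `S₂`. -/
def roShadow {W : Type*} (η₁ η₂ : ℝ → ℝ) (φ : Dep → (JetCoord Dep ⊕ (Fin 3 ⊕ W) → ℝ) → ℝ) :
    Dep → (JetCoord Dep ⊕ ((Fin 3 ⊕ W) ⊕ Fin 3) → ℝ) → ℝ :=
  fun a p => ro η₁ η₂ (p ∘ Sum.inl) (p (Sum.inr (Sum.inl (Sum.inl 0))))
    (φ u (Cov.toBase p)) (φ v (Cov.toBase p)) (p (Sum.inr (Sum.inr 1))) (p (Sum.inr (Sum.inr 2))) a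

end SDeform

end

/-!
Write `a = u_y / v` and `b = -v_x / u` for the derivatives of `s₀`. The system says exactly that
`(η₂ - η₁) a_y = (η₂ - η₁) b_x = ½ η₁' b - ½ η₂' a - u v`, so that `s₀` is a potential, and
then `(cos s₀ u, v sin s₀)` and `(-sin s₀ u, v cos s₀)` are closed too. Linearizing the system
amounts to linearizing this equation along with the definitions of `a` and `b`.

Rotating the pair `(S₁, S₂)` by the angle `s₀` gives a frame `(T, Z)` in which `Ũ`, `Ṽ` and the
induced variations of `a` and `b` have coefficients free of `s₀`; the linearized equation for
the transformed quantities is then a polynomial identity. The transformed map is triangular with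
respect to the order of derivatives of `U` and `V`, with diagonal coefficients `η₁` and `η₂`, and
a triangular map with nonvanishing diagonal can be inverted coordinate by coordinate. Finally, a
shadow in a covering over `𝒮` is the same thing as a map to `V𝓔` commuting with the total
derivatives, and composing it with the morphism of the tangent covering transports the shadow.
-/

noncomputable section

namespace SDeform

section Calculus

variable {I J : Type*}

theorem SmoothAt.congr {f g : (I → ℝ) → ℝ} {p : I → ℝ} (h : SmoothAt f p) (hgf : g =ᶠ[𝓝 p] f) :
    SmoothAt g p :=
  let ⟨s, f', hf', hf⟩ := h
  ⟨s, f', hf', hgf.trans hf⟩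

theorem SmoothAt.continuousAt {f : (I → ℝ) → ℝ} {p : I → ℝ} (h : SmoothAt f p) :
    ContinuousAt f p := by
  obtain ⟨s, g, hg, hf⟩ := h
  have hgs : ContinuousAt (fun q => g (s.restrict q)) p :=
    ContinuousAt.comp (f := s.restrict) hg.self_of_nhds.continuousAt
      (Finset.continuous_restrict s).continuousAt
  exact hgs.congr (hf.mono fun q hq => hq.symm)

theorem smoothAt_of_contDiffAt [Fintype I] {f : (I → ℝ) → ℝ} {p : I → ℝ}
    (hf : ∀ᶠ z in 𝓝 p, ContDiffAt ℝ ∞ f z) : SmoothAt f p := by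
  have hext : ContDiff ℝ ∞ fun (z : ↥(Finset.univ : Finset I) → ℝ) (i : I) =>
      z ⟨i, Finset.mem_univ i⟩ :=
    contDiff_pi.2 fun i => contDiff_apply ℝ ℝ _
  refine ⟨Finset.univ, fun z => f fun i => z ⟨i, Finset.mem_univ i⟩, ?_, .of_forall fun _ => rfl⟩
  have hp := hext.continuous.tendsto ((Finset.univ : Finset I).restrict p)
  filter_upwards [hp.eventually hf] with z hz
  exact ContDiffAt.comp z hz hext.contDiffAt

theorem smoothAt_coord (i : I) (p : I → ℝ) : SmoothAt (fun q => q i) p :=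
  ⟨{i}, fun z => z ⟨i, Finset.mem_singleton_self i⟩,
    .of_forall fun _ => (contDiff_apply ℝ ℝ _).contDiffAt, .of_forall fun _ => rfl⟩

theorem smoothAt_const (c : ℝ) (p : I → ℝ) : SmoothAt (fun _ => c) p :=
  ⟨∅, fun _ => c, .of_forall fun _ => contDiffAt_const, .of_forall fun _ => rfl⟩

theorem continuousAt_of_smoothAt {m : (I → ℝ) → J → ℝ} {p : I → ℝ}
    (hm : ∀ j, SmoothAt (fun q => m q j) p) : ContinuousAt m p :=
  continuousAt_pi.2 fun j => (hm j).continuousAt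

theorem exists_contDiffAt_of_smoothAt [Fintype J] {m : (I → ℝ) → J → ℝ} {p : I → ℝ}
    (hm : ∀ j, SmoothAt (fun q => m q j) p) :
    ∃ (t : Finset I) (k : (t → ℝ) → J → ℝ),
      (∀ᶠ z in 𝓝 (t.restrict p), ContDiffAt ℝ ∞ k z) ∧ ∀ᶠ q in 𝓝 p, m q = k (t.restrict q) := by
  classical
  choose S G hG hS using hm
  let t : Finset I := Finset.univ.biUnion S
  let r : ∀ j : J, (t → ℝ) → (S j → ℝ) := fun j z i =>
    z ⟨i, Finset.mem_biUnion.2 ⟨j, Finset.mem_univ j, i.2⟩⟩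
  have hr : ∀ j, ContDiff ℝ ∞ (r j) := fun j => contDiff_pi.2 fun i => contDiff_apply ℝ ℝ _
  refine ⟨t, fun z j => G j (r j z), ?_, ?_⟩
  · have hG' : ∀ᶠ z in 𝓝 (t.restrict p), ∀ j, ContDiffAt ℝ ∞ (G j) (r j z) :=
      Filter.eventually_all.2 fun j =>
        ((hr j).continuous.tendsto (t.restrict p)).eventually (hG j)
    filter_upwards [hG'] with z hz
    exact contDiffAt_pi.2 fun j => ContDiffAt.comp z (hz j) (hr j).contDiffAt
  · filter_upwards [Filter.eventually_all.2 hS] with q hq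
    exact funext hq

theorem SmoothAt.comp {f : (J → ℝ) → ℝ} {m : (I → ℝ) → J → ℝ} {p : I → ℝ}
    (hf : SmoothAt f (m p)) (hm : ∀ j, SmoothAt (fun q => m q j) p) :
    SmoothAt (fun q => f (m q)) p := by
  obtain ⟨s, g, hg, hfg⟩ := hf
  obtain ⟨t, k, hk, hmk⟩ := exists_contDiffAt_of_smoothAt (m := fun q => s.restrict (m q))
    fun j => hm j
  refine ⟨t, fun z => g (k z), ?_, ?_⟩
  · have hkp : Filter.Tendsto k (𝓝 (t.restrict p)) (𝓝 (s.restrict (m p))) := by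
      rw [hmk.self_of_nhds]
      exact hk.self_of_nhds.continuousAt
    filter_upwards [hk, hkp.eventually hg] with z hkz hgz
    exact ContDiffAt.comp z hgz hkz
  · filter_upwards [(continuousAt_of_smoothAt hm).eventually hfg, hmk] with q hfq hmq
    rw [hfq, hmq]

theorem SmoothAt.scalar {f : (I → ℝ) → ℝ} {p : I → ℝ} {h : ℝ → ℝ}
    (hh : ∀ᶠ z in 𝓝 (f p), ContDiffAt ℝ ∞ h z) (hf : SmoothAt f p) :
    SmoothAt (fun q => h (f q)) p := by
  have hh' : SmoothAt (I := Unit) (fun z => h (z ())) (fun _ => f p) := by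
    refine smoothAt_of_contDiffAt ?_
    filter_upwards [((continuous_apply ()).tendsto fun _ => f p).eventually hh] with z hz
    exact ContDiffAt.comp z hz (contDiff_apply ℝ ℝ _).contDiffAt
  exact SmoothAt.comp (m := fun q _ => f q) hh' fun _ => hf

theorem SmoothAt.binary {f g : (I → ℝ) → ℝ} {p : I → ℝ} {h : ℝ → ℝ → ℝ}
    (hh : ContDiff ℝ ∞ fun z : ℝ × ℝ => h z.1 z.2) (hf : SmoothAt f p) (hg : SmoothAt g p) :
    SmoothAt (fun q => h (f q) (g q)) p := by
  have hh' : SmoothAt (I := Bool) (fun z => h (z true) (z false))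
      (fun b => cond b (f p) (g p)) :=
    smoothAt_of_contDiffAt <| .of_forall fun _ =>
      (hh.comp ((contDiff_apply ℝ ℝ true).prodMk (contDiff_apply ℝ ℝ false))).contDiffAt
  exact SmoothAt.comp (m := fun q b => cond b (f q) (g q)) hh' (Bool.rec hg hf)

section Arithmetic

variable {f g : (I → ℝ) → ℝ} {p : I → ℝ}

theorem SmoothAt.add (hf : SmoothAt f p) (hg : SmoothAt g p) : SmoothAt (fun q => f q + g q) p :=
  SmoothAt.binary (contDiff_fst.add contDiff_snd) hf hg

theorem SmoothAt.sub (hf : SmoothAt f p) (hg : SmoothAt g p) : SmoothAt (fun q => f q - g q) p :=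
  SmoothAt.binary (contDiff_fst.sub contDiff_snd) hf hg

theorem SmoothAt.mul (hf : SmoothAt f p) (hg : SmoothAt g p) : SmoothAt (fun q => f q * g q) p :=
  SmoothAt.binary (contDiff_fst.mul contDiff_snd) hf hg

theorem SmoothAt.div (hf : SmoothAt f p) (hg : SmoothAt g p) (h0 : g p ≠ 0) :
    SmoothAt (fun q => f q / g q) p := by
  have hinv : ∀ᶠ z in 𝓝 (g p), ContDiffAt ℝ ∞ (fun z : ℝ => z⁻¹) z := by
    filter_upwards [isOpen_ne.mem_nhds h0] with z hz
    exact contDiffAt_inv ℝ hz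
  simpa only [div_eq_mul_inv] using hf.mul (hg.scalar hinv)

end Arithmetic

theorem hasDerivAt_of_rep {f : (I → ℝ) → ℝ} {s : Finset I} {g : (s → ℝ) → ℝ} {γ : ℝ → I → ℝ}
    {ξ : I → ℝ} {t : ℝ} (hg : DifferentiableAt ℝ g (s.restrict (γ t)))
    (hf : ∀ᶠ q in 𝓝 (γ t), f q = g (s.restrict q))
    (hγ : ∀ i, HasDerivAt (fun τ => γ τ i) (ξ i) t) :
    HasDerivAt (fun τ => f (γ τ)) (fderiv ℝ g (s.restrict (γ t)) (s.restrict ξ)) t := by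
  have hs : HasDerivAt (fun τ => s.restrict (γ τ)) (s.restrict ξ) t := hasDerivAt_pi.2 fun i => hγ i
  have hc : ContinuousAt γ t := continuousAt_pi.2 fun i => (hγ i).continuousAt
  exact (HasFDerivAt.comp_hasDerivAt t hg.hasFDerivAt hs).congr_of_eventuallyEq (hc.eventually hf)

open Classical in
theorem pd_of_rep {f : (I → ℝ) → ℝ} {p : I → ℝ} {s : Finset I} {g : (s → ℝ) → ℝ}
    (hg : DifferentiableAt ℝ g (s.restrict p)) (hf : ∀ᶠ q in 𝓝 p, f q = g (s.restrict q)) (i : I) :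
    pd i f p = fderiv ℝ g (s.restrict p) (s.restrict (Pi.single i 1 : I → ℝ)) := by
  have hp : Function.update p i (p i) = p := Function.update_eq_self i p
  have hγ : ∀ j, HasDerivAt (fun t => Function.update p i t j)
      ((Pi.single i 1 : I → ℝ) j) (p i) := fun j => by
    rcases eq_or_ne j i with rfl | hj
    · simpa using hasDerivAt_id' (p j)
    · simpa [hj] using hasDerivAt_const (p i) (p j)
  have := hasDerivAt_of_rep (t := p i) (by rwa [hp]) (by rwa [hp]) hγ
  rw [hp] at this
  exact this.deriv

theorem dirDeriv_of_rep {f : (I → ℝ) → ℝ} {p : I → ℝ} {s : Finset I} {g : (s → ℝ) → ℝ}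
    (hg : DifferentiableAt ℝ g (s.restrict p)) (hf : ∀ᶠ q in 𝓝 p, f q = g (s.restrict q))
    (ξ : I → ℝ) : dirDeriv ξ f p = fderiv ℝ g (s.restrict p) (s.restrict ξ) := by
  classical
  have hsupp : (Function.support fun i => ξ i * pd i f p) ⊆ s := fun i hi => by
    by_contra his
    have h0 : s.restrict (Pi.single i 1 : I → ℝ) = 0 := by
      ext j
      exact Pi.single_eq_of_ne (fun h : (j : I) = i => his (h ▸ j.2)) _
    exact hi (by simp only [pd_of_rep hg hf, h0, map_zero, mul_zero])
  have hξ : s.restrict ξ = ∑ i ∈ s, ξ i • s.restrict (Pi.single i 1 : I → ℝ) := by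
    ext j
    simp [Pi.single_apply]
  rw [dirDeriv, finsum_eq_sum_of_support_subset _ hsupp, hξ]
  simp only [map_sum, map_smul, smul_eq_mul, pd_of_rep hg hf]

theorem eventually_dirDeriv_of_rep {f : (I → ℝ) → ℝ} {p : I → ℝ} {s : Finset I}
    {g : (s → ℝ) → ℝ} (hg : ∀ᶠ z in 𝓝 (s.restrict p), ContDiffAt ℝ ∞ g z)
    (hf : ∀ᶠ q in 𝓝 p, f q = g (s.restrict q)) :
    ∀ᶠ q in 𝓝 p, ∀ ξ, dirDeriv ξ f q = fderiv ℝ g (s.restrict q) (s.restrict ξ) := by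
  filter_upwards [((Finset.continuous_restrict s).tendsto p).eventually hg,
    hf.eventually_nhds] with q hgq hfq
  exact dirDeriv_of_rep (hgq.differentiableAt (by simp)) hfq

theorem SmoothAt.hasDerivAt {f : (I → ℝ) → ℝ} {γ : ℝ → I → ℝ} {ξ : I → ℝ} {t : ℝ}
    (h : SmoothAt f (γ t)) (hγ : ∀ i, HasDerivAt (fun τ => γ τ i) (ξ i) t) :
    HasDerivAt (fun τ => f (γ τ)) (SDeform.dirDeriv ξ f (γ t)) t := by
  obtain ⟨s, g, hg, hf⟩ := h
  have hd := hg.self_of_nhds.differentiableAt (by simp)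
  rw [dirDeriv_of_rep hd hf]
  exact hasDerivAt_of_rep hd hf hγ

theorem hasDerivAt_line (p ξ : I → ℝ) (i : I) :
    HasDerivAt (fun t : ℝ => (p + t • ξ) i) (ξ i) 0 := by
  simpa using ((hasDerivAt_id (0 : ℝ)).mul_const (ξ i)).const_add (p i)

theorem tendsto_line (p ξ : I → ℝ) : Filter.Tendsto (fun t : ℝ => p + t • ξ) (𝓝 0) (𝓝 p) := by
  have hc : Continuous fun t : ℝ => p + t • ξ := by fun_prop
  simpa using hc.tendsto 0

theorem SmoothAt.hasDerivAt_line {f : (I → ℝ) → ℝ} {p : I → ℝ} (h : SmoothAt f p) (ξ : I → ℝ) :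
    HasDerivAt (fun t : ℝ => f (p + t • ξ)) (SDeform.dirDeriv ξ f p) 0 := by
  have hp : p + (0 : ℝ) • ξ = p := by simp
  simpa only [hp] using SmoothAt.hasDerivAt (t := 0) (hp.symm ▸ h) (SDeform.hasDerivAt_line p ξ)

theorem SmoothAt.dirDeriv_comp {f : (J → ℝ) → ℝ} {m : (I → ℝ) → J → ℝ} {p : I → ℝ}
    (hf : SmoothAt f (m p)) (hm : ∀ j, SmoothAt (fun q => m q j) p) (ξ : I → ℝ) :
    SDeform.dirDeriv ξ (fun q => f (m q)) p
      = SDeform.dirDeriv (fun j => SDeform.dirDeriv ξ (fun q => m q j) p) f (m p) := by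
  have hp : p + (0 : ℝ) • ξ = p := by simp
  have hf' := SmoothAt.hasDerivAt (γ := fun t : ℝ => m (p + t • ξ)) (t := 0) (hp.symm ▸ hf)
    fun j => (hm j).hasDerivAt_line ξ
  rw [hp] at hf'
  exact ((hf.comp hm).hasDerivAt_line ξ).unique hf'

theorem dirDeriv_congr {f g : (I → ℝ) → ℝ} {p : I → ℝ} (hf : SmoothAt f p) (hgf : g =ᶠ[𝓝 p] f)
    (ξ : I → ℝ) : dirDeriv ξ g p = dirDeriv ξ f p :=
  ((hf.congr hgf).hasDerivAt_line ξ).unique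
    ((hf.hasDerivAt_line ξ).congr_of_eventuallyEq ((tendsto_line p ξ).eventually hgf))

/-- `f` is smooth at `p`, with derivative `d` in the direction `ξ`. Bundling smoothness with the
value lets the rules of differentiation be applied as terms. -/
structure HasDirDerivAt (f : (I → ℝ) → ℝ) (d : ℝ) (ξ p : I → ℝ) : Prop where
  smooth : SmoothAt f p
  eq : dirDeriv ξ f p = d

theorem SmoothAt.hasDirDerivAt {f : (I → ℝ) → ℝ} {p : I → ℝ} (h : SmoothAt f p) (ξ : I → ℝ) :
    HasDirDerivAt f (SDeform.dirDeriv ξ f p) ξ p :=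
  ⟨h, rfl⟩

namespace HasDirDerivAt

variable {ξ p : I → ℝ} {f g : (I → ℝ) → ℝ} {d e : ℝ}

theorem hasDerivAt (h : HasDirDerivAt f d ξ p) : HasDerivAt (fun t : ℝ => f (p + t • ξ)) d 0 :=
  h.eq ▸ h.smooth.hasDerivAt_line ξ

theorem of_hasDerivAt (h : SmoothAt f p) (h' : HasDerivAt (fun t : ℝ => f (p + t • ξ)) d 0) :
    HasDirDerivAt f d ξ p :=
  ⟨h, (h.hasDerivAt_line ξ).unique h'⟩

theorem coord (i : I) : HasDirDerivAt (fun q => q i) (ξ i) ξ p :=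
  of_hasDerivAt (smoothAt_coord i p) (hasDerivAt_line p ξ i)

theorem const (c : ℝ) : HasDirDerivAt (fun _ => c) 0 ξ p :=
  of_hasDerivAt (smoothAt_const c p) (hasDerivAt_const _ _)

theorem add (hf : HasDirDerivAt f d ξ p) (hg : HasDirDerivAt g e ξ p) :
    HasDirDerivAt (fun q => f q + g q) (d + e) ξ p :=
  of_hasDerivAt (hf.smooth.add hg.smooth) (hf.hasDerivAt.add hg.hasDerivAt)

theorem sub (hf : HasDirDerivAt f d ξ p) (hg : HasDirDerivAt g e ξ p) :
    HasDirDerivAt (fun q => f q - g q) (d - e) ξ p :=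
  of_hasDerivAt (hf.smooth.sub hg.smooth) (hf.hasDerivAt.sub hg.hasDerivAt)

theorem mul (hf : HasDirDerivAt f d ξ p) (hg : HasDirDerivAt g e ξ p) :
    HasDirDerivAt (fun q => f q * g q) (d * g p + f p * e) ξ p :=
  of_hasDerivAt (hf.smooth.mul hg.smooth) (by simpa using hf.hasDerivAt.fun_mul hg.hasDerivAt)

theorem div (hf : HasDirDerivAt f d ξ p) (hg : HasDirDerivAt g e ξ p) (h0 : g p ≠ 0) :
    HasDirDerivAt (fun q => f q / g q) ((d * g p - f p * e) / g p ^ 2) ξ p :=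
  of_hasDerivAt (hf.smooth.div hg.smooth h0)
    (by simpa using hf.hasDerivAt.fun_div hg.hasDerivAt (by simpa using h0))

theorem scalar {h : ℝ → ℝ} (hh : ∀ᶠ z in 𝓝 (f p), ContDiffAt ℝ ∞ h z)
    (hf : HasDirDerivAt f d ξ p) :
    HasDirDerivAt (fun q => h (f q)) (deriv h (f p) * d) ξ p := by
  have hd : HasDerivAt h (deriv h (f p)) (f p) :=
    (hh.self_of_nhds.differentiableAt (by simp)).hasDerivAt
  refine of_hasDerivAt (hf.smooth.scalar hh) (HasDerivAt.comp (h₂ := h) 0 ?_ hf.hasDerivAt)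
  simpa using hd

theorem neg (hf : HasDirDerivAt f d ξ p) : HasDirDerivAt (fun q => -f q) (-d) ξ p := by
  simpa using (const 0).sub hf

theorem sin (hf : HasDirDerivAt f d ξ p) :
    HasDirDerivAt (fun q => Real.sin (f q)) (Real.cos (f p) * d) ξ p := by
  simpa using hf.scalar (h := Real.sin) (.of_forall fun _ => Real.contDiff_sin.contDiffAt)

theorem cos (hf : HasDirDerivAt f d ξ p) :
    HasDirDerivAt (fun q => Real.cos (f q)) (-Real.sin (f p) * d) ξ p := by
  simpa using hf.scalar (h := Real.cos) (.of_forall fun _ => Real.contDiff_cos.contDiffAt)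

theorem congr (hf : HasDirDerivAt f d ξ p) (hgf : g =ᶠ[𝓝 p] f) : HasDirDerivAt g d ξ p :=
  ⟨hf.smooth.congr hgf, (dirDeriv_congr hf.smooth hgf ξ).trans hf.eq⟩

theorem congr_deriv (hf : HasDirDerivAt f d ξ p) (hde : d = e) : HasDirDerivAt f e ξ p :=
  hde ▸ hf

end HasDirDerivAt

theorem SmoothAt.dirDeriv {f : (J → ℝ) → ℝ} {m ξ : (I → ℝ) → J → ℝ} {p : I → ℝ}
    (hf : SmoothAt f (m p)) (hm : ∀ j, SmoothAt (fun q => m q j) p)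
    (hξ : ∀ j, SmoothAt (fun q => ξ q j) p) :
    SmoothAt (fun q => SDeform.dirDeriv (ξ q) f (m q)) p := by
  obtain ⟨s, g, hg, hfg⟩ := hf
  have hinl : ContDiff ℝ ∞ fun (z : s ⊕ s → ℝ) i => z (Sum.inl i) :=
    contDiff_pi.2 fun i => contDiff_apply ℝ ℝ _
  have hinr : ContDiff ℝ ∞ fun (z : s ⊕ s → ℝ) i => z (Sum.inr i) :=
    contDiff_pi.2 fun i => contDiff_apply ℝ ℝ _
  have hfderiv : SmoothAt (I := s ⊕ s) (fun z => fderiv ℝ g (z ∘ Sum.inl) (z ∘ Sum.inr))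
      (Sum.elim (s.restrict (m p)) (s.restrict (ξ p))) := by
    refine smoothAt_of_contDiffAt ?_
    filter_upwards [(hinl.continuous.tendsto
      (Sum.elim (s.restrict (m p)) (s.restrict (ξ p)))).eventually hg] with z hz
    exact (ContDiffAt.comp z (hz.fderiv_right (m := ∞) (by simp)) hinl.contDiffAt).clm_apply
      hinr.contDiffAt
  have hcomp := SmoothAt.comp
    (m := fun q => Sum.elim (s.restrict (m q)) (s.restrict (ξ q))) hfderiv
    (Sum.rec (fun i => hm i) (fun i => hξ i))
  refine hcomp.congr ?_
  filter_upwards [(continuousAt_of_smoothAt hm).eventually (eventually_dirDeriv_of_rep hg hfg)]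
    with q hq
  exact hq _

theorem SmoothAt.dirDeriv_comm {f : (I → ℝ) → ℝ} {p : I → ℝ} (h : SmoothAt f p) (ξ ζ : I → ℝ) :
    SDeform.dirDeriv ξ (SDeform.dirDeriv ζ f) p = SDeform.dirDeriv ζ (SDeform.dirDeriv ξ f) p := by
  obtain ⟨s, g, hg, hf⟩ := h
  have hz := hg.self_of_nhds
  have hd : DifferentiableAt ℝ (fderiv ℝ g) (s.restrict p) :=
    (hz.fderiv_right (m := ∞) (by simp)).differentiableAt (by simp)
  have hsecond : ∀ ξ ζ, SDeform.dirDeriv ξ (SDeform.dirDeriv ζ f) p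
      = fderiv ℝ (fderiv ℝ g) (s.restrict p) (s.restrict ξ) (s.restrict ζ) := fun ξ ζ => by
    rw [dirDeriv_of_rep (hd.clm_apply (differentiableAt_const (s.restrict ζ)))
      ((eventually_dirDeriv_of_rep hg hf).mono fun q hq => hq ζ),
      fderiv_clm_apply hd (differentiableAt_const _)]
    simp
  rw [hsecond, hsecond]
  exact hz.isSymmSndFDerivAt (by simpa using ENat.LEInfty.out) _ _

theorem SmoothAt.dirDeriv_dirDeriv {f : (J → ℝ) → ℝ} {m ξ : (I → ℝ) → J → ℝ} {p : I → ℝ}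
    (hf : SmoothAt f (m p)) (hm : ∀ j, SmoothAt (fun q => m q j) p)
    (hξ : ∀ j, SmoothAt (fun q => ξ q j) p) (ζ : I → ℝ) :
    SDeform.dirDeriv ζ (fun q => SDeform.dirDeriv (ξ q) f (m q)) p
      = SDeform.dirDeriv (fun j => SDeform.dirDeriv ζ (fun q => m q j) p)
          (SDeform.dirDeriv (ξ p) f) (m p)
        + SDeform.dirDeriv (fun j => SDeform.dirDeriv ζ (fun q => ξ q j) p) f (m p) := by
  have hsmooth := hf.dirDeriv hm hξ
  obtain ⟨s, g, hg, hfg⟩ := hf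
  have hz := hg.self_of_nhds
  have hd : DifferentiableAt ℝ (fderiv ℝ g) (s.restrict (m p)) :=
    (hz.fderiv_right (m := ∞) (by simp)).differentiableAt (by simp)
  have hp : p + (0 : ℝ) • ζ = p := by simp
  have hev := eventually_dirDeriv_of_rep hg hfg
  have hm' : HasDerivAt (fun t : ℝ => s.restrict (m (p + t • ζ)))
      (s.restrict fun j => SDeform.dirDeriv ζ (fun q => m q j) p) 0 :=
    hasDerivAt_pi.2 fun j => (hm j).hasDerivAt_line ζ
  have hξ' : HasDerivAt (fun t : ℝ => s.restrict (ξ (p + t • ζ)))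
      (s.restrict fun j => SDeform.dirDeriv ζ (fun q => ξ q j) p) 0 :=
    hasDerivAt_pi.2 fun j => (hξ j).hasDerivAt_line ζ
  have hg' := (HasFDerivAt.comp_hasDerivAt (l := fderiv ℝ g) 0
    (by rw [hp]; exact hd.hasFDerivAt) hm').clm_apply hξ'
  have hline := hg'.congr_of_eventuallyEq <| ((tendsto_line p ζ).eventually
    ((continuousAt_of_smoothAt hm).eventually hev)).mono fun t ht => ht (ξ (p + t • ζ))
  rw [(hsmooth.hasDerivAt_line ζ).unique hline,
    dirDeriv_of_rep (hd.clm_apply (differentiableAt_const (s.restrict (ξ p))))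
      (hev.mono fun q hq => hq (ξ p)),
    dirDeriv_of_rep (hz.differentiableAt (by simp)) hfg,
    fderiv_clm_apply hd (differentiableAt_const _)]
  simp

end Calculus

section VectorFields

variable {I J : Type*}

theorem SmoothAt.along {X : I → (I → ℝ) → ℝ} {f : (I → ℝ) → ℝ} {p : I → ℝ} (hf : SmoothAt f p)
    (hX : ∀ i, SmoothAt (X i) p) : SmoothAt (SDeform.along X f) p :=
  SmoothAt.dirDeriv (m := fun q => q) hf (fun i => smoothAt_coord i p) hX

@[simp] theorem along_coord (X : I → (I → ℝ) → ℝ) (i : I) : along X (fun q => q i) = X i :=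
  funext fun _ => (HasDirDerivAt.coord i).eq

@[simp] theorem along_const (X : I → (I → ℝ) → ℝ) (a : ℝ) : along X (fun _ => a) = fun _ => 0 :=
  funext fun _ => (HasDirDerivAt.const a).eq

theorem along_comp {X : I → (I → ℝ) → ℝ} {X' : J → (J → ℝ) → ℝ} {m : (I → ℝ) → J → ℝ}
    {f : (J → ℝ) → ℝ} {p : I → ℝ} (hm : ∀ c, SmoothAt (fun q => m q c) p)
    (hX : ∀ c, along X (fun q => m q c) p = X' c (m p)) (hf : SmoothAt f (m p)) :
    along X (fun q => f (m q)) p = along X' f (m p) :=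
  (hf.dirDeriv_comp hm _).trans (congrArg (fun ξ => dirDeriv ξ f (m p)) (funext hX))

theorem along_dirDeriv {X' : I → (I → ℝ) → ℝ} {X : J → (J → ℝ) → ℝ} {b φ : (I → ℝ) → J → ℝ}
    {f : (J → ℝ) → ℝ} {p : I → ℝ} (hb : ∀ c, SmoothAt (fun q => b q c) p)
    (hφ : ∀ c, SmoothAt (fun q => φ q c) p) (hX : ∀ c, SmoothAt (X c) (b p))
    (hf : SmoothAt f (b p)) (hXb : ∀ c, along X' (fun q => b q c) p = X c (b p))
    (hXφ : ∀ c, along X' (fun q => φ q c) p = dirDeriv (φ p) (X c) (b p)) :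
    along X' (fun q => dirDeriv (φ q) f (b q)) p = dirDeriv (φ p) (along X f) (b p) := by
  have hleft := hf.dirDeriv_dirDeriv hb hφ fun i => X' i p
  have hright := SmoothAt.dirDeriv_dirDeriv (m := fun q => q) (ξ := fun q c => X c q) hf
    (fun c => smoothAt_coord c (b p)) hX (φ p)
  have hcoord : ∀ c, dirDeriv (φ p) (fun q => q c) (b p) = φ p c := fun c =>
    (HasDirDerivAt.coord c).eq
  simp only [along] at hXb hXφ ⊢
  simp only [hXb, hXφ] at hleft
  simp only [hcoord] at hright
  rw [hleft, hf.dirDeriv_comm]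
  exact hright.symm

theorem along_comm {X Y : I → (I → ℝ) → ℝ} {f : (I → ℝ) → ℝ} {p : I → ℝ}
    (hX : ∀ i, SmoothAt (X i) p) (hY : ∀ i, SmoothAt (Y i) p) (hf : SmoothAt f p)
    (hXY : ∀ i, along X (Y i) p = along Y (X i) p) :
    along X (along Y f) p = along Y (along X f) p :=
  along_dirDeriv (X' := X) (b := fun q => q) (φ := fun q c => Y c q)
    (fun c => smoothAt_coord c p) hY hX hf (fun c => congrFun (along_coord X c) p) hXY

/-- The vector field `X` has smooth coefficients on `S` and is tangent to `S`, in the sense that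
it annihilates the smooth functions that vanish on `S`. -/
structure IsTangent (S : Set (I → ℝ)) (X : I → (I → ℝ) → ℝ) : Prop where
  smooth : ∀ i, ∀ p ∈ S, SmoothAt (X i) p
  zero : ∀ f : (I → ℝ) → ℝ, (∀ p ∈ S, SmoothAt f p) → (∀ p ∈ S, f p = 0) →
    ∀ p ∈ S, along X f p = 0

variable {S : Set (I → ℝ)} {X Y : I → (I → ℝ) → ℝ} {f g : (I → ℝ) → ℝ}

theorem isTangent_of_isOpen (hS : IsOpen S) (hX : ∀ i, ∀ p ∈ S, SmoothAt (X i) p) :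
    IsTangent S X where
  smooth := hX
  zero f _ h0 p hp := by
    refine ((HasDirDerivAt.const (0 : ℝ)).congr ?_).eq
    filter_upwards [hS.mem_nhds hp] with q hq using h0 q hq

theorem smoothAt_iterate_along (hX : ∀ i, ∀ p ∈ S, SmoothAt (X i) p)
    (hf : ∀ p ∈ S, SmoothAt f p) (n : ℕ) : ∀ p ∈ S, SmoothAt ((along X)^[n] f) p := by
  induction n with
  | zero => exact hf
  | succ n ih =>
    intro p hp
    rw [Function.iterate_succ_apply']
    exact (ih p hp).along fun i => hX i p hp

namespace IsTangent

theorem congr (hX : IsTangent S X) (hf : ∀ p ∈ S, SmoothAt f p)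
    (hg : ∀ p ∈ S, SmoothAt g p) (hfg : ∀ p ∈ S, f p = g p) :
    ∀ p ∈ S, along X f p = along X g p := by
  intro p hp
  have hsub := ((hf p hp).hasDirDerivAt fun i => X i p).sub ((hg p hp).hasDirDerivAt _)
  exact sub_eq_zero.1 <| hsub.eq.symm.trans <| hX.zero _
    (fun q hq => (hf q hq).sub (hg q hq)) (fun q hq => sub_eq_zero.2 (hfg q hq)) p hp

theorem iterate_comp {S' : Set (J → ℝ)} {X' : J → (J → ℝ) → ℝ} {m : (I → ℝ) → J → ℝ}
    (hX : IsTangent S X) (hX' : ∀ i, ∀ p ∈ S', SmoothAt (X' i) p)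
    (hS : ∀ p ∈ S, m p ∈ S') (hm : ∀ c, ∀ p ∈ S, SmoothAt (fun q => m q c) p)
    (hXm : ∀ c, ∀ p ∈ S, along X (fun q => m q c) p = X' c (m p))
    {f : (J → ℝ) → ℝ} (hf : ∀ p ∈ S', SmoothAt f p) (hg : ∀ p ∈ S, SmoothAt g p)
    (hgf : ∀ p ∈ S, g p = f (m p)) (n : ℕ) :
    ∀ p ∈ S, (along X)^[n] g p = (along X')^[n] f (m p) := by
  induction n with
  | zero => exact hgf
  | succ n ih =>
    intro p hp
    rw [Function.iterate_succ_apply', Function.iterate_succ_apply']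
    have hs := smoothAt_iterate_along hX' hf n
    rw [hX.congr (smoothAt_iterate_along hX.smooth hg n)
      (fun q hq => (hs _ (hS q hq)).comp fun c => hm c q hq) ih p hp]
    exact along_comp (fun c => hm c p hp) (fun c => hXm c p hp) (hs _ (hS p hp))

theorem along_iterate_comm (hX : IsTangent S X) (hY : IsTangent S Y)
    (hXY : ∀ i, ∀ p ∈ S, along X (Y i) p = along Y (X i) p) (hf : ∀ p ∈ S, SmoothAt f p) (n : ℕ) :
    ∀ p ∈ S, along Y ((along X)^[n] f) p = (along X)^[n] (along Y f) p := by
  induction n with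
  | zero => exact fun _ _ => rfl
  | succ n ih =>
    intro p hp
    rw [Function.iterate_succ_apply', Function.iterate_succ_apply']
    have hs := smoothAt_iterate_along hX.smooth hf n
    have hYf : ∀ p ∈ S, SmoothAt (along Y f) p := fun p hp =>
      (hf p hp).along fun i => hY.smooth i p hp
    rw [← along_comm (fun i => hX.smooth i p hp) (fun i => hY.smooth i p hp) (hs p hp)
      fun i => hXY i p hp]
    exact hX.congr (fun q hq => (hs q hq).along fun i => hY.smooth i q hq)
      (smoothAt_iterate_along hX.smooth hYf n) ih p hp

end IsTangent

end VectorFields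

section TriangularSystems

variable {I : Type*}

/-- On `U`, the values of `f` are determined by the coordinates of level less than `n`. -/
def DependsBelow (U : Set (I → ℝ)) (lev : I → ℕ) (n : ℕ) (f : (I → ℝ) → ℝ) : Prop :=
  ∀ p ∈ U, ∀ q ∈ U, (∀ c, lev c < n → p c = q c) → f p = f q

variable {U : Set (I → ℝ)} {lev : I → ℕ} {n : ℕ} {f : (I → ℝ) → ℝ}

namespace DependsBelow

theorem mono {m : ℕ} (h : DependsBelow U lev m f) (hmn : m ≤ n) : DependsBelow U lev n f :=
  fun p hp q hq hpq => h p hp q hq fun c hc => hpq c (hc.trans_le hmn)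

theorem dirDeriv_congr (h : DependsBelow U lev n f) (hU : IsOpen U) (hf : ∀ p ∈ U, SmoothAt f p)
    {p q ξ ζ : I → ℝ} (hp : p ∈ U) (hq : q ∈ U) (hpq : ∀ c, lev c < n → p c = q c)
    (hξζ : ∀ c, lev c < n → ξ c = ζ c) : dirDeriv ξ f p = dirDeriv ζ f q := by
  refine ((hf p hp).hasDerivAt_line ξ).unique
    (((hf q hq).hasDerivAt_line ζ).congr_of_eventuallyEq ?_)
  filter_upwards [(tendsto_line p ξ).eventually (hU.mem_nhds hp),
    (tendsto_line q ζ).eventually (hU.mem_nhds hq)] with t hpt hqt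
  refine h _ hpt _ hqt fun c hc => ?_
  simp only [Pi.add_apply, Pi.smul_apply, hpq c hc, hξζ c hc]

theorem along {X : I → (I → ℝ) → ℝ} (h : DependsBelow U lev n f) (hU : IsOpen U)
    (hf : ∀ p ∈ U, SmoothAt f p) (hX : ∀ c, lev c < n → DependsBelow U lev (n + 1) (X c)) :
    DependsBelow U lev (n + 1) (SDeform.along X f) := fun p hp q hq hpq =>
  h.dirDeriv_congr hU hf hp hq (fun c hc => hpq c (hc.trans n.lt_succ_self))
    fun c hc => hX c hc p hp q hq hpq

end DependsBelow

/-- The right-hand side of a triangular system of equations `p = T p` on `U`: the equation for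
each coordinate involves coordinates of lower level only. -/
structure IsTriangular (U : Set (I → ℝ)) (lev : I → ℕ) (T : (I → ℝ) → I → ℝ) : Prop where
  mapsTo : Set.MapsTo T U U
  dependsBelow : ∀ c, DependsBelow U lev (lev c) fun p => T p c

/-- The solution of a triangular system: the value of each coordinate has become stationary
after as many substitutions, starting from any point `p`, as its level requires. -/
def triangularSolution (lev : I → ℕ) (T : (I → ℝ) → I → ℝ) (p : I → ℝ) : I → ℝ :=
  fun c => T^[lev c + 1] p c

namespace IsTriangular

variable {T : (I → ℝ) → I → ℝ} {p q : I → ℝ}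

theorem eq_of_eq (h : IsTriangular U lev T) (hp : p ∈ U) (hq : q ∈ U) (hTp : T p = p)
    (hTq : T q = q) : p = q := by
  have hlev : ∀ n c, lev c = n → p c = q c := by
    intro n
    induction n using Nat.strong_induction_on with
    | _ n ih =>
      rintro c rfl
      rw [← congrFun hTp c, ← congrFun hTq c]
      exact h.dependsBelow c p hp q hq fun c' hc' => ih _ hc' c' rfl
  exact funext fun c => hlev _ c rfl

theorem iterate_succ_apply (h : IsTriangular U lev T) (hp : p ∈ U) (n : ℕ) :
    ∀ c, lev c < n → T^[n + 1] p c = T^[n] p c := by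
  induction n with
  | zero => exact fun c hc => absurd hc (Nat.not_lt_zero _)
  | succ n ih =>
    intro c hc
    calc T^[n + 1 + 1] p c = T (T^[n + 1] p) c := by rw [Function.iterate_succ_apply']
      _ = T (T^[n] p) c :=
        h.dependsBelow c _ (h.mapsTo.iterate _ hp) _ (h.mapsTo.iterate _ hp)
          fun c' hc' => ih c' (by omega)
      _ = T^[n + 1] p c := by rw [Function.iterate_succ_apply']

theorem iterate_apply (h : IsTriangular U lev T) (hp : p ∈ U) {n : ℕ} {c : I} (hc : lev c < n) :
    T^[n] p c = triangularSolution lev T p c := by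
  induction n, hc using Nat.le_induction with
  | base => rfl
  | succ n hn ih => rw [h.iterate_succ_apply hp n c hn, ih]

theorem solution_mem (h : IsTriangular U lev T) (hp : p ∈ U)
    (hU : ∀ p ∈ U, ∀ p' : I → ℝ, (∀ c, lev c < n → p c = p' c) → p' ∈ U) :
    triangularSolution lev T p ∈ U :=
  hU _ (h.mapsTo.iterate n hp) _ fun _ hc => h.iterate_apply hp hc

theorem apply_solution (h : IsTriangular U lev T) (hp : p ∈ U)
    (hs : triangularSolution lev T p ∈ U) :
    T (triangularSolution lev T p) = triangularSolution lev T p := by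
  funext c
  conv_rhs => rw [triangularSolution, Function.iterate_succ_apply']
  exact h.dependsBelow c _ hs _ (h.mapsTo.iterate _ hp) fun c' hc' => (h.iterate_apply hp hc').symm

end IsTriangular

theorem smoothAt_triangularSolution {T : (I → ℝ) → (I → ℝ) → I → ℝ} {r : I → ℝ}
    (hT : Set.MapsTo (T r) U U)
    (hsmooth : ∀ m : (I → ℝ) → I → ℝ, (∀ c, SmoothAt (fun r => m r c) r) → m r ∈ U →
      ∀ c, SmoothAt (fun r => T r (m r) c) r) (hr : r ∈ U) (c : I) :
    SmoothAt (fun r => triangularSolution lev (T r) r c) r := by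
  have hiter : ∀ n c, SmoothAt (fun r => (T r)^[n] r c) r := by
    intro n
    induction n with
    | zero => exact fun c => smoothAt_coord c r
    | succ n ih =>
      simp only [Function.iterate_succ_apply']
      exact hsmooth _ ih (hT.iterate n hr)
  exact hiter _ c

end TriangularSystems

open JetCoord

section Jets

variable {A K : Type*}

/-- The two independent variables, so that what holds for both total derivatives can be stated
once. -/
inductive Axis where
  | x
  | y

/-- The increment of the number of `x`-derivatives under the total derivative along an axis. -/
def Axis.dx : Axis → ℕ
  | .x => 1
  | .y => 0

/-- The increment of the number of `y`-derivatives under the total derivative along an axis. -/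
def Axis.dy : Axis → ℕ
  | .x => 0
  | .y => 1

/-- Coefficients of the total derivative along an axis on the infinite jet space. -/
def totalField : Axis → JetCoord A → (JetCoord A → ℝ) → ℝ
  | .x => jetX
  | .y => jetY

/-- The order of a jet coordinate; the independent variables have order `0`. -/
def JetCoord.ord : JetCoord A → ℕ
  | x => 0
  | y => 0
  | jet _ i j => i + j

theorem jet_induction {P : ℕ → ℕ → Prop} (zero : P 0 0)
    (step : ∀ (d : Axis) (i j : ℕ), P i j → P (i + d.dx) (j + d.dy)) (i j : ℕ) : P i j := by
  induction i with
  | zero =>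
    induction j with
    | zero => exact zero
    | succ j ih => exact step .y 0 j ih
  | succ i ih => exact step .x i j ih

theorem totalField_jet (d : Axis) (a : A) (i j : ℕ) (q : JetCoord A → ℝ) :
    totalField d (jet a i j) q = q (jet a (i + d.dx) (j + d.dy)) := by
  cases d <;> rfl

theorem smoothAt_totalField (d : Axis) (c : JetCoord A) (q : JetCoord A → ℝ) :
    SmoothAt (totalField d c) q := by
  cases d <;> cases c
  case x.x | y.y => exact smoothAt_const 1 q
  case x.y | y.x => exact smoothAt_const 0 q
  all_goals exact smoothAt_coord _ q

theorem along_totalField_comm (c : JetCoord A) :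
    along (totalField .x) (totalField .y c) = along (totalField .y) (totalField .x c) := by
  cases c with
  | x => exact (along_const _ 0).trans (along_const _ 1).symm
  | y => exact (along_const _ 1).trans (along_const _ 0).symm
  | jet a i j =>
    exact (along_coord jetX (jet a i (j + 1))).trans (along_coord jetY (jet a (i + 1) j)).symm

theorem dependsBelow_totalField (U : Set (JetCoord A → ℝ)) (d : Axis) {c : JetCoord A} {n : ℕ}
    (hc : c.ord < n) : DependsBelow U ord (n + 1) (totalField d c) := by
  cases d <;> cases c
  case x.jet | y.jet => exact fun p _ q _ h => h _ (by simp only [ord] at *; omega)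
  all_goals exact fun _ _ _ _ _ => rfl

/-- The differential consequences of the equations of a system. -/
def PDESystem.cons (E : PDESystem A K) (k : K) (i j : ℕ) : (JetCoord A → ℝ) → ℝ :=
  (along jetX)^[i] ((along jetY)^[j] (E.F k))

/-- The equations of a system are given by smooth functions on an open domain. -/
structure PDESystem.IsSmooth (E : PDESystem A K) : Prop where
  isOpen_dom : IsOpen E.dom
  smooth : ∀ k, ∀ q ∈ E.dom, SmoothAt (E.F k) q

namespace PDESystem.IsSmooth

variable {E : PDESystem A K}

theorem isTangent_totalField (h : E.IsSmooth) (d : Axis) : IsTangent E.dom (totalField d) :=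
  isTangent_of_isOpen h.isOpen_dom fun c q _ => smoothAt_totalField d c q

theorem smoothAt_cons (h : E.IsSmooth) (k : K) (i j : ℕ) :
    ∀ q ∈ E.dom, SmoothAt (E.cons k i j) q :=
  smoothAt_iterate_along (h.isTangent_totalField .x).smooth
    (smoothAt_iterate_along (h.isTangent_totalField .y).smooth (h.smooth k) j) i

theorem along_cons (h : E.IsSmooth) (d : Axis) (k : K) (i j : ℕ) :
    ∀ q ∈ E.dom, along (totalField d) (E.cons k i j) q = E.cons k (i + d.dx) (j + d.dy) q := by
  intro q hq
  cases d with
  | x => exact (congrFun (Function.iterate_succ_apply' (along jetX) i _) q).symm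
  | y =>
    have hcomm := (h.isTangent_totalField .x).along_iterate_comm (h.isTangent_totalField .y)
      (fun c q _ => congrFun (along_totalField_comm c) q)
      (smoothAt_iterate_along (h.isTangent_totalField .y).smooth (h.smooth k) j) i q hq
    exact hcomm.trans (congrArg (fun f => (along jetX)^[i] f q)
      (Function.iterate_succ_apply' (along jetY) j (E.F k)).symm)

end PDESystem.IsSmooth

/-- Each equation of the system expresses one derivative of its own dependent variable, of
multi-order `lead`, through coordinates of lower order. This is a solved form in which the
system needs no integrability conditions. -/
structure IsNormal (E : PDESystem A A) (lead : A → ℕ × ℕ) : Prop extends E.IsSmooth where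
  lower : ∀ a, DependsBelow E.dom ord ((lead a).1 + (lead a).2)
    fun q => E.F a q - q (jet a (lead a).1 (lead a).2)
  dom_of_ord : ∀ q ∈ E.dom, ∀ q' : JetCoord A → ℝ, (∀ c, ord c < 1 → q c = q' c) → q' ∈ E.dom
  lead_pos : ∀ a, 0 < (lead a).1 + (lead a).2

/-- The derivative `jet a i j` is principal: it is a derivative of the left-hand side of the
solved equation for the dependent variable `a`. -/
def IsPrincipal (lead : A → ℕ × ℕ) (a : A) (i j : ℕ) : Prop :=
  (lead a).1 ≤ i ∧ (lead a).2 ≤ j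

/-- The value of the principal derivative `jet a i j` that the system prescribes; for a normal
system it is determined by the coordinates of lower order. -/
def PDESystem.solved (E : PDESystem A A) (lead : A → ℕ × ℕ) (a : A) (i j : ℕ)
    (q : JetCoord A → ℝ) : ℝ :=
  q (jet a i j) - E.cons a (i - (lead a).1) (j - (lead a).2) q

open Classical in
/-- One substitution of the system: principal derivatives are computed from `p`, the other
coordinates are those of `r`. -/
def PDESystem.reduce (E : PDESystem A A) (lead : A → ℕ × ℕ) (r p : JetCoord A → ℝ) :
    JetCoord A → ℝ
  | x => r x
  | y => r y
  | jet a i j => if IsPrincipal lead a i j then E.solved lead a i j p else r (jet a i j)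

/-- The point of the infinite prolongation of a normal system with the same parametric
(non-principal) coordinates as `q`. -/
def PDESystem.retract (E : PDESystem A A) (lead : A → ℕ × ℕ) (q : JetCoord A → ℝ) :
    JetCoord A → ℝ :=
  triangularSolution ord (E.reduce lead q) q

namespace PDESystem

variable {E : PDESystem A A} {lead : A → ℕ × ℕ} {a : A} {i j : ℕ} {p q r : JetCoord A → ℝ}

theorem reduce_of_isPrincipal (h : IsPrincipal lead a i j) :
    E.reduce lead r p (jet a i j) = E.solved lead a i j p :=
  if_pos h

theorem reduce_of_not_isPrincipal (h : ¬ IsPrincipal lead a i j) :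
    E.reduce lead r p (jet a i j) = r (jet a i j) :=
  if_neg h

theorem mem_inf_iff_solved (lead : A → ℕ × ℕ) : q ∈ E.inf ↔ q ∈ E.dom ∧
    ∀ a i j, IsPrincipal lead a i j → E.solved lead a i j q = q (jet a i j) := by
  refine and_congr_right fun _ => ⟨fun h a i j _ => ?_, fun h a i j => ?_⟩
  · rw [solved, sub_eq_self]
    exact h a _ _
  · have hij := h a (i + (lead a).1) (j + (lead a).2)
      ⟨Nat.le_add_left _ _, Nat.le_add_left _ _⟩
    rwa [solved, sub_eq_self, Nat.add_sub_cancel, Nat.add_sub_cancel] at hij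

theorem reduce_eq_of_mem_inf (hq : q ∈ E.inf) : E.reduce lead q q = q := by
  funext c
  cases c with
  | x => rfl
  | y => rfl
  | jet a i j =>
    by_cases ha : IsPrincipal lead a i j
    · rw [reduce_of_isPrincipal ha, ((mem_inf_iff_solved lead).1 hq).2 a i j ha]
    · exact reduce_of_not_isPrincipal ha

theorem mem_inf_of_reduce_eq (hp : p ∈ E.dom) (h : E.reduce lead r p = p) : p ∈ E.inf :=
  (mem_inf_iff_solved lead).2 ⟨hp, fun a i j ha => by
    rw [← reduce_of_isPrincipal (r := r) ha, h]⟩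

end PDESystem

namespace IsNormal

open PDESystem

variable {I : Type*} {E : PDESystem A A} {lead : A → ℕ × ℕ} {q r : JetCoord A → ℝ}

theorem lower_along (h : IsNormal E lead) (d : Axis) {a : A} {i j k l n : ℕ}
    (hij : DependsBelow E.dom ord n fun q => E.cons a i j q - q (jet a k l)) :
    DependsBelow E.dom ord (n + 1)
      fun q => E.cons a (i + d.dx) (j + d.dy) q - q (jet a (k + d.dx) (l + d.dy)) := by
  have hderiv : ∀ q ∈ E.dom, HasDirDerivAt (fun q => E.cons a i j q - q (jet a k l))
      (E.cons a (i + d.dx) (j + d.dy) q - q (jet a (k + d.dx) (l + d.dy)))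
      (fun c => totalField d c q) q := fun q hq => by
    rw [← h.along_cons d a i j q hq, ← totalField_jet d a k l q]
    exact ((h.smoothAt_cons a i j q hq).hasDirDerivAt _).sub
      (.coord (ξ := fun c => totalField d c q) (jet a k l))
  intro p hp q hq hpq
  have hpq' := hij.along h.isOpen_dom (fun q hq => (hderiv q hq).smooth) (X := totalField d)
    (fun c hc => dependsBelow_totalField _ d hc) p hp q hq hpq
  rwa [along, along, (hderiv p hp).eq, (hderiv q hq).eq] at hpq'

theorem lower_cons (h : IsNormal E lead) (a : A) (i j : ℕ) :
    DependsBelow E.dom ord ((lead a).1 + i + ((lead a).2 + j))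
      fun q => E.cons a i j q - q (jet a ((lead a).1 + i) ((lead a).2 + j)) := by
  induction i, j using jet_induction with
  | zero => exact h.lower a
  | step d i j ih =>
    have hd : d.dx + d.dy = 1 := by cases d <;> rfl
    simp only [← add_assoc]
    exact (h.lower_along d ih).mono (by omega)

theorem dependsBelow_solved (h : IsNormal E lead) {a : A} {i j : ℕ}
    (ha : IsPrincipal lead a i j) : DependsBelow E.dom ord (i + j) (E.solved lead a i j) := by
  intro p hp q hq hpq
  have hlower := h.lower_cons a (i - (lead a).1) (j - (lead a).2)
  rw [Nat.add_sub_cancel' ha.1, Nat.add_sub_cancel' ha.2] at hlower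
  have := hlower p hp q hq hpq
  simp only [solved]
  linarith

theorem smoothAt_solved (h : IsNormal E lead) (a : A) (i j : ℕ) :
    ∀ q ∈ E.dom, SmoothAt (E.solved lead a i j) q :=
  fun q hq => (smoothAt_coord _ _).sub (h.smoothAt_cons _ _ _ q hq)

theorem reduce_of_ord_lt_one (h : IsNormal E lead) (r p : JetCoord A → ℝ) {c : JetCoord A}
    (hc : ord c < 1) : E.reduce lead r p c = r c := by
  cases c with
  | x => rfl
  | y => rfl
  | jet a i j =>
    refine reduce_of_not_isPrincipal fun ha => ?_
    have := h.lead_pos a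
    simp only [ord] at hc
    have := ha.1
    have := ha.2
    omega

theorem reduce_mem_dom (h : IsNormal E lead) (hr : r ∈ E.dom) (p : JetCoord A → ℝ) :
    E.reduce lead r p ∈ E.dom :=
  h.dom_of_ord r hr _ fun _ hc => (h.reduce_of_ord_lt_one r p hc).symm

theorem isTriangular_reduce (h : IsNormal E lead) (hr : r ∈ E.dom) :
    IsTriangular E.dom ord (E.reduce lead r) where
  mapsTo p _ := h.reduce_mem_dom hr p
  dependsBelow c := by
    cases c with
    | x => exact fun _ _ _ _ _ => rfl
    | y => exact fun _ _ _ _ _ => rfl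
    | jet a i j =>
      by_cases ha : IsPrincipal lead a i j
      · simp only [reduce_of_isPrincipal ha]
        exact h.dependsBelow_solved ha
      · simp only [reduce_of_not_isPrincipal ha]
        exact fun _ _ _ _ _ => rfl

theorem smoothAt_reduce (h : IsNormal E lead) {k m : (I → ℝ) → JetCoord A → ℝ} {p : I → ℝ}
    (hk : ∀ c, SmoothAt (fun p => k p c) p) (hm : ∀ c, SmoothAt (fun p => m p c) p)
    (hmp : m p ∈ E.dom) (c : JetCoord A) :
    SmoothAt (fun p => E.reduce lead (k p) (m p) c) p := by
  cases c with
  | x => exact hk x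
  | y => exact hk y
  | jet a i j =>
    by_cases ha : IsPrincipal lead a i j
    · simp only [reduce_of_isPrincipal ha]
      exact (h.smoothAt_solved a i j _ hmp).comp hm
    · simp only [reduce_of_not_isPrincipal ha]
      exact hk _

theorem eq_of_mem_inf (h : IsNormal E lead) (hq : q ∈ E.inf) (hr : r ∈ E.inf) (hx : q x = r x)
    (hy : q y = r y) (hjet : ∀ a i j, ¬ IsPrincipal lead a i j → q (jet a i j) = r (jet a i j)) :
    q = r := by
  refine (h.isTriangular_reduce hr.1).eq_of_eq hq.1 hr.1 (funext fun c => ?_)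
    (reduce_eq_of_mem_inf hr)
  cases c with
  | x => exact hx.symm
  | y => exact hy.symm
  | jet a i j =>
    by_cases ha : IsPrincipal lead a i j
    · rw [reduce_of_isPrincipal ha, ((mem_inf_iff_solved lead).1 hq).2 a i j ha]
    · rw [reduce_of_not_isPrincipal ha, hjet a i j ha]

theorem retract_mem_dom (h : IsNormal E lead) (hq : q ∈ E.dom) : E.retract lead q ∈ E.dom :=
  (h.isTriangular_reduce hq).solution_mem hq h.dom_of_ord

theorem reduce_retract (h : IsNormal E lead) (hq : q ∈ E.dom) :
    E.reduce lead q (E.retract lead q) = E.retract lead q :=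
  (h.isTriangular_reduce hq).apply_solution hq (h.retract_mem_dom hq)

theorem retract_mem_inf (h : IsNormal E lead) (hq : q ∈ E.dom) : E.retract lead q ∈ E.inf :=
  mem_inf_of_reduce_eq (h.retract_mem_dom hq) (h.reduce_retract hq)

theorem retract_eq_self (h : IsNormal E lead) (hq : q ∈ E.inf) : E.retract lead q = q :=
  (h.isTriangular_reduce hq.1).eq_of_eq (h.retract_mem_dom hq.1) hq.1 (h.reduce_retract hq.1)
    (reduce_eq_of_mem_inf hq)

theorem smoothAt_retract (h : IsNormal E lead) (hq : q ∈ E.dom) (c : JetCoord A) :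
    SmoothAt (fun q => E.retract lead q c) q :=
  smoothAt_triangularSolution (h.isTriangular_reduce hq).mapsTo
    (fun _ hm hmq => h.smoothAt_reduce (fun c => smoothAt_coord c q) hm hmq) hq c

theorem dirDeriv_retract (h : IsNormal E lead) (hq : q ∈ E.inf) {ξ : JetCoord A → ℝ}
    (hξ : ∀ a i j, dirDeriv ξ (E.cons a i j) q = 0) (c : JetCoord A) :
    dirDeriv ξ (fun q => E.retract lead q c) q = ξ c := by
  induction hn : ord c using Nat.strong_induction_on generalizing c with
  | _ n ih =>
    have hred : (fun q => E.retract lead q c)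
        =ᶠ[𝓝 q] fun q => E.reduce lead q (E.retract lead q) c := by
      filter_upwards [h.isOpen_dom.mem_nhds hq.1] with q' hq'
      rw [h.reduce_retract hq']
    cases c with
    | x => exact ((HasDirDerivAt.coord x).congr hred).eq
    | y => exact ((HasDirDerivAt.coord y).congr hred).eq
    | jet a i j =>
      by_cases ha : IsPrincipal lead a i j
      · simp only [reduce_of_isPrincipal ha] at hred
        have hsol := h.smoothAt_solved a i j
        have hsolR : SmoothAt (E.solved lead a i j) (E.retract lead q) := by
          rw [h.retract_eq_self hq]; exact hsol q hq.1
        have hR := h.smoothAt_retract hq.1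
        have hcons := ((HasDirDerivAt.coord (ξ := ξ) (jet a i j)).sub
          ((h.smoothAt_cons a (i - (lead a).1) (j - (lead a).2) q hq.1).hasDirDerivAt ξ)).eq
        rw [hξ, sub_zero] at hcons
        rw [dirDeriv_congr (hsolR.comp hR) hred, hsolR.dirDeriv_comp hR, h.retract_eq_self hq,
          ← hcons]
        exact (h.dependsBelow_solved ha).dirDeriv_congr h.isOpen_dom hsol hq.1 hq.1
          (fun _ _ => rfl) fun c hc => ih _ (hn ▸ hc) c rfl
      · simp only [reduce_of_not_isPrincipal ha] at hred
        exact ((HasDirDerivAt.coord (jet a i j)).congr hred).eq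

end IsNormal

end Jets

section TangentSystems

variable {A K : Type*}

theorem smoothAt_jetBase (c : JetCoord A) (q : JetCoord (A ⊕ A) → ℝ) :
    SmoothAt (fun q => jetBase q c) q :=
  smoothAt_coord _ q

theorem smoothAt_jetFibre (c : JetCoord A) (q : JetCoord (A ⊕ A) → ℝ) :
    SmoothAt (fun q => jetFibre q c) q := by
  cases c with
  | x => exact smoothAt_const 0 q
  | y => exact smoothAt_const 0 q
  | jet a i j => exact smoothAt_coord _ q

theorem along_jetBase (d : Axis) (c : JetCoord A) (q : JetCoord (A ⊕ A) → ℝ) :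
    along (totalField d) (fun q => jetBase q c) q = totalField d c (jetBase q) := by
  refine (congrFun (along_coord _ (c.map Sum.inl)) q).trans ?_
  cases d <;> cases c <;> rfl

theorem along_jetFibre (d : Axis) (c : JetCoord A) (q : JetCoord (A ⊕ A) → ℝ) :
    along (totalField d) (fun q => jetFibre q c) q
      = dirDeriv (jetFibre q) (totalField d c) (jetBase q) := by
  cases d <;> cases c
  case x.jet a i j =>
    exact (congrFun (along_coord _ (jet (Sum.inr a) i j)) q).trans
      (HasDirDerivAt.coord (ξ := jetFibre q) (p := jetBase q) (jet a (i + 1) j)).eq.symm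
  case y.jet a i j =>
    exact (congrFun (along_coord _ (jet (Sum.inr a) i j)) q).trans
      (HasDirDerivAt.coord (ξ := jetFibre q) (p := jetBase q) (jet a i (j + 1))).eq.symm
  all_goals exact (congrFun (along_const _ 0) q).trans (HasDirDerivAt.const _).eq.symm

theorem along_comp_jetBase (d : Axis) {f : (JetCoord A → ℝ) → ℝ} {q : JetCoord (A ⊕ A) → ℝ}
    (hf : SmoothAt f (jetBase q)) :
    along (totalField d) (fun q => f (jetBase q)) q = along (totalField d) f (jetBase q) :=
  along_comp (fun c => smoothAt_jetBase c q) (fun c => along_jetBase d c q) hf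

/-- The variation of a function on the jet space of `A`: its derivative along the vertical vector
that is encoded by a point of the jet space of `A ⊕ A`. -/
def variation (f : (JetCoord A → ℝ) → ℝ) (q : JetCoord (A ⊕ A) → ℝ) : ℝ :=
  dirDeriv (jetFibre q) f (jetBase q)

theorem along_variation (d : Axis) {f : (JetCoord A → ℝ) → ℝ} {q : JetCoord (A ⊕ A) → ℝ}
    (hf : SmoothAt f (jetBase q)) :
    along (totalField d) (variation f) q = variation (along (totalField d) f) q :=
  along_dirDeriv (fun c => smoothAt_jetBase c q) (fun c => smoothAt_jetFibre c q)
    (fun c => smoothAt_totalField d c _) hf (fun c => along_jetBase d c q)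
    fun c => along_jetFibre d c q

theorem smoothAt_comp_jetBase {f : (JetCoord A → ℝ) → ℝ} {q : JetCoord (A ⊕ A) → ℝ}
    (hf : SmoothAt f (jetBase q)) : SmoothAt (fun q => f (jetBase q)) q :=
  hf.comp fun c => smoothAt_jetBase c q

theorem smoothAt_variation {f : (JetCoord A → ℝ) → ℝ} {q : JetCoord (A ⊕ A) → ℝ}
    (hf : SmoothAt f (jetBase q)) : SmoothAt (variation f) q :=
  hf.dirDeriv (fun c => smoothAt_jetBase c q) fun c => smoothAt_jetFibre c q

theorem ord_map {B : Type*} (f : A → B) (c : JetCoord A) : (c.map f).ord = c.ord := by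
  cases c <;> rfl

theorem jetFibre_congr {p q : JetCoord (A ⊕ A) → ℝ} {n : ℕ} (h : ∀ c, ord c < n → p c = q c) :
    ∀ c, ord c < n → jetFibre p c = jetFibre q c
  | x, _ => rfl
  | y, _ => rfl
  | jet a i j, hc => h (jet (Sum.inr a) i j) hc

namespace PDESystem.IsSmooth

variable {E : PDESystem A K}

theorem tangent (h : E.IsSmooth) : E.tangent.IsSmooth where
  isOpen_dom := h.isOpen_dom.preimage (continuous_pi fun c => continuous_apply (c.map Sum.inl))
  smooth
    | .inl k, _, hq => smoothAt_comp_jetBase (h.smooth k _ hq)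
    | .inr k, _, hq => smoothAt_variation (h.smooth k _ hq)

theorem cons_tangent_inl (h : E.IsSmooth) (k : K) (i j : ℕ) :
    ∀ q ∈ E.tangent.dom, E.tangent.cons (Sum.inl k) i j q = E.cons k i j (jetBase q) := by
  induction i, j using jet_induction with
  | zero => exact fun _ _ => rfl
  | step d i j ih =>
    intro q hq
    have hcons := h.smoothAt_cons k i j
    rw [← h.tangent.along_cons d _ i j q hq, ← h.along_cons d k i j _ hq,
      (h.tangent.isTangent_totalField d).congr (h.tangent.smoothAt_cons _ i j)
        (fun q hq => smoothAt_comp_jetBase (hcons _ hq)) ih q hq]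
    exact along_comp_jetBase d (hcons _ hq)

theorem cons_tangent_inr (h : E.IsSmooth) (k : K) (i j : ℕ) :
    ∀ q ∈ E.tangent.dom, E.tangent.cons (Sum.inr k) i j q = variation (E.cons k i j) q := by
  induction i, j using jet_induction with
  | zero => exact fun _ _ => rfl
  | step d i j ih =>
    intro q hq
    have hcons := h.smoothAt_cons k i j
    have hstep : E.cons k (i + d.dx) (j + d.dy)
        =ᶠ[𝓝 (jetBase q)] along (totalField d) (E.cons k i j) := by
      filter_upwards [h.isOpen_dom.mem_nhds hq] with q hq
      exact (h.along_cons d k i j q hq).symm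
    rw [← h.tangent.along_cons d _ i j q hq,
      (h.tangent.isTangent_totalField d).congr (h.tangent.smoothAt_cons _ i j)
        (fun q hq => smoothAt_variation (hcons _ hq)) ih q hq,
      variation, dirDeriv_congr ((hcons _ hq).along fun c => smoothAt_totalField d c _) hstep]
    exact along_variation d (hcons _ hq)

theorem mem_tangent_inf_iff (h : E.IsSmooth) {q : JetCoord (A ⊕ A) → ℝ} :
    q ∈ E.tangent.inf ↔ jetBase q ∈ E.inf ∧ ∀ k i j, variation (E.cons k i j) q = 0 := by
  refine ⟨fun hq => ⟨⟨hq.1, fun k i j => ?_⟩, fun k i j => ?_⟩,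
    fun hq => ⟨hq.1.1, Sum.rec (fun k i j => ?_) fun k i j => ?_⟩⟩
  · exact (h.cons_tangent_inl k i j q hq.1).symm.trans (hq.2 (Sum.inl k) i j)
  · exact (h.cons_tangent_inr k i j q hq.1).symm.trans (hq.2 (Sum.inr k) i j)
  · exact (h.cons_tangent_inl k i j q hq.1.1).trans (hq.1.2 k i j)
  · exact (h.cons_tangent_inr k i j q hq.1.1).trans (hq.2 k i j)

end PDESystem.IsSmooth

theorem IsNormal.tangent {E : PDESystem A A} {lead : A → ℕ × ℕ} (h : IsNormal E lead) :
    IsNormal E.tangent (Sum.elim lead lead) where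
  toIsSmooth := h.toIsSmooth.tangent
  lower := by
    rintro (a | a) p hp q hq hpq
    · exact h.lower a _ hp _ hq fun c hc => hpq _ (by rwa [ord_map])
    · have hvar : ∀ q ∈ E.tangent.dom,
          variation (fun q => E.F a q - q (jet a (lead a).1 (lead a).2)) q
            = variation (E.F a) q - q (jet (Sum.inr a) (lead a).1 (lead a).2) := fun q hq =>
        (((h.smooth a _ hq).hasDirDerivAt (jetFibre q)).sub (.coord _)).eq
      have hlower := (h.lower a).dirDeriv_congr h.isOpen_dom
        (fun q hq => (h.smooth a q hq).sub (smoothAt_coord _ _)) hp hq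
        (fun c hc => hpq _ (by rwa [ord_map])) (jetFibre_congr hpq)
      exact (hvar p hp).symm.trans (hlower.trans (hvar q hq))
  dom_of_ord q hq q' hqq' := h.dom_of_ord _ hq _ fun c hc => hqq' _ (by rwa [ord_map])
  lead_pos := Sum.rec h.lead_pos h.lead_pos

end TangentSystems

section Coverings

variable {A A' K W : Type*}

namespace Cov

section

variable {E : PDESystem A K} (C : Cov E W)

/-- The derivatives of the fibre coordinates of a covering along an axis. -/
def coef : Axis → W → (JetCoord A ⊕ W → ℝ) → ℝ
  | .x => C.X
  | .y => C.Y

/-- The coefficients of the lifted total derivative along an axis. -/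
def field (d : Axis) : JetCoord A ⊕ W → (JetCoord A ⊕ W → ℝ) → ℝ :=
  Sum.elim (fun c p => totalField d c (p ∘ Sum.inl)) (C.coef d)

theorem smoothAt_comp_inl {f : (JetCoord A → ℝ) → ℝ} {p : JetCoord A ⊕ W → ℝ}
    (h : SmoothAt f (p ∘ Sum.inl)) : SmoothAt (fun p : JetCoord A ⊕ W → ℝ => f (p ∘ Sum.inl)) p :=
  SmoothAt.comp (m := fun p : JetCoord A ⊕ W → ℝ => p ∘ Sum.inl) h
    fun c => smoothAt_coord (Sum.inl c) p

theorem dirDeriv_comp_inl {f : (JetCoord A → ℝ) → ℝ} {p : JetCoord A ⊕ W → ℝ}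
    (h : SmoothAt f (p ∘ Sum.inl)) (ξ : JetCoord A ⊕ W → ℝ) :
    dirDeriv ξ (fun p : JetCoord A ⊕ W → ℝ => f (p ∘ Sum.inl)) p
      = dirDeriv (ξ ∘ Sum.inl) f (p ∘ Sum.inl) :=
  (SmoothAt.dirDeriv_comp (m := fun p : JetCoord A ⊕ W → ℝ => p ∘ Sum.inl) h
    (fun c => smoothAt_coord (Sum.inl c) p) ξ).trans
    (congrArg (fun ξ => dirDeriv ξ f (p ∘ Sum.inl))
      (funext fun c => (HasDirDerivAt.coord (Sum.inl c)).eq))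

theorem along_field_coord (d : Axis) (a : A) (i j : ℕ) :
    along (C.field d) (fun p => p (Sum.inl (jet a i j)))
      = fun p => p (Sum.inl (jet a (i + d.dx) (j + d.dy))) := by
  rw [along_coord]
  exact funext fun p => totalField_jet d a i j (p ∘ Sum.inl)

theorem iterate_coord (a : A) (i j : ℕ) :
    C.Dx^[i] (C.Dy^[j] fun p => p (Sum.inl (jet a 0 0))) = fun p => p (Sum.inl (jet a i j)) := by
  have hy : C.Dy^[j] (fun p => p (Sum.inl (jet a 0 0))) = fun p => p (Sum.inl (jet a 0 j)) := by
    induction j with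
    | zero => rfl
    | succ j ih => rw [Function.iterate_succ_apply', ih]; exact C.along_field_coord .y a 0 j
  rw [hy]
  induction i with
  | zero => rfl
  | succ i ih => rw [Function.iterate_succ_apply', ih]; exact C.along_field_coord .x a i j

theorem prol_depVar (p : JetCoord A ⊕ W → ℝ) : C.prol depVar p = p ∘ Sum.inl := by
  funext c
  cases c with
  | x => rfl
  | y => rfl
  | jet a i j => exact congrFun (C.iterate_coord a i j) p

theorem along_field_comp_inl (d : Axis) {f : (JetCoord A → ℝ) → ℝ} {p : JetCoord A ⊕ W → ℝ}
    (h : SmoothAt f (p ∘ Sum.inl)) :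
    along (C.field d) (fun p => f (p ∘ Sum.inl)) p = along (totalField d) f (p ∘ Sum.inl) :=
  dirDeriv_comp_inl h _

theorem jetBase_prol {E : PDESystem (A ⊕ A) K} (C : Cov E W)
    {φ : A ⊕ A → (JetCoord (A ⊕ A) ⊕ W → ℝ) → ℝ} (hφ : ∀ a, φ (Sum.inl a) = depVar (Sum.inl a))
    (p : JetCoord (A ⊕ A) ⊕ W → ℝ) : jetBase (C.prol φ p) = jetBase (p ∘ Sum.inl) := by
  funext c
  cases c with
  | x => rfl
  | y => rfl
  | jet a i j =>
    calc C.Dx^[i] (C.Dy^[j] (φ (Sum.inl a))) p = C.Dx^[i] (C.Dy^[j] (depVar (Sum.inl a))) p := by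
          rw [hφ]
      _ = p (Sum.inl (jet (Sum.inl a) i j)) := congrFun (C.iterate_coord (Sum.inl a) i j) p

theorem hasDirDerivAt_comp_jetBase {E : PDESystem (A ⊕ A) K} (C : Cov E W) (d : Axis)
    {f : (JetCoord A → ℝ) → ℝ} {p : JetCoord (A ⊕ A) ⊕ W → ℝ}
    (hf : SmoothAt f (jetBase (p ∘ Sum.inl))) :
    HasDirDerivAt (fun p => f (jetBase (p ∘ Sum.inl)))
      (along (totalField d) f (jetBase (p ∘ Sum.inl))) (fun c => C.field d c p) p :=
  ⟨smoothAt_comp_inl (smoothAt_comp_jetBase hf),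
    (C.along_field_comp_inl d (smoothAt_comp_jetBase hf)).trans (along_comp_jetBase d hf)⟩

theorem hasDirDerivAt_variation {E : PDESystem (A ⊕ A) K} (C : Cov E W) (d : Axis)
    {f : (JetCoord A → ℝ) → ℝ} {p : JetCoord (A ⊕ A) ⊕ W → ℝ}
    (hf : SmoothAt f (jetBase (p ∘ Sum.inl))) :
    HasDirDerivAt (fun p => variation f (p ∘ Sum.inl))
      (variation (along (totalField d) f) (p ∘ Sum.inl)) (fun c => C.field d c p) p :=
  ⟨smoothAt_comp_inl (smoothAt_variation hf),
    (C.along_field_comp_inl d (smoothAt_variation hf)).trans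
      (along_variation d hf)⟩

variable {C}

theorem smoothAt_field {S : Set (JetCoord A ⊕ W → ℝ)} {d : Axis}
    (h : ∀ w, ∀ p ∈ S, SmoothAt (C.coef d w) p) : ∀ c, ∀ p ∈ S, SmoothAt (C.field d c) p
  | .inl c, _, _ => smoothAt_comp_inl (smoothAt_totalField d c _)
  | .inr w, p, hp => h w p hp

theorem smoothAt_prol_jet {S : Set (JetCoord A ⊕ W → ℝ)}
    (h : ∀ d w, ∀ p ∈ S, SmoothAt (C.coef d w) p) {φ : A' → (JetCoord A ⊕ W → ℝ) → ℝ} {a : A'}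
    (hφ : ∀ p ∈ S, SmoothAt (φ a) p) (i j : ℕ) :
    ∀ p ∈ S, SmoothAt (fun p => C.prol φ p (jet a i j)) p :=
  smoothAt_iterate_along (smoothAt_field (h .x))
    (smoothAt_iterate_along (smoothAt_field (h .y)) hφ j) i

namespace IsCovering

theorem smoothAt_coef (h : C.IsCovering) : ∀ d w, ∀ p ∈ C.pts, SmoothAt (C.coef d w) p
  | .x => h.smooth_X
  | .y => h.smooth_Y

theorem along_field_comm (h : C.IsCovering) : ∀ c, ∀ p ∈ C.pts,
    along (C.field .x) (C.field .y c) p = along (C.field .y) (C.field .x c) p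
  | .inl c, p, _ =>
    ((C.along_field_comp_inl .x (smoothAt_totalField .y c _)).trans
      (congrFun (along_totalField_comm c) (p ∘ Sum.inl))).trans
        (C.along_field_comp_inl .y (smoothAt_totalField .x c _)).symm
  | .inr w, p, hp => h.comm w p hp

theorem smoothAt_prol (h : C.IsCovering) {φ : A' → (JetCoord A ⊕ W → ℝ) → ℝ}
    (hφ : ∀ a, ∀ p ∈ C.pts, SmoothAt (φ a) p) :
    ∀ c, ∀ p ∈ C.pts, SmoothAt (fun q => C.prol φ q c) p
  | x, _, _ => smoothAt_coord _ _
  | y, _, _ => smoothAt_coord _ _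
  | jet a i j, p, hp => smoothAt_prol_jet h.smoothAt_coef (hφ a) i j p hp

end IsCovering

end

variable {E : PDESystem A A} {lead : A → ℕ × ℕ} {C : Cov E W}

theorem dirDeriv_eq_zero (hE : IsNormal E lead) (hC : IsOpen C.dom)
    {f : (JetCoord A ⊕ W → ℝ) → ℝ} {p ξ : JetCoord A ⊕ W → ℝ} (hp : p ∈ C.pts)
    (hf : SmoothAt f p) (h0 : ∀ p ∈ C.pts, f p = 0)
    (hξ : ∀ a i j, dirDeriv (ξ ∘ Sum.inl) (E.cons a i j) (p ∘ Sum.inl) = 0) :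
    dirDeriv ξ f p = 0 := by
  let R : (JetCoord A ⊕ W → ℝ) → JetCoord A ⊕ W → ℝ := fun q =>
    Sum.elim (E.retract lead (q ∘ Sum.inl)) (q ∘ Sum.inr)
  have hRp : R p = p := by
    simp only [R, hE.retract_eq_self hp.1, Sum.elim_comp_inl_inr]
  have hR : ∀ c, SmoothAt (fun q => R q c) p := by
    rintro (c | w)
    · exact smoothAt_comp_inl (hE.smoothAt_retract hp.1.1 c)
    · exact smoothAt_coord _ _
  have hdR : (fun c => dirDeriv ξ (fun q => R q c) p) = ξ := by
    funext c
    rcases c with c | w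
    · exact (dirDeriv_comp_inl (hE.smoothAt_retract hp.1.1 c) ξ).trans
        (hE.dirDeriv_retract hp.1 hξ c)
    · exact (HasDirDerivAt.coord (Sum.inr w)).eq
  have hinl : ContinuousAt (fun q : JetCoord A ⊕ W → ℝ => q ∘ Sum.inl) p :=
    (continuous_pi fun c => continuous_apply _).continuousAt
  have hfR : (fun q => f (R q)) =ᶠ[𝓝 p] fun _ => 0 := by
    filter_upwards [(continuousAt_of_smoothAt hR).eventually (hC.mem_nhds (hRp.symm ▸ hp.2)),
      hinl.eventually (hE.isOpen_dom.mem_nhds hp.1.1)] with q hRq hq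
    exact h0 _ ⟨hE.retract_mem_inf hq, hRq⟩
  calc dirDeriv ξ f p = dirDeriv ξ (fun q => f (R q)) p := by
        rw [SmoothAt.dirDeriv_comp (hRp.symm ▸ hf) hR, hdR, hRp]
    _ = 0 := ((HasDirDerivAt.const 0).congr hfR).eq

theorem isTangent_field (hE : IsNormal E lead) (hC : IsOpen C.dom) {d : Axis}
    (h : ∀ w, ∀ p ∈ C.pts, SmoothAt (C.coef d w) p) : IsTangent C.pts (C.field d) where
  smooth := smoothAt_field h
  zero _ hf h0 p hp := dirDeriv_eq_zero hE hC hp (hf p hp) h0 fun a i j =>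
    (hE.along_cons d a i j _ hp.1.1).trans (hp.1.2 a _ _)

namespace IsCovering

theorem isTangent_field (hC : C.IsCovering) (hE : IsNormal E lead) (d : Axis) :
    IsTangent C.pts (C.field d) :=
  Cov.isTangent_field hE hC.isOpen_dom (hC.smoothAt_coef d)

theorem along_prol (hC : C.IsCovering) (hE : IsNormal E lead)
    {φ : A' → (JetCoord A ⊕ W → ℝ) → ℝ} (hφ : ∀ a, ∀ p ∈ C.pts, SmoothAt (φ a) p) (d : Axis)
    (c : JetCoord A') {p : JetCoord A ⊕ W → ℝ} (hp : p ∈ C.pts) :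
    along (C.field d) (fun q => C.prol φ q c) p = totalField d c (C.prol φ p) := by
  cases d <;> cases c
  case x.jet a i j => exact (congrFun (Function.iterate_succ_apply' C.Dx i _) p).symm
  case y.jet a i j =>
    have hcomm := (hC.isTangent_field hE .x).along_iterate_comm (hC.isTangent_field hE .y)
      hC.along_field_comm
      (smoothAt_iterate_along (hC.isTangent_field hE .y).smooth (hφ a) j) i p hp
    exact hcomm.trans (congrArg (fun f => C.Dx^[i] f p)
      (Function.iterate_succ_apply' C.Dy j (φ a)).symm)
  all_goals exact congrFun (along_coord _ _) p

theorem variation_along_prol {B : Type*} (hC : C.IsCovering) (hE : IsNormal E lead)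
    {φ : B ⊕ B → (JetCoord A ⊕ W → ℝ) → ℝ} (hφ : ∀ a, ∀ p ∈ C.pts, SmoothAt (φ a) p) (d : Axis)
    {f : (JetCoord B → ℝ) → ℝ} {p : JetCoord A ⊕ W → ℝ} (hp : p ∈ C.pts)
    (hf : SmoothAt f (jetBase (C.prol φ p))) :
    variation (along (totalField d) f) (C.prol φ p)
      = along (C.field d) (fun p => variation f (C.prol φ p)) p :=
  ((along_comp (fun c => hC.smoothAt_prol hφ c p hp) (fun c => hC.along_prol hE hφ d c hp)
    (smoothAt_variation hf)).trans (along_variation d hf)).symm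

theorem isMorphism (hC : C.IsCovering) (hE : IsNormal E lead) {K' : Type*}
    {E' : PDESystem A' K'} (hE' : E'.IsSmooth)
    {φ : A' → (JetCoord A ⊕ W → ℝ) → ℝ} (hφ : ∀ a, ∀ p ∈ C.pts, SmoothAt (φ a) p)
    (hdom : ∀ p ∈ C.pts, C.prol φ p ∈ E'.dom)
    (hF : ∀ k, ∀ p ∈ C.pts, E'.F k (C.prol φ p) = 0) : C.IsMorphism E' φ := by
  have hprol := hC.smoothAt_prol hφ
  have hcons : ∀ k i j, ∀ p ∈ C.pts, E'.cons k i j (C.prol φ p) = 0 := by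
    intro k i j
    induction i, j using jet_induction with
    | zero => exact hF k
    | step d i j ih =>
      intro p hp
      have hs := fun p hp => hE'.smoothAt_cons k i j _ (hdom p hp)
      rw [← hE'.along_cons d k i j _ (hdom p hp), ← along_comp (fun c => hprol c p hp)
        (fun c => hC.along_prol hE hφ d c hp) (hs p hp)]
      exact (hC.isTangent_field hE d).zero _
        (fun p hp => (hs p hp).comp fun c => hprol c p hp) ih p hp
  exact ⟨hφ, fun p hp => ⟨hdom p hp, fun k i j => hcons k i j p hp⟩,
    fun c p => hC.along_prol hE hφ .x c, fun c p => hC.along_prol hE hφ .y c⟩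

theorem isCoveringOver_depVar (hC : C.IsCovering) (hE : IsNormal E lead)
    (hdom : C.dom = Set.univ) : C.IsCoveringOver E depVar W := by
  refine ⟨hC.isMorphism hE hE.toIsSmooth (fun a p _ => smoothAt_coord _ _)
    (fun p hp => by rw [prol_depVar]; exact hp.1.1)
    (fun a p hp => by rw [prol_depVar]; exact hp.1.2 a 0 0), fun n p => p (Sum.inr n),
    fun c r => r c, fun n p _ => smoothAt_coord _ _, fun c r _ => smoothAt_coord _ _,
    fun p _ => ?_, fun r hr => ⟨⟨hr, hdom ▸ Set.mem_univ _⟩, ?_⟩⟩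
  all_goals
    rw [prol_depVar]
    exact Sum.elim_comp_inl_inr _

end IsCovering

end Cov

end Coverings

section TangentCoverings

variable {A W : Type*} {E : PDESystem A A} {lead : A → ℕ × ℕ} {C : Cov E W}

namespace Cov

theorem smoothAt_tangentBase (c : JetCoord A ⊕ W) (p : JetCoord (A ⊕ A) ⊕ (W ⊕ W) → ℝ) :
    SmoothAt (fun p => tangentBase p c) p := by
  rcases c with c | w <;> exact smoothAt_coord _ p

theorem smoothAt_tangentFibre (c : JetCoord A ⊕ W) (p : JetCoord (A ⊕ A) ⊕ (W ⊕ W) → ℝ) :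
    SmoothAt (fun p => tangentFibre p c) p := by
  rcases c with c | w
  · exact smoothAt_comp_inl (smoothAt_jetFibre c _)
  · exact smoothAt_coord _ p

theorem tangentBase_mem_pts (hE : E.IsSmooth) {p : JetCoord (A ⊕ A) ⊕ (W ⊕ W) → ℝ}
    (hp : p ∈ C.tangent.pts) : tangentBase p ∈ C.pts :=
  ⟨(hE.mem_tangent_inf_iff.1 hp.1).1, hp.2⟩

theorem coef_tangent_inl (d : Axis) (w : W) (p : JetCoord (A ⊕ A) ⊕ (W ⊕ W) → ℝ) :
    C.tangent.coef d (Sum.inl w) p = C.coef d w (tangentBase p) := by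
  cases d <;> rfl

theorem coef_tangent_inr (d : Axis) (w : W) (p : JetCoord (A ⊕ A) ⊕ (W ⊕ W) → ℝ) :
    C.tangent.coef d (Sum.inr w) p = dirDeriv (tangentFibre p) (C.coef d w) (tangentBase p) := by
  cases d <;> rfl

theorem along_tangentBase (d : Axis) (c : JetCoord A ⊕ W)
    (p : JetCoord (A ⊕ A) ⊕ (W ⊕ W) → ℝ) :
    along (C.tangent.field d) (fun p => tangentBase p c) p = C.field d c (tangentBase p) := by
  rcases c with c | w
  · exact (C.tangent.along_field_comp_inl d (smoothAt_jetBase c _)).trans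
      (along_jetBase d c (p ∘ Sum.inl))
  · exact (congrFun (along_coord _ (Sum.inr (Sum.inl w))) p).trans (coef_tangent_inl d w p)

theorem along_tangentFibre (d : Axis) (c : JetCoord A ⊕ W)
    (p : JetCoord (A ⊕ A) ⊕ (W ⊕ W) → ℝ) :
    along (C.tangent.field d) (fun p => tangentFibre p c) p
      = dirDeriv (tangentFibre p) (C.field d c) (tangentBase p) := by
  rcases c with c | w
  · exact ((C.tangent.along_field_comp_inl d (smoothAt_jetFibre c _)).trans
      (along_jetFibre d c (p ∘ Sum.inl))).trans
        (dirDeriv_comp_inl (p := tangentBase p) (smoothAt_totalField d c _)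
          (tangentFibre p)).symm
  · exact (congrFun (along_coord _ (Sum.inr (Sum.inr w))) p).trans (coef_tangent_inr d w p)

theorem IsCovering.along_dirDeriv_tangent (hC : C.IsCovering) (hE : E.IsSmooth) (d : Axis)
    {f : (JetCoord A ⊕ W → ℝ) → ℝ} {p : JetCoord (A ⊕ A) ⊕ (W ⊕ W) → ℝ}
    (hp : p ∈ C.tangent.pts) (hf : SmoothAt f (tangentBase p)) :
    along (C.tangent.field d) (fun p => dirDeriv (tangentFibre p) f (tangentBase p)) p
      = dirDeriv (tangentFibre p) (along (C.field d) f) (tangentBase p) :=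
  along_dirDeriv (fun c => smoothAt_tangentBase c p) (fun c => smoothAt_tangentFibre c p)
    (fun c => smoothAt_field (hC.smoothAt_coef d) c _ (tangentBase_mem_pts hE hp)) hf
    (fun c => along_tangentBase d c p) fun c => along_tangentFibre d c p

theorem smoothAt_coef_tangent {d : Axis} {p : JetCoord (A ⊕ A) ⊕ (W ⊕ W) → ℝ}
    (h : ∀ w, SmoothAt (C.coef d w) (tangentBase p)) : ∀ w, SmoothAt (C.tangent.coef d w) p
  | .inl w => ((h w).comp fun c => smoothAt_tangentBase c p).congr
      (.of_forall fun q => coef_tangent_inl d w q)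
  | .inr w => ((h w).dirDeriv (fun c => smoothAt_tangentBase c p)
      fun c => smoothAt_tangentFibre c p).congr (.of_forall fun q => coef_tangent_inr d w q)

theorem IsCovering.smoothAt_coef_tangent (hC : C.IsCovering) (hE : E.IsSmooth) (d : Axis) :
    ∀ w, ∀ p ∈ C.tangent.pts, SmoothAt (C.tangent.coef d w) p := fun w _ hp =>
  Cov.smoothAt_coef_tangent (fun w => hC.smoothAt_coef d w _ (tangentBase_mem_pts hE hp)) w

theorem IsCovering.tangent (hC : C.IsCovering) (hE : IsNormal E lead) :
    C.tangent.IsCovering where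
  isOpen_dom := hC.isOpen_dom.preimage (continuous_iff_continuousAt.2 fun p =>
    continuousAt_of_smoothAt fun c => smoothAt_tangentBase c p)
  smooth_X := hC.smoothAt_coef_tangent hE.toIsSmooth .x
  smooth_Y := hC.smoothAt_coef_tangent hE.toIsSmooth .y
  comm := by
    rintro (w | w) p hp
    all_goals
      have hbase := tangentBase_mem_pts hE.toIsSmooth hp
      have hX := hC.smooth_X w _ hbase
      have hY := hC.smooth_Y w _ hbase
    · calc C.tangent.Dx (fun p => C.Y w (tangentBase p)) p
          = C.Dx (C.Y w) (tangentBase p) := along_comp (fun c => smoothAt_tangentBase c p)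
            (fun c => along_tangentBase .x c p) hY
        _ = C.Dy (C.X w) (tangentBase p) := hC.comm w _ hbase
        _ = C.tangent.Dy (fun p => C.X w (tangentBase p)) p :=
          (along_comp (fun c => smoothAt_tangentBase c p)
            (fun c => along_tangentBase .y c p) hX).symm
    · have hDY := hY.along fun c => smoothAt_field (hC.smoothAt_coef .x) c _ hbase
      have hDX := hX.along fun c => smoothAt_field (hC.smoothAt_coef .y) c _ hbase
      have hcomm := dirDeriv_eq_zero (ξ := tangentFibre p) hE hC.isOpen_dom hbase
        (hDY.sub hDX) (fun p hp => sub_eq_zero.2 (hC.comm w p hp))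
        (hE.mem_tangent_inf_iff.1 hp.1).2
      rw [((hDY.hasDirDerivAt _).sub (hDX.hasDirDerivAt _)).eq, sub_eq_zero] at hcomm
      exact ((hC.along_dirDeriv_tangent hE.toIsSmooth .x hp hY).trans hcomm).trans
        (hC.along_dirDeriv_tangent hE.toIsSmooth .y hp hX).symm

end Cov

end TangentCoverings

open Dep

section System

variable {J₁ J₂ : Set ℝ} {η₁ η₂ : ℝ → ℝ}

/-- The parameters of the system are smooth functions on open sets. -/
structure SmoothData (J₁ J₂ : Set ℝ) (η₁ η₂ : ℝ → ℝ) : Prop where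
  isOpen₁ : IsOpen J₁
  isOpen₂ : IsOpen J₂
  contDiffOn₁ : ContDiffOn ℝ ∞ η₁ J₁
  contDiffOn₂ : ContDiffOn ℝ ∞ η₂ J₂

theorem HasDirDerivAt.contDiffOn {I : Type*} {f : (I → ℝ) → ℝ} {d : ℝ} {ξ p : I → ℝ}
    {J : Set ℝ} {h : ℝ → ℝ} (hJ : IsOpen J) (hh : ContDiffOn ℝ ∞ h J)
    (hf : HasDirDerivAt f d ξ p) (hp : f p ∈ J) :
    HasDirDerivAt (fun q => h (f q)) (deriv h (f p) * d) ξ p :=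
  hf.scalar <| by filter_upwards [hJ.mem_nhds hp] with z hz using hh.contDiffAt (hJ.mem_nhds hz)

/-- The derivatives of the angle `s₀` along the axes. -/
def angle : Axis → (JetCoord Dep → ℝ) → ℝ
  | .x, q => q (jet u 0 1) / q (jet v 0 0)
  | .y, q => -(q (jet v 1 0) / q (jet u 0 0))

/-- The two expressions for the mixed derivative of the angle `s₀`; the one that contains the
leading derivative of the unknown `a` is indexed by `a`. -/
def crossAngle : Dep → (JetCoord Dep → ℝ) → ℝ
  | .u => along jetY (angle .x)
  | .v => along jetX (angle .y)

/-- The value that the system assigns to `(η₂ - η₁) * (s₀)_xy`. -/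
def angleXY (η₁ η₂ : ℝ → ℝ) (q : JetCoord Dep → ℝ) : ℝ :=
  1 / 2 * deriv η₁ (q x) * angle .y q - 1 / 2 * deriv η₂ (q y) * angle .x q
    - q (jet u 0 0) * q (jet v 0 0)

/-- The multi-orders of the left-hand sides `u_yy` and `v_xx` of the system. -/
def leadEta : Dep → ℕ × ℕ
  | .u => (0, 2)
  | .v => (2, 0)

variable {q ξ : JetCoord Dep → ℝ}

theorem hasDirDerivAt_angle_x (hv : q (jet v 0 0) ≠ 0) (ξ : JetCoord Dep → ℝ) :
    HasDirDerivAt (angle .x) ((ξ (jet u 0 1) - angle .x q * ξ (jet v 0 0)) / q (jet v 0 0)) ξ q :=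
  ((HasDirDerivAt.coord (jet u 0 1)).div (.coord (jet v 0 0)) hv).congr_deriv <| by
    simp only [angle]
    field_simp

theorem hasDirDerivAt_angle_y (hu : q (jet u 0 0) ≠ 0) (ξ : JetCoord Dep → ℝ) :
    HasDirDerivAt (angle .y) (-(ξ (jet v 1 0) + angle .y q * ξ (jet u 0 0)) / q (jet u 0 0)) ξ q :=
  ((HasDirDerivAt.coord (jet v 1 0)).div (.coord (jet u 0 0)) hu).neg.congr_deriv <| by
    simp only [angle]
    field_simp
    ring

theorem crossAngle_u (hv : q (jet v 0 0) ≠ 0) :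
    crossAngle u q = (q (jet u 0 2) - angle .x q * q (jet v 0 1)) / q (jet v 0 0) :=
  (hasDirDerivAt_angle_x hv fun c => jetY c q).eq

theorem crossAngle_v (hu : q (jet u 0 0) ≠ 0) :
    crossAngle v q = -(q (jet v 2 0) + angle .y q * q (jet u 1 0)) / q (jet u 0 0) :=
  (hasDirDerivAt_angle_y hu fun c => jetX c q).eq

/-- The nonvanishing factor by which an equation of the system differs from the corresponding
expression for the mixed derivative of `s₀`. -/
def eqFactor (η₁ η₂ : ℝ → ℝ) : Dep → (JetCoord Dep → ℝ) → ℝ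
  | .u, q => q (jet v 0 0) / (η₂ (q y) - η₁ (q x))
  | .v, q => -q (jet u 0 0) / (η₂ (q y) - η₁ (q x))

theorem sysEta_F_eq (a : Dep) (hq : q ∈ (sysEta J₁ J₂ η₁ η₂).dom) :
    (sysEta J₁ J₂ η₁ η₂).F a q
      = eqFactor η₁ η₂ a q * ((η₂ (q y) - η₁ (q x)) * crossAngle a q - angleXY η₁ η₂ q) := by
  obtain ⟨-, -, hη, hu, hv⟩ := hq
  have h₁₂ := sub_ne_zero.2 hη
  have h₂₁ := sub_ne_zero.2 hη.symm
  cases a with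
  | u =>
    rw [crossAngle_u hv]
    simp only [sysEta, eqFactor, angleXY, angle]
    field_simp
    ring
  | v =>
    rw [crossAngle_v hu]
    simp only [sysEta, eqFactor, angleXY, angle]
    field_simp
    ring

theorem eqFactor_ne_zero (a : Dep) (hq : q ∈ (sysEta J₁ J₂ η₁ η₂).dom) :
    eqFactor η₁ η₂ a q ≠ 0 := by
  obtain ⟨-, -, hη, hu, hv⟩ := hq
  cases a with
  | u => exact div_ne_zero hv (sub_ne_zero.2 hη.symm)
  | v => exact div_ne_zero (neg_ne_zero.2 hu) (sub_ne_zero.2 hη.symm)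

theorem sysEta_F_eq_zero_iff (a : Dep) (hq : q ∈ (sysEta J₁ J₂ η₁ η₂).dom) :
    (sysEta J₁ J₂ η₁ η₂).F a q = 0
      ↔ (η₂ (q y) - η₁ (q x)) * crossAngle a q = angleXY η₁ η₂ q := by
  rw [sysEta_F_eq a hq, mul_eq_zero_iff_left (eqFactor_ne_zero a hq), sub_eq_zero]

theorem smoothAt_angle (hq : q ∈ (sysEta J₁ J₂ η₁ η₂).dom) : ∀ d, SmoothAt (angle d) q
  | .x => (hasDirDerivAt_angle_x hq.2.2.2.2 0).smooth
  | .y => (hasDirDerivAt_angle_y hq.2.2.2.1 0).smooth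

theorem smoothAt_crossAngle (hq : q ∈ (sysEta J₁ J₂ η₁ η₂).dom) : ∀ a, SmoothAt (crossAngle a) q
  | .u => (smoothAt_angle hq .x).along fun c => smoothAt_totalField .y c q
  | .v => (smoothAt_angle hq .y).along fun c => smoothAt_totalField .x c q

namespace SmoothData

variable (h : SmoothData J₁ J₂ η₁ η₂)
include h

theorem hasDirDerivAt_eta₁ {I : Type*} {p ξ : I → ℝ} {i : I} (hp : p i ∈ J₁) :
    HasDirDerivAt (fun p => η₁ (p i)) (deriv η₁ (p i) * ξ i) ξ p :=
  (HasDirDerivAt.coord i).contDiffOn h.isOpen₁ h.contDiffOn₁ hp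

theorem hasDirDerivAt_eta₂ {I : Type*} {p ξ : I → ℝ} {i : I} (hp : p i ∈ J₂) :
    HasDirDerivAt (fun p => η₂ (p i)) (deriv η₂ (p i) * ξ i) ξ p :=
  (HasDirDerivAt.coord i).contDiffOn h.isOpen₂ h.contDiffOn₂ hp

theorem hasDirDerivAt_deriv_eta₁ {I : Type*} {p ξ : I → ℝ} {i : I} (hp : p i ∈ J₁) :
    HasDirDerivAt (fun p => deriv η₁ (p i)) (deriv (deriv η₁) (p i) * ξ i) ξ p :=
  (HasDirDerivAt.coord i).contDiffOn h.isOpen₁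
    (h.contDiffOn₁.deriv_of_isOpen h.isOpen₁ le_rfl) hp

theorem hasDirDerivAt_deriv_eta₂ {I : Type*} {p ξ : I → ℝ} {i : I} (hp : p i ∈ J₂) :
    HasDirDerivAt (fun p => deriv η₂ (p i)) (deriv (deriv η₂) (p i) * ξ i) ξ p :=
  (HasDirDerivAt.coord i).contDiffOn h.isOpen₂
    (h.contDiffOn₂.deriv_of_isOpen h.isOpen₂ le_rfl) hp

theorem isOpen_dom_sysEta : IsOpen (sysEta J₁ J₂ η₁ η₂).dom := by
  refine isOpen_iff_mem_nhds.2 fun q hq => ?_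
  obtain ⟨hx, hy, hη, hu, hv⟩ := hq
  have hcoord := fun c => (smoothAt_coord c q).continuousAt
  have hη₁ := (h.hasDirDerivAt_eta₁ (ξ := 0) hx).smooth.continuousAt
  have hη₂ := (h.hasDirDerivAt_eta₂ (ξ := 0) hy).smooth.continuousAt
  filter_upwards [(hcoord x).eventually (h.isOpen₁.mem_nhds hx),
    (hcoord y).eventually (h.isOpen₂.mem_nhds hy), hη₁.ne_iff_eventually_ne hη₂ |>.1 hη,
    (hcoord (jet u 0 0)).eventually_ne hu, (hcoord (jet v 0 0)).eventually_ne hv]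
    with q hx hy hη hu hv using ⟨hx, hy, hη, hu, hv⟩

theorem hasDirDerivAt_angleXY (hq : q ∈ (sysEta J₁ J₂ η₁ η₂).dom) (ξ : JetCoord Dep → ℝ) :
    HasDirDerivAt (angleXY η₁ η₂)
      (1 / 2 * (deriv (deriv η₁) (q x) * ξ x) * angle .y q
        + 1 / 2 * deriv η₁ (q x) * dirDeriv ξ (angle .y) q
        - (1 / 2 * (deriv (deriv η₂) (q y) * ξ y) * angle .x q
          + 1 / 2 * deriv η₂ (q y) * dirDeriv ξ (angle .x) q)
        - (ξ (jet u 0 0) * q (jet v 0 0) + q (jet u 0 0) * ξ (jet v 0 0))) ξ q :=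
  (((((HasDirDerivAt.const (1 / 2)).mul (h.hasDirDerivAt_deriv_eta₁ hq.1)).mul
    ((smoothAt_angle hq .y).hasDirDerivAt ξ)).sub
    (((HasDirDerivAt.const (1 / 2)).mul (h.hasDirDerivAt_deriv_eta₂ hq.2.1)).mul
    ((smoothAt_angle hq .x).hasDirDerivAt ξ))).sub
    ((HasDirDerivAt.coord (jet u 0 0)).mul (.coord (jet v 0 0)))).congr_deriv (by ring)

theorem smoothAt_eqFactor (a : Dep) (hq : q ∈ (sysEta J₁ J₂ η₁ η₂).dom) :
    SmoothAt (eqFactor η₁ η₂ a) q := by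
  have hden := ((h.hasDirDerivAt_eta₂ (ξ := 0) hq.2.1).sub (h.hasDirDerivAt_eta₁ hq.1)).smooth
  have hne := sub_ne_zero.2 hq.2.2.1.symm
  cases a with
  | u => exact (smoothAt_coord _ q).div hden hne
  | v => exact (HasDirDerivAt.coord (ξ := 0) (jet u 0 0)).neg.smooth.div hden hne

theorem isSmooth_sysEta : (sysEta J₁ J₂ η₁ η₂).IsSmooth where
  isOpen_dom := h.isOpen_dom_sysEta
  smooth a q hq := by
    have hdiff := ((h.hasDirDerivAt_eta₂ (ξ := 0) hq.2.1).sub (h.hasDirDerivAt_eta₁ hq.1)).smooth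
    refine ((h.smoothAt_eqFactor a hq).mul ((hdiff.mul (smoothAt_crossAngle hq a)).sub
      (h.hasDirDerivAt_angleXY hq 0).smooth)).congr ?_
    filter_upwards [h.isOpen_dom_sysEta.mem_nhds hq] with q hq using sysEta_F_eq a hq

theorem isNormal_sysEta : IsNormal (sysEta J₁ J₂ η₁ η₂) leadEta where
  toIsSmooth := h.isSmooth_sysEta
  lower a p _ q _ hpq := by
    have hx := hpq x
    have hy := hpq y
    have hu := hpq (jet u 0 0)
    have hv := hpq (jet v 0 0)
    have hux := hpq (jet u 1 0)
    have huy := hpq (jet u 0 1)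
    have hvx := hpq (jet v 1 0)
    have hvy := hpq (jet v 0 1)
    cases a <;> simp_all [sysEta, leadEta, ord]
  dom_of_ord q hq p hqp := by
    have hx := hqp x Nat.one_pos
    have hy := hqp y Nat.one_pos
    have hu := hqp (jet u 0 0) Nat.one_pos
    have hv := hqp (jet v 0 0) Nat.one_pos
    simpa only [sysEta, Set.mem_ofPred_eq, hx, hy, hu, hv] using hq
  lead_pos a := by cases a <;> exact Nat.two_pos

theorem dirDeriv_sysEta_F_eq_zero_iff (a : Dep) (hq : q ∈ (sysEta J₁ J₂ η₁ η₂).dom)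
    (h0 : (sysEta J₁ J₂ η₁ η₂).F a q = 0) (hx : ξ x = 0) (hy : ξ y = 0) :
    dirDeriv ξ ((sysEta J₁ J₂ η₁ η₂).F a) q = 0
      ↔ (η₂ (q y) - η₁ (q x)) * dirDeriv ξ (crossAngle a) q
        = 1 / 2 * deriv η₁ (q x) * dirDeriv ξ (angle .y) q
          - 1 / 2 * deriv η₂ (q y) * dirDeriv ξ (angle .x) q
          - q (jet u 0 0) * ξ (jet v 0 0) - q (jet v 0 0) * ξ (jet u 0 0) := by
  have hdiff := (((h.hasDirDerivAt_eta₂ hq.2.1).sub (h.hasDirDerivAt_eta₁ hq.1)).mul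
    ((smoothAt_crossAngle hq a).hasDirDerivAt ξ)).sub (h.hasDirDerivAt_angleXY hq ξ)
  have hF := (((h.smoothAt_eqFactor a hq).hasDirDerivAt ξ).mul hdiff).congr <| by
    filter_upwards [h.isOpen_dom_sysEta.mem_nhds hq] with q hq using sysEta_F_eq a hq
  rw [hF.eq, sub_eq_zero.2 ((sysEta_F_eq_zero_iff a hq).1 h0), hx, hy, mul_zero, zero_add,
    mul_eq_zero_iff_left (eqFactor_ne_zero a hq), ← sub_eq_zero (b := _ - _ - _ - _)]
  ring_nf

end SmoothData

theorem crossAngle_eq (hq : q ∈ (sysEta J₁ J₂ η₁ η₂).inf) (a : Dep) :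
    (η₂ (q y) - η₁ (q x)) * crossAngle a q = angleXY η₁ η₂ q :=
  (sysEta_F_eq_zero_iff a hq.1).1 (hq.2 a 0 0)

theorem mul_angle_x (hv : q (jet v 0 0) ≠ 0) : q (jet v 0 0) * angle .x q = q (jet u 0 1) :=
  mul_div_cancel₀ _ hv

theorem mul_angle_y (hu : q (jet u 0 0) ≠ 0) : q (jet u 0 0) * angle .y q = -q (jet v 1 0) := by
  rw [angle, mul_neg, mul_div_cancel₀ _ hu]

theorem hasDirDerivAt_covS_X {p ξ : JetCoord Dep ⊕ Fin 3 → ℝ}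
    (hp : p ∘ Sum.inl ∈ (sysEta J₁ J₂ η₁ η₂).dom) (w : Fin 3) :
    HasDirDerivAt ((covS J₁ J₂ η₁ η₂).X w)
      (![dirDeriv (ξ ∘ Sum.inl) (angle .x) (p ∘ Sum.inl),
        -Real.sin (p (Sum.inr 0)) * ξ (Sum.inr 0) * p (Sum.inl (jet u 0 0))
          + Real.cos (p (Sum.inr 0)) * ξ (Sum.inl (jet u 0 0)),
        -(Real.cos (p (Sum.inr 0)) * ξ (Sum.inr 0)) * p (Sum.inl (jet u 0 0))
          + -Real.sin (p (Sum.inr 0)) * ξ (Sum.inl (jet u 0 0))] w) ξ p := by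
  have hs₀ := HasDirDerivAt.coord (ξ := ξ) (p := p) (Sum.inr 0)
  have hu := HasDirDerivAt.coord (ξ := ξ) (p := p) (Sum.inl (jet u 0 0))
  match w with
  | 0 => exact ⟨Cov.smoothAt_comp_inl (smoothAt_angle hp .x),
      Cov.dirDeriv_comp_inl (smoothAt_angle hp .x) ξ⟩
  | 1 => exact hs₀.cos.mul hu
  | 2 => exact hs₀.sin.neg.mul hu

theorem hasDirDerivAt_covS_Y {p ξ : JetCoord Dep ⊕ Fin 3 → ℝ}
    (hp : p ∘ Sum.inl ∈ (sysEta J₁ J₂ η₁ η₂).dom) (w : Fin 3) :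
    HasDirDerivAt ((covS J₁ J₂ η₁ η₂).Y w)
      (![dirDeriv (ξ ∘ Sum.inl) (angle .y) (p ∘ Sum.inl),
        ξ (Sum.inl (jet v 0 0)) * Real.sin (p (Sum.inr 0))
          + p (Sum.inl (jet v 0 0)) * (Real.cos (p (Sum.inr 0)) * ξ (Sum.inr 0)),
        ξ (Sum.inl (jet v 0 0)) * Real.cos (p (Sum.inr 0))
          + p (Sum.inl (jet v 0 0)) * (-Real.sin (p (Sum.inr 0)) * ξ (Sum.inr 0))] w) ξ p := by
  have hs₀ := HasDirDerivAt.coord (ξ := ξ) (p := p) (Sum.inr 0)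
  have hv := HasDirDerivAt.coord (ξ := ξ) (p := p) (Sum.inl (jet v 0 0))
  match w with
  | 0 => exact ⟨Cov.smoothAt_comp_inl (smoothAt_angle hp .y),
      Cov.dirDeriv_comp_inl (smoothAt_angle hp .y) ξ⟩
  | 1 => exact hv.mul hs₀.sin
  | 2 => exact hv.mul hs₀.cos

theorem isCovering_covS : (covS J₁ J₂ η₁ η₂).IsCovering where
  isOpen_dom := isOpen_univ
  smooth_X w _ hp := (hasDirDerivAt_covS_X (ξ := 0) hp.1.1 w).smooth
  smooth_Y w _ hp := (hasDirDerivAt_covS_Y (ξ := 0) hp.1.1 w).smooth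
  comm w p hp := by
    obtain ⟨-, -, hη, hu, hv⟩ := hp.1.1
    have hux := mul_angle_x hv
    have hvx := mul_angle_y hu
    refine (hasDirDerivAt_covS_Y hp.1.1 w).eq.trans
      (.trans ?_ (hasDirDerivAt_covS_X hp.1.1 w).eq.symm)
    match w with
    | 0 =>
      exact mul_left_cancel₀ (sub_ne_zero.2 hη.symm)
        ((crossAngle_eq hp.1 v).trans (crossAngle_eq hp.1 u).symm)
    | 1 =>
      change p (Sum.inl (jet v 1 0)) * Real.sin (p (Sum.inr 0)) + p (Sum.inl (jet v 0 0))
          * (Real.cos (p (Sum.inr 0)) * angle .x (p ∘ Sum.inl))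
        = -Real.sin (p (Sum.inr 0)) * angle .y (p ∘ Sum.inl) * p (Sum.inl (jet u 0 0))
          + Real.cos (p (Sum.inr 0)) * p (Sum.inl (jet u 0 1))
      simp only [Function.comp_apply] at hux hvx
      linear_combination Real.cos (p (Sum.inr 0)) * hux + Real.sin (p (Sum.inr 0)) * hvx
    | 2 =>
      change p (Sum.inl (jet v 1 0)) * Real.cos (p (Sum.inr 0)) + p (Sum.inl (jet v 0 0))
          * (-Real.sin (p (Sum.inr 0)) * angle .x (p ∘ Sum.inl))
        = -(Real.cos (p (Sum.inr 0)) * angle .y (p ∘ Sum.inl)) * p (Sum.inl (jet u 0 0))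
          + -Real.sin (p (Sum.inr 0)) * p (Sum.inl (jet u 0 1))
      simp only [Function.comp_apply] at hux hvx
      linear_combination Real.cos (p (Sum.inr 0)) * hvx - Real.sin (p (Sum.inr 0)) * hux

end System

section RecursionOperator

variable {J₁ J₂ : Set ℝ} {η₁ η₂ : ℝ → ℝ}
variable {p : JetCoord (Dep ⊕ Dep) ⊕ (Fin 3 ⊕ Fin 3) → ℝ}

/-- The component `sin s₀ S₁ + cos s₀ S₂` of the variation of `(s₁, s₂)` in the frame rotated by
the angle `s₀`. -/
def rotT (p : JetCoord (Dep ⊕ Dep) ⊕ (Fin 3 ⊕ Fin 3) → ℝ) : ℝ :=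
  Real.sin (p (Sum.inr (Sum.inl 0))) * p (Sum.inr (Sum.inr 1))
    + Real.cos (p (Sum.inr (Sum.inl 0))) * p (Sum.inr (Sum.inr 2))

/-- The component `cos s₀ S₁ - sin s₀ S₂` of the variation of `(s₁, s₂)` in the frame rotated by
the angle `s₀`. -/
def rotZ (p : JetCoord (Dep ⊕ Dep) ⊕ (Fin 3 ⊕ Fin 3) → ℝ) : ℝ :=
  Real.cos (p (Sum.inr (Sum.inl 0))) * p (Sum.inr (Sum.inr 1))
    - Real.sin (p (Sum.inr (Sum.inl 0))) * p (Sum.inr (Sum.inr 2))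

theorem hasDirDerivAt_rotT (ξ : JetCoord (Dep ⊕ Dep) ⊕ (Fin 3 ⊕ Fin 3) → ℝ) :
    HasDirDerivAt rotT (ξ (Sum.inr (Sum.inl 0)) * rotZ p
      + (Real.sin (p (Sum.inr (Sum.inl 0))) * ξ (Sum.inr (Sum.inr 1))
        + Real.cos (p (Sum.inr (Sum.inl 0))) * ξ (Sum.inr (Sum.inr 2)))) ξ p :=
  (((HasDirDerivAt.coord _).sin.mul (.coord _)).add
    ((HasDirDerivAt.coord _).cos.mul (.coord _))).congr_deriv (by rw [rotZ]; ring)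

theorem hasDirDerivAt_rotZ (ξ : JetCoord (Dep ⊕ Dep) ⊕ (Fin 3 ⊕ Fin 3) → ℝ) :
    HasDirDerivAt rotZ (-ξ (Sum.inr (Sum.inl 0)) * rotT p
      + (Real.cos (p (Sum.inr (Sum.inl 0))) * ξ (Sum.inr (Sum.inr 1))
        - Real.sin (p (Sum.inr (Sum.inl 0))) * ξ (Sum.inr (Sum.inr 2)))) ξ p :=
  (((HasDirDerivAt.coord _).cos.mul (.coord _)).sub
    ((HasDirDerivAt.coord _).sin.mul (.coord _))).congr_deriv (by rw [rotT]; ring)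

theorem field_x_tangent_covS (hp : jetBase (p ∘ Sum.inl) ∈ (sysEta J₁ J₂ η₁ η₂).dom) (w : Fin 3) :
    (covS J₁ J₂ η₁ η₂).tangent.field .x (Sum.inr (Sum.inr w)) p
      = ![variation (angle .x) (p ∘ Sum.inl),
        -Real.sin (p (Sum.inr (Sum.inl 0))) * p (Sum.inr (Sum.inr 0))
            * p (Sum.inl (jet (Sum.inl u) 0 0))
          + Real.cos (p (Sum.inr (Sum.inl 0))) * p (Sum.inl (jet (Sum.inr u) 0 0)),
        -(Real.cos (p (Sum.inr (Sum.inl 0))) * p (Sum.inr (Sum.inr 0)))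
            * p (Sum.inl (jet (Sum.inl u) 0 0))
          + -Real.sin (p (Sum.inr (Sum.inl 0))) * p (Sum.inl (jet (Sum.inr u) 0 0))] w :=
  (hasDirDerivAt_covS_X (p := Cov.tangentBase p) hp w).eq

theorem field_y_tangent_covS (hp : jetBase (p ∘ Sum.inl) ∈ (sysEta J₁ J₂ η₁ η₂).dom) (w : Fin 3) :
    (covS J₁ J₂ η₁ η₂).tangent.field .y (Sum.inr (Sum.inr w)) p
      = ![variation (angle .y) (p ∘ Sum.inl),
        p (Sum.inl (jet (Sum.inr v) 0 0)) * Real.sin (p (Sum.inr (Sum.inl 0)))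
          + p (Sum.inl (jet (Sum.inl v) 0 0))
            * (Real.cos (p (Sum.inr (Sum.inl 0))) * p (Sum.inr (Sum.inr 0))),
        p (Sum.inl (jet (Sum.inr v) 0 0)) * Real.cos (p (Sum.inr (Sum.inl 0)))
          + p (Sum.inl (jet (Sum.inl v) 0 0))
            * (-Real.sin (p (Sum.inr (Sum.inl 0))) * p (Sum.inr (Sum.inr 0)))] w :=
  (hasDirDerivAt_covS_Y (p := Cov.tangentBase p) hp w).eq

theorem dirDeriv_x_rotT (hp : jetBase (p ∘ Sum.inl) ∈ (sysEta J₁ J₂ η₁ η₂).dom) :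
    dirDeriv (fun c => (covS J₁ J₂ η₁ η₂).tangent.field .x c p) rotT p
      = angle .x (jetBase (p ∘ Sum.inl)) * rotZ p
        - p (Sum.inl (jet (Sum.inl u) 0 0)) * p (Sum.inr (Sum.inr 0)) := by
  rw [(hasDirDerivAt_rotT _).eq, field_x_tangent_covS hp, field_x_tangent_covS hp]
  change angle .x (jetBase (p ∘ Sum.inl)) * rotZ p + _ = _
  simp only [Matrix.cons_val]
  linear_combination (-p (Sum.inl (jet (Sum.inl u) 0 0)) * p (Sum.inr (Sum.inr 0)))
    * Real.sin_sq_add_cos_sq (p (Sum.inr (Sum.inl 0)))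

theorem dirDeriv_x_rotZ (hp : jetBase (p ∘ Sum.inl) ∈ (sysEta J₁ J₂ η₁ η₂).dom) :
    dirDeriv (fun c => (covS J₁ J₂ η₁ η₂).tangent.field .x c p) rotZ p
      = p (Sum.inl (jet (Sum.inr u) 0 0)) - angle .x (jetBase (p ∘ Sum.inl)) * rotT p := by
  rw [(hasDirDerivAt_rotZ _).eq, field_x_tangent_covS hp, field_x_tangent_covS hp]
  change -angle .x (jetBase (p ∘ Sum.inl)) * rotT p + _ = _
  simp only [Matrix.cons_val]
  linear_combination p (Sum.inl (jet (Sum.inr u) 0 0))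
    * Real.sin_sq_add_cos_sq (p (Sum.inr (Sum.inl 0)))

theorem dirDeriv_y_rotT (hp : jetBase (p ∘ Sum.inl) ∈ (sysEta J₁ J₂ η₁ η₂).dom) :
    dirDeriv (fun c => (covS J₁ J₂ η₁ η₂).tangent.field .y c p) rotT p
      = p (Sum.inl (jet (Sum.inr v) 0 0)) + angle .y (jetBase (p ∘ Sum.inl)) * rotZ p := by
  rw [(hasDirDerivAt_rotT _).eq, field_y_tangent_covS hp, field_y_tangent_covS hp]
  change angle .y (jetBase (p ∘ Sum.inl)) * rotZ p + _ = _
  simp only [Matrix.cons_val]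
  linear_combination p (Sum.inl (jet (Sum.inr v) 0 0))
    * Real.sin_sq_add_cos_sq (p (Sum.inr (Sum.inl 0)))

theorem dirDeriv_y_rotZ (hp : jetBase (p ∘ Sum.inl) ∈ (sysEta J₁ J₂ η₁ η₂).dom) :
    dirDeriv (fun c => (covS J₁ J₂ η₁ η₂).tangent.field .y c p) rotZ p
      = p (Sum.inl (jet (Sum.inl v) 0 0)) * p (Sum.inr (Sum.inr 0))
        - angle .y (jetBase (p ∘ Sum.inl)) * rotT p := by
  rw [(hasDirDerivAt_rotZ _).eq, field_y_tangent_covS hp, field_y_tangent_covS hp]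
  change -angle .y (jetBase (p ∘ Sum.inl)) * rotT p + _ = _
  simp only [Matrix.cons_val]
  linear_combination (p (Sum.inl (jet (Sum.inl v) 0 0)) * p (Sum.inr (Sum.inr 0)))
    * Real.sin_sq_add_cos_sq (p (Sum.inr (Sum.inl 0)))

theorem roTangent_inr_u (η₁ η₂ : ℝ → ℝ) (p : JetCoord (Dep ⊕ Dep) ⊕ (Fin 3 ⊕ Fin 3) → ℝ) :
    roTangent η₁ η₂ (Sum.inr u) p
      = η₁ (p (Sum.inl x)) * p (Sum.inl (jet (Sum.inr u) 0 0))
        + 1 / 2 * deriv η₁ (p (Sum.inl x)) * rotZ p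
        + (η₂ (p (Sum.inl y)) - η₁ (p (Sum.inl x))) * angle .x (jetBase (p ∘ Sum.inl))
          * rotT p := by
  simp only [roTangent, ro, rotT, rotZ, angle, jetBase, JetCoord.map, Function.comp]
  ring

theorem roTangent_inr_v (η₁ η₂ : ℝ → ℝ) (p : JetCoord (Dep ⊕ Dep) ⊕ (Fin 3 ⊕ Fin 3) → ℝ) :
    roTangent η₁ η₂ (Sum.inr v) p
      = η₂ (p (Sum.inl y)) * p (Sum.inl (jet (Sum.inr v) 0 0))
        + 1 / 2 * deriv η₂ (p (Sum.inl y)) * rotT p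
        + (η₂ (p (Sum.inl y)) - η₁ (p (Sum.inl x))) * angle .y (jetBase (p ∘ Sum.inl))
          * rotZ p := by
  simp only [roTangent, ro, rotT, rotZ, angle, jetBase, JetCoord.map, Function.comp]
  ring

/-- The variations of the derivatives of the angle `s₀` that correspond to `(Ũ, Ṽ)`. -/
def recAngle (η₁ η₂ : ℝ → ℝ) : Axis → (JetCoord (Dep ⊕ Dep) ⊕ (Fin 3 ⊕ Fin 3) → ℝ) → ℝ
  | .x, p => η₁ (p (Sum.inl x)) * variation (angle .x) (p ∘ Sum.inl)
      + 1 / 2 * deriv η₁ (p (Sum.inl x)) * p (Sum.inr (Sum.inr 0))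
      - p (Sum.inl (jet (Sum.inl u) 0 0)) * rotT p
  | .y, p => η₂ (p (Sum.inl y)) * variation (angle .y) (p ∘ Sum.inl)
      + 1 / 2 * deriv η₂ (p (Sum.inl y)) * p (Sum.inr (Sum.inr 0))
      + p (Sum.inl (jet (Sum.inl v) 0 0)) * rotZ p

theorem jetBase_prol_roTangent (η₁ η₂ : ℝ → ℝ)
    (p : JetCoord (Dep ⊕ Dep) ⊕ (Fin 3 ⊕ Fin 3) → ℝ) :
    jetBase ((covS J₁ J₂ η₁ η₂).tangent.prol (roTangent η₁ η₂) p) = jetBase (p ∘ Sum.inl) :=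
  Cov.jetBase_prol _ (φ := roTangent η₁ η₂) (fun _ => rfl) p

namespace SmoothData

variable (h : SmoothData J₁ J₂ η₁ η₂)
include h

theorem hasDirDerivAt_roTangent_inr_u (hp : jetBase (p ∘ Sum.inl) ∈ (sysEta J₁ J₂ η₁ η₂).dom)
    (ξ : JetCoord (Dep ⊕ Dep) ⊕ (Fin 3 ⊕ Fin 3) → ℝ) :
    HasDirDerivAt (roTangent η₁ η₂ (Sum.inr u))
      (deriv η₁ (p (Sum.inl x)) * ξ (Sum.inl x) * p (Sum.inl (jet (Sum.inr u) 0 0))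
        + η₁ (p (Sum.inl x)) * ξ (Sum.inl (jet (Sum.inr u) 0 0))
        + (1 / 2 * (deriv (deriv η₁) (p (Sum.inl x)) * ξ (Sum.inl x)) * rotZ p
          + 1 / 2 * deriv η₁ (p (Sum.inl x)) * dirDeriv ξ rotZ p)
        + (((deriv η₂ (p (Sum.inl y)) * ξ (Sum.inl y) - deriv η₁ (p (Sum.inl x)) * ξ (Sum.inl x))
              * angle .x (jetBase (p ∘ Sum.inl))
            + (η₂ (p (Sum.inl y)) - η₁ (p (Sum.inl x)))
              * dirDeriv ξ (fun p => angle .x (jetBase (p ∘ Sum.inl))) p) * rotT p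
          + (η₂ (p (Sum.inl y)) - η₁ (p (Sum.inl x))) * angle .x (jetBase (p ∘ Sum.inl))
            * dirDeriv ξ rotT p)) ξ p := by
  have hη₁ := h.hasDirDerivAt_eta₁ (ξ := ξ) hp.1
  have hη₂ := h.hasDirDerivAt_eta₂ (ξ := ξ) hp.2.1
  have hη₁' := h.hasDirDerivAt_deriv_eta₁ (ξ := ξ) hp.1
  have hangle := (Cov.smoothAt_comp_inl (smoothAt_comp_jetBase
    (smoothAt_angle hp .x))).hasDirDerivAt ξ
  have hT := (hasDirDerivAt_rotT (p := p) ξ).smooth.hasDirDerivAt ξ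
  have hZ := (hasDirDerivAt_rotZ (p := p) ξ).smooth.hasDirDerivAt ξ
  refine ((((hη₁.mul (.coord (Sum.inl (jet (Sum.inr u) 0 0)))).add
    (((HasDirDerivAt.const (1 / 2)).mul hη₁').mul hZ)).add
    (((hη₂.sub hη₁).mul hangle).mul hT)).congr
      (.of_forall fun q => roTangent_inr_u η₁ η₂ q)).congr_deriv ?_
  simp only [JetCoord.map, zero_mul, zero_add]

theorem hasDirDerivAt_roTangent_inr_v (hp : jetBase (p ∘ Sum.inl) ∈ (sysEta J₁ J₂ η₁ η₂).dom)
    (ξ : JetCoord (Dep ⊕ Dep) ⊕ (Fin 3 ⊕ Fin 3) → ℝ) :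
    HasDirDerivAt (roTangent η₁ η₂ (Sum.inr v))
      (deriv η₂ (p (Sum.inl y)) * ξ (Sum.inl y) * p (Sum.inl (jet (Sum.inr v) 0 0))
        + η₂ (p (Sum.inl y)) * ξ (Sum.inl (jet (Sum.inr v) 0 0))
        + (1 / 2 * (deriv (deriv η₂) (p (Sum.inl y)) * ξ (Sum.inl y)) * rotT p
          + 1 / 2 * deriv η₂ (p (Sum.inl y)) * dirDeriv ξ rotT p)
        + (((deriv η₂ (p (Sum.inl y)) * ξ (Sum.inl y) - deriv η₁ (p (Sum.inl x)) * ξ (Sum.inl x))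
              * angle .y (jetBase (p ∘ Sum.inl))
            + (η₂ (p (Sum.inl y)) - η₁ (p (Sum.inl x)))
              * dirDeriv ξ (fun p => angle .y (jetBase (p ∘ Sum.inl))) p) * rotZ p
          + (η₂ (p (Sum.inl y)) - η₁ (p (Sum.inl x))) * angle .y (jetBase (p ∘ Sum.inl))
            * dirDeriv ξ rotZ p)) ξ p := by
  have hη₁ := h.hasDirDerivAt_eta₁ (ξ := ξ) hp.1
  have hη₂ := h.hasDirDerivAt_eta₂ (ξ := ξ) hp.2.1
  have hη₂' := h.hasDirDerivAt_deriv_eta₂ (ξ := ξ) hp.2.1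
  have hangle := (Cov.smoothAt_comp_inl (smoothAt_comp_jetBase
    (smoothAt_angle hp .y))).hasDirDerivAt ξ
  have hT := (hasDirDerivAt_rotT (p := p) ξ).smooth.hasDirDerivAt ξ
  have hZ := (hasDirDerivAt_rotZ (p := p) ξ).smooth.hasDirDerivAt ξ
  refine ((((hη₂.mul (.coord (Sum.inl (jet (Sum.inr v) 0 0)))).add
    (((HasDirDerivAt.const (1 / 2)).mul hη₂').mul hT)).add
    (((hη₂.sub hη₁).mul hangle).mul hZ)).congr
      (.of_forall fun q => roTangent_inr_v η₁ η₂ q)).congr_deriv ?_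
  simp only [JetCoord.map, zero_mul, zero_add]

theorem smoothAt_roTangent (hp : jetBase (p ∘ Sum.inl) ∈ (sysEta J₁ J₂ η₁ η₂).dom) :
    ∀ a, SmoothAt (roTangent η₁ η₂ a) p
  | .inl a => smoothAt_coord (Sum.inl (jet (Sum.inl a) 0 0)) p
  | .inr u => (h.hasDirDerivAt_roTangent_inr_u hp 0).smooth
  | .inr v => (h.hasDirDerivAt_roTangent_inr_v hp 0).smooth

theorem dirDeriv_y_roTangent_inr_u (hp : jetBase (p ∘ Sum.inl) ∈ (sysEta J₁ J₂ η₁ η₂).inf) :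
    dirDeriv (fun c => (covS J₁ J₂ η₁ η₂).tangent.field .y c p) (roTangent η₁ η₂ (Sum.inr u)) p
      = angle .x (jetBase (p ∘ Sum.inl)) * roTangent η₁ η₂ (Sum.inr v) p
        + p (Sum.inl (jet (Sum.inl v) 0 0)) * recAngle η₁ η₂ .x p := by
  have hv := hp.1.2.2.2.2
  have hα : p (Sum.inl (jet (Sum.inl v) 0 0)) * variation (angle .x) (p ∘ Sum.inl)
      = p (Sum.inl (jet (Sum.inr u) 0 1))
        - angle .x (jetBase (p ∘ Sum.inl)) * p (Sum.inl (jet (Sum.inr v) 0 0)) :=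
    (congrArg _ (hasDirDerivAt_angle_x hv _).eq).trans (mul_div_cancel₀ _ hv)
  have hcross : (η₂ (p (Sum.inl y)) - η₁ (p (Sum.inl x)))
      * along (totalField .y) (angle .x) (jetBase (p ∘ Sum.inl))
      = 1 / 2 * deriv η₁ (p (Sum.inl x)) * angle .y (jetBase (p ∘ Sum.inl))
        - 1 / 2 * deriv η₂ (p (Sum.inl y)) * angle .x (jetBase (p ∘ Sum.inl))
        - p (Sum.inl (jet (Sum.inl u) 0 0)) * p (Sum.inl (jet (Sum.inl v) 0 0)) :=
    crossAngle_eq hp u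
  have hx : (covS J₁ J₂ η₁ η₂).tangent.field .y (Sum.inl x) p = 0 := rfl
  have hy : (covS J₁ J₂ η₁ η₂).tangent.field .y (Sum.inl y) p = 1 := rfl
  have hU : (covS J₁ J₂ η₁ η₂).tangent.field .y (Sum.inl (jet (Sum.inr u) 0 0)) p
      = p (Sum.inl (jet (Sum.inr u) 0 1)) := rfl
  rw [(h.hasDirDerivAt_roTangent_inr_u hp.1 _).eq, dirDeriv_y_rotT hp.1, dirDeriv_y_rotZ hp.1,
    (Cov.hasDirDerivAt_comp_jetBase _ .y (smoothAt_angle hp.1 .x)).eq, roTangent_inr_v, recAngle,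
    hx, hy, hU]
  linear_combination rotT p * hcross - η₁ (p (Sum.inl x)) * hα

theorem dirDeriv_x_roTangent_inr_v (hp : jetBase (p ∘ Sum.inl) ∈ (sysEta J₁ J₂ η₁ η₂).inf) :
    dirDeriv (fun c => (covS J₁ J₂ η₁ η₂).tangent.field .x c p) (roTangent η₁ η₂ (Sum.inr v)) p
      = -(angle .y (jetBase (p ∘ Sum.inl)) * roTangent η₁ η₂ (Sum.inr u) p
        + p (Sum.inl (jet (Sum.inl u) 0 0)) * recAngle η₁ η₂ .y p) := by
  have hu := hp.1.2.2.2.1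
  have hβ : p (Sum.inl (jet (Sum.inl u) 0 0)) * variation (angle .y) (p ∘ Sum.inl)
      = -(p (Sum.inl (jet (Sum.inr v) 1 0))
        + angle .y (jetBase (p ∘ Sum.inl)) * p (Sum.inl (jet (Sum.inr u) 0 0))) :=
    (congrArg _ (hasDirDerivAt_angle_y hu _).eq).trans (mul_div_cancel₀ _ hu)
  have hcross : (η₂ (p (Sum.inl y)) - η₁ (p (Sum.inl x)))
      * along (totalField .x) (angle .y) (jetBase (p ∘ Sum.inl))
      = 1 / 2 * deriv η₁ (p (Sum.inl x)) * angle .y (jetBase (p ∘ Sum.inl))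
        - 1 / 2 * deriv η₂ (p (Sum.inl y)) * angle .x (jetBase (p ∘ Sum.inl))
        - p (Sum.inl (jet (Sum.inl u) 0 0)) * p (Sum.inl (jet (Sum.inl v) 0 0)) :=
    crossAngle_eq hp v
  have hx : (covS J₁ J₂ η₁ η₂).tangent.field .x (Sum.inl x) p = 1 := rfl
  have hy : (covS J₁ J₂ η₁ η₂).tangent.field .x (Sum.inl y) p = 0 := rfl
  have hV : (covS J₁ J₂ η₁ η₂).tangent.field .x (Sum.inl (jet (Sum.inr v) 0 0)) p
      = p (Sum.inl (jet (Sum.inr v) 1 0)) := rfl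
  rw [(h.hasDirDerivAt_roTangent_inr_v hp.1 _).eq, dirDeriv_x_rotT hp.1, dirDeriv_x_rotZ hp.1,
    (Cov.hasDirDerivAt_comp_jetBase _ .x (smoothAt_angle hp.1 .y)).eq, roTangent_inr_u, recAngle,
    hx, hy, hV]
  linear_combination rotZ p * hcross + η₂ (p (Sum.inl y)) * hβ

theorem variation_angle_prol_roTangent (hp : jetBase (p ∘ Sum.inl) ∈ (sysEta J₁ J₂ η₁ η₂).inf) :
    ∀ d, variation (angle d) ((covS J₁ J₂ η₁ η₂).tangent.prol (roTangent η₁ η₂) p)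
      = recAngle η₁ η₂ d p := by
  have hbase := jetBase_prol_roTangent (J₁ := J₁) (J₂ := J₂) η₁ η₂ p
  have hu := hp.1.2.2.2.1
  have hv := hp.1.2.2.2.2
  rintro (_ | _)
  · rw [variation, hbase, (hasDirDerivAt_angle_x hv _).eq, div_eq_iff hv]
    change dirDeriv (fun c => (covS J₁ J₂ η₁ η₂).tangent.field .y c p) (roTangent η₁ η₂ (.inr u)) p
      - angle .x (jetBase (p ∘ Sum.inl)) * roTangent η₁ η₂ (.inr v) p
      = recAngle η₁ η₂ .x p * p (Sum.inl (jet (Sum.inl v) 0 0))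
    rw [h.dirDeriv_y_roTangent_inr_u hp]
    ring
  · rw [variation, hbase, (hasDirDerivAt_angle_y hu _).eq, div_eq_iff hu]
    change -(dirDeriv (fun c => (covS J₁ J₂ η₁ η₂).tangent.field .x c p)
        (roTangent η₁ η₂ (.inr v)) p
      + angle .y (jetBase (p ∘ Sum.inl)) * roTangent η₁ η₂ (.inr u) p)
      = recAngle η₁ η₂ .y p * p (Sum.inl (jet (Sum.inl u) 0 0))
    rw [h.dirDeriv_x_roTangent_inr_v hp]
    ring

theorem hasDirDerivAt_recAngle_x (hp : jetBase (p ∘ Sum.inl) ∈ (sysEta J₁ J₂ η₁ η₂).dom)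
    (ξ : JetCoord (Dep ⊕ Dep) ⊕ (Fin 3 ⊕ Fin 3) → ℝ) :
    HasDirDerivAt (recAngle η₁ η₂ .x)
      (deriv η₁ (p (Sum.inl x)) * ξ (Sum.inl x) * variation (angle .x) (p ∘ Sum.inl)
        + η₁ (p (Sum.inl x)) * dirDeriv ξ (fun p => variation (angle .x) (p ∘ Sum.inl)) p
        + (1 / 2 * (deriv (deriv η₁) (p (Sum.inl x)) * ξ (Sum.inl x)) * p (Sum.inr (Sum.inr 0))
          + 1 / 2 * deriv η₁ (p (Sum.inl x)) * ξ (Sum.inr (Sum.inr 0)))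
        - (ξ (Sum.inl (jet (Sum.inl u) 0 0)) * rotT p
          + p (Sum.inl (jet (Sum.inl u) 0 0)) * dirDeriv ξ rotT p)) ξ p := by
  have hη := h.hasDirDerivAt_eta₁ (ξ := ξ) hp.1
  have hη' := h.hasDirDerivAt_deriv_eta₁ (ξ := ξ) hp.1
  have hvar := (Cov.smoothAt_comp_inl
    (smoothAt_variation (smoothAt_angle hp .x))).hasDirDerivAt ξ
  have hrot := (hasDirDerivAt_rotT (p := p) ξ).smooth.hasDirDerivAt ξ
  refine (((hη.mul hvar).add (((HasDirDerivAt.const (1 / 2)).mul hη').mul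
    (.coord (Sum.inr (Sum.inr 0))))).sub
      ((HasDirDerivAt.coord (Sum.inl (jet (Sum.inl u) 0 0))).mul hrot)).congr_deriv ?_
  simp only [JetCoord.map, zero_mul, zero_add]

theorem hasDirDerivAt_recAngle_y (hp : jetBase (p ∘ Sum.inl) ∈ (sysEta J₁ J₂ η₁ η₂).dom)
    (ξ : JetCoord (Dep ⊕ Dep) ⊕ (Fin 3 ⊕ Fin 3) → ℝ) :
    HasDirDerivAt (recAngle η₁ η₂ .y)
      (deriv η₂ (p (Sum.inl y)) * ξ (Sum.inl y) * variation (angle .y) (p ∘ Sum.inl)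
        + η₂ (p (Sum.inl y)) * dirDeriv ξ (fun p => variation (angle .y) (p ∘ Sum.inl)) p
        + (1 / 2 * (deriv (deriv η₂) (p (Sum.inl y)) * ξ (Sum.inl y)) * p (Sum.inr (Sum.inr 0))
          + 1 / 2 * deriv η₂ (p (Sum.inl y)) * ξ (Sum.inr (Sum.inr 0)))
        + (ξ (Sum.inl (jet (Sum.inl v) 0 0)) * rotZ p
          + p (Sum.inl (jet (Sum.inl v) 0 0)) * dirDeriv ξ rotZ p)) ξ p := by
  have hη := h.hasDirDerivAt_eta₂ (ξ := ξ) hp.2.1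
  have hη' := h.hasDirDerivAt_deriv_eta₂ (ξ := ξ) hp.2.1
  have hvar := (Cov.smoothAt_comp_inl
    (smoothAt_variation (smoothAt_angle hp .y))).hasDirDerivAt ξ
  have hrot := (hasDirDerivAt_rotZ (p := p) ξ).smooth.hasDirDerivAt ξ
  refine (((hη.mul hvar).add (((HasDirDerivAt.const (1 / 2)).mul hη').mul
    (.coord (Sum.inr (Sum.inr 0))))).add
      ((HasDirDerivAt.coord (Sum.inl (jet (Sum.inl v) 0 0))).mul hrot)).congr_deriv ?_
  simp only [JetCoord.map, zero_mul, zero_add]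

theorem smoothAt_recAngle (hp : jetBase (p ∘ Sum.inl) ∈ (sysEta J₁ J₂ η₁ η₂).dom) :
    ∀ d, SmoothAt (recAngle η₁ η₂ d) p
  | .x => (h.hasDirDerivAt_recAngle_x hp 0).smooth
  | .y => (h.hasDirDerivAt_recAngle_y hp 0).smooth

theorem variation_crossAngle (hp : p ∈ (covS J₁ J₂ η₁ η₂).tangent.pts) (a : Dep) :
    (η₂ (p (Sum.inl y)) - η₁ (p (Sum.inl x))) * variation (crossAngle a) (p ∘ Sum.inl)
      = 1 / 2 * deriv η₁ (p (Sum.inl x)) * variation (angle .y) (p ∘ Sum.inl)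
        - 1 / 2 * deriv η₂ (p (Sum.inl y)) * variation (angle .x) (p ∘ Sum.inl)
        - p (Sum.inl (jet (Sum.inl u) 0 0)) * p (Sum.inl (jet (Sum.inr v) 0 0))
        - p (Sum.inl (jet (Sum.inl v) 0 0)) * p (Sum.inl (jet (Sum.inr u) 0 0)) :=
  (h.dirDeriv_sysEta_F_eq_zero_iff a hp.1.1 (hp.1.2 (Sum.inl a) 0 0) rfl rfl).1
    (hp.1.2 (Sum.inr a) 0 0)

theorem dirDeriv_y_recAngle_x (hp : p ∈ (covS J₁ J₂ η₁ η₂).tangent.pts) :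
    (η₂ (p (Sum.inl y)) - η₁ (p (Sum.inl x)))
        * dirDeriv (fun c => (covS J₁ J₂ η₁ η₂).tangent.field .y c p) (recAngle η₁ η₂ .x) p
      = 1 / 2 * deriv η₁ (p (Sum.inl x)) * recAngle η₁ η₂ .y p
        - 1 / 2 * deriv η₂ (p (Sum.inl y)) * recAngle η₁ η₂ .x p
        - p (Sum.inl (jet (Sum.inl u) 0 0)) * roTangent η₁ η₂ (Sum.inr v) p
        - p (Sum.inl (jet (Sum.inl v) 0 0)) * roTangent η₁ η₂ (Sum.inr u) p := by
  have hdom := hp.1.1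
  have hα := h.variation_crossAngle hp u
  have hx : (covS J₁ J₂ η₁ η₂).tangent.field .y (Sum.inl x) p = 0 := rfl
  have hu : (covS J₁ J₂ η₁ η₂).tangent.field .y (Sum.inl (jet (Sum.inl u) 0 0)) p
      = p (Sum.inl (jet (Sum.inl u) 0 1)) := rfl
  have huy : p (Sum.inl (jet (Sum.inl v) 0 0)) * angle .x (jetBase (p ∘ Sum.inl))
      = p (Sum.inl (jet (Sum.inl u) 0 1)) := mul_angle_x hdom.2.2.2.2
  have hS₀ : (covS J₁ J₂ η₁ η₂).tangent.field .y (Sum.inr (Sum.inr 0)) p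
      = variation (angle .y) (p ∘ Sum.inl) := field_y_tangent_covS hdom 0
  have hcross : along (totalField .y) (angle .x) = crossAngle u := rfl
  rw [(h.hasDirDerivAt_recAngle_x hdom _).eq, dirDeriv_y_rotT hdom,
    (Cov.hasDirDerivAt_variation _ .y (smoothAt_angle hdom .x)).eq, roTangent_inr_u,
    roTangent_inr_v, recAngle, recAngle, hx, hu, hS₀, hcross]
  linear_combination η₁ (p (Sum.inl x)) * hα
    + (η₂ (p (Sum.inl y)) - η₁ (p (Sum.inl x))) * rotT p * huy

theorem dirDeriv_x_recAngle_y (hp : p ∈ (covS J₁ J₂ η₁ η₂).tangent.pts) :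
    (η₂ (p (Sum.inl y)) - η₁ (p (Sum.inl x)))
        * dirDeriv (fun c => (covS J₁ J₂ η₁ η₂).tangent.field .x c p) (recAngle η₁ η₂ .y) p
      = 1 / 2 * deriv η₁ (p (Sum.inl x)) * recAngle η₁ η₂ .y p
        - 1 / 2 * deriv η₂ (p (Sum.inl y)) * recAngle η₁ η₂ .x p
        - p (Sum.inl (jet (Sum.inl u) 0 0)) * roTangent η₁ η₂ (Sum.inr v) p
        - p (Sum.inl (jet (Sum.inl v) 0 0)) * roTangent η₁ η₂ (Sum.inr u) p := by
  have hdom := hp.1.1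
  have hβ := h.variation_crossAngle hp v
  have hy : (covS J₁ J₂ η₁ η₂).tangent.field .x (Sum.inl y) p = 0 := rfl
  have hv : (covS J₁ J₂ η₁ η₂).tangent.field .x (Sum.inl (jet (Sum.inl v) 0 0)) p
      = p (Sum.inl (jet (Sum.inl v) 1 0)) := rfl
  have hvx : p (Sum.inl (jet (Sum.inl u) 0 0)) * angle .y (jetBase (p ∘ Sum.inl))
      = -p (Sum.inl (jet (Sum.inl v) 1 0)) := mul_angle_y hdom.2.2.2.1
  have hS₀ : (covS J₁ J₂ η₁ η₂).tangent.field .x (Sum.inr (Sum.inr 0)) p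
      = variation (angle .x) (p ∘ Sum.inl) := field_x_tangent_covS hdom 0
  have hcross : along (totalField .x) (angle .y) = crossAngle v := rfl
  rw [(h.hasDirDerivAt_recAngle_y hdom _).eq, dirDeriv_x_rotZ hdom,
    (Cov.hasDirDerivAt_variation _ .x (smoothAt_angle hdom .y)).eq, roTangent_inr_u,
    roTangent_inr_v, recAngle, recAngle, hy, hv, hS₀, hcross]
  linear_combination η₂ (p (Sum.inl y)) * hβ
    + (η₂ (p (Sum.inl y)) - η₁ (p (Sum.inl x))) * rotZ p * hvx

theorem isCovering_tangent_covS : (covS J₁ J₂ η₁ η₂).tangent.IsCovering :=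
  isCovering_covS.tangent h.isNormal_sysEta

theorem variation_along_angle_prol_roTangent (hp : p ∈ (covS J₁ J₂ η₁ η₂).tangent.pts)
    (d d' : Axis) :
    variation (along (totalField d) (angle d'))
        ((covS J₁ J₂ η₁ η₂).tangent.prol (roTangent η₁ η₂) p)
      = along ((covS J₁ J₂ η₁ η₂).tangent.field d) (recAngle η₁ η₂ d') p := by
  have hE := h.isNormal_sysEta.tangent
  have hC := h.isCovering_tangent_covS
  have hφ : ∀ a, ∀ p ∈ (covS J₁ J₂ η₁ η₂).tangent.pts, SmoothAt (roTangent η₁ η₂ a) p :=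
    fun a p hp => h.smoothAt_roTangent hp.1.1 a
  have hangle : ∀ p ∈ (covS J₁ J₂ η₁ η₂).tangent.pts, SmoothAt (angle d')
      (jetBase ((covS J₁ J₂ η₁ η₂).tangent.prol (roTangent η₁ η₂) p)) := fun p hp => by
    rw [jetBase_prol_roTangent]
    exact smoothAt_angle hp.1.1 d'
  rw [hC.variation_along_prol hE hφ d hp (hangle p hp)]
  refine (hC.isTangent_field hE d).congr (fun p hp => ?_) (fun p hp => ?_) (fun p hp => ?_) p hp
  · exact (smoothAt_variation (hangle p hp)).comp fun c => hC.smoothAt_prol hφ c p hp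
  · exact h.smoothAt_recAngle hp.1.1 d'
  · exact h.variation_angle_prol_roTangent (h.isSmooth_sysEta.mem_tangent_inf_iff.1 hp.1 |>.1) d'

theorem variation_crossAngle_prol_roTangent (hp : p ∈ (covS J₁ J₂ η₁ η₂).tangent.pts) (a : Dep) :
    (η₂ (p (Sum.inl y)) - η₁ (p (Sum.inl x)))
        * variation (crossAngle a) ((covS J₁ J₂ η₁ η₂).tangent.prol (roTangent η₁ η₂) p)
      = 1 / 2 * deriv η₁ (p (Sum.inl x)) * recAngle η₁ η₂ .y p
        - 1 / 2 * deriv η₂ (p (Sum.inl y)) * recAngle η₁ η₂ .x p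
        - p (Sum.inl (jet (Sum.inl u) 0 0)) * roTangent η₁ η₂ (Sum.inr v) p
        - p (Sum.inl (jet (Sum.inl v) 0 0)) * roTangent η₁ η₂ (Sum.inr u) p := by
  cases a with
  | u =>
    exact (congrArg _ (h.variation_along_angle_prol_roTangent hp .y .x)).trans
      (h.dirDeriv_y_recAngle_x hp)
  | v =>
    exact (congrArg _ (h.variation_along_angle_prol_roTangent hp .x .y)).trans
      (h.dirDeriv_x_recAngle_y hp)

theorem isMorphism_roTangent : (covS J₁ J₂ η₁ η₂).tangent.IsMorphism
    (sysEta J₁ J₂ η₁ η₂).tangent (roTangent η₁ η₂) := by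
  refine h.isCovering_tangent_covS.isMorphism h.isNormal_sysEta.tangent h.isSmooth_sysEta.tangent
    (fun a p hp => h.smoothAt_roTangent hp.1.1 a) (fun p hp => ?_) ?_
  · change jetBase _ ∈ (sysEta J₁ J₂ η₁ η₂).dom
    rw [jetBase_prol_roTangent]
    exact hp.1.1
  · have hF : ∀ a, ∀ p ∈ (covS J₁ J₂ η₁ η₂).tangent.pts, (sysEta J₁ J₂ η₁ η₂).F a
        (jetBase ((covS J₁ J₂ η₁ η₂).tangent.prol (roTangent η₁ η₂) p)) = 0 := fun a p hp => by
      rw [jetBase_prol_roTangent]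
      exact hp.1.2 (Sum.inl a) 0 0
    rintro (a | a) p hp
    · exact hF a p hp
    · refine (h.dirDeriv_sysEta_F_eq_zero_iff a ?_ (hF a p hp) rfl rfl).2 ?_
      · rw [jetBase_prol_roTangent]
        exact hp.1.1
      · refine (h.variation_crossAngle_prol_roTangent hp a).trans ?_
        rw [← h.variation_angle_prol_roTangent (h.isSmooth_sysEta.mem_tangent_inf_iff.1 hp.1 |>.1),
          ← h.variation_angle_prol_roTangent (h.isSmooth_sysEta.mem_tangent_inf_iff.1 hp.1 |>.1)]
        rfl

end SmoothData

end RecursionOperator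

section TriangularMaps

variable {A W : Type*} {E : PDESystem A A} {lead : A → ℕ × ℕ} {C : Cov E W} {l : W → ℕ}
variable {e : A → (JetCoord A → ℝ) → ℝ}
variable {φ : A ⊕ A → (JetCoord (A ⊕ A) ⊕ (W ⊕ W) → ℝ) → ℝ}
variable {p q r : JetCoord (A ⊕ A) ⊕ (W ⊕ W) → ℝ}

theorem DependsBelow.along_sub_mul {I : Type*} {U : Set (I → ℝ)} {lev : I → ℕ} {n : ℕ}
    {X : I → (I → ℝ) → ℝ} (hU : IsOpen U) (hX : ∀ c, lev c < n → DependsBelow U lev (n + 1) (X c))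
    {g f : (I → ℝ) → ℝ} (hg : ∀ p ∈ U, SmoothAt g p) (hf : ∀ p ∈ U, SmoothAt f p)
    (hgn : DependsBelow U lev n g) {c : I} (hc : lev c < n + 1)
    (hfg : DependsBelow U lev n fun p => f p - g p * p c) :
    DependsBelow U lev (n + 1) fun p => SDeform.along X f p - g p * X c p := by
  have hderiv : ∀ p ∈ U, HasDirDerivAt (fun p => f p - g p * p c)
      (SDeform.along X f p - (SDeform.along X g p * p c + g p * X c p)) (fun c => X c p) p :=
    fun p hp => ((hf p hp).hasDirDerivAt _).sub
      (((hg p hp).hasDirDerivAt _).mul (.coord (ξ := fun c => X c p) c))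
  intro p hp q hq hpq
  have hrem := hfg.along hU (fun p hp => (hderiv p hp).smooth) hX p hp q hq hpq
  rw [SDeform.along, SDeform.along, (hderiv p hp).eq, (hderiv q hq).eq,
    hgn.along hU hg hX p hp q hq hpq, hpq c hc] at hrem
  linarith

/-- The points of the ambient space of a covering that lie over the domain of the system. -/
def PDESystem.overDom {K : Type*} (E : PDESystem A K) (W : Type*) : Set (JetCoord A ⊕ W → ℝ) :=
  {p | p ∘ Sum.inl ∈ E.dom}

theorem PDESystem.IsSmooth.isOpen_overDom {A K : Type*} {E : PDESystem A K} (hE : E.IsSmooth)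
    (W : Type*) : IsOpen (E.overDom W) :=
  hE.isOpen_dom.preimage (continuous_pi fun c => continuous_apply (Sum.inl c))

/-- The levels of the variations of the coordinates: those of the variations of the fibre
coordinates are given by `l`. -/
def variationLevel (l : W → ℕ) : JetCoord A ⊕ W → ℕ :=
  Sum.elim (fun c => c.ord + 1) l

/-- Levels of the coordinates of a tangent covering. The coordinates that are not variations have
level `0`, since a linear map of the variations has them as parameters. -/
def tangentLevel (l : W → ℕ) : JetCoord (A ⊕ A) ⊕ (W ⊕ W) → ℕ
  | .inl (jet (.inr _) i j) => i + j + 1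
  | .inl _ => 0
  | .inr w => Sum.elim 0 l w

namespace Cov

theorem tangentBase_congr (h : ∀ c, tangentLevel l c = 0 → p c = q c) :
    tangentBase p = tangentBase q := by
  funext c
  rcases c with (_ | _ | _) | _ <;> exact h _ rfl

theorem jetBase_congr (h : ∀ c, tangentLevel l c = 0 → p c = q c) :
    jetBase (p ∘ Sum.inl) = jetBase (q ∘ Sum.inl) :=
  congrArg (· ∘ Sum.inl) (tangentBase_congr h)

theorem tangentLevel_inl_le {c : JetCoord (A ⊕ A)} :
    tangentLevel l (Sum.inl c) ≤ c.ord + 1 := by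
  rcases c with _ | _ | ⟨a | a, i, j⟩
  case jet.inr => exact le_rfl
  all_goals exact Nat.zero_le _

theorem tangentFibre_congr {n : ℕ} (h : ∀ c, tangentLevel l c < n → p c = q c) :
    ∀ c, variationLevel l c < n → tangentFibre p c = tangentFibre q c
  | .inl x, _ => rfl
  | .inl y, _ => rfl
  | .inl (jet a i j), hc => h (.inl (jet (.inr a) i j)) hc
  | .inr w, hc => h (.inr (.inr w)) hc

/-- The tuple `φ` on the tangent covering of `C` preserves the dependent variables of `E` and
transforms their variations, up to terms of lower level, by multiplication with the nonvanishing
functions `e`; moreover, the lifted total derivatives raise levels by at most one. -/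
structure IsTriangularMap (C : Cov E W) (l : W → ℕ) (e : A → (JetCoord A → ℝ) → ℝ)
    (φ : A ⊕ A → (JetCoord (A ⊕ A) ⊕ (W ⊕ W) → ℝ) → ℝ) : Prop where
  smoothAt_coef : ∀ d w, ∀ p ∈ E.overDom W, SmoothAt (C.coef d w) p
  dependsBelow_coef : ∀ d w, DependsBelow (E.overDom W) (variationLevel l) (l w + 2) (C.coef d w)
  smoothAt_lead : ∀ a, ∀ q ∈ E.dom, SmoothAt (e a) q
  lead_ne_zero : ∀ a, ∀ q ∈ E.dom, e a q ≠ 0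
  apply_inl : ∀ a, φ (Sum.inl a) = depVar (Sum.inl a)
  smoothAt_inr : ∀ a, ∀ p ∈ E.tangent.overDom (W ⊕ W), SmoothAt (φ (Sum.inr a)) p
  dependsBelow_inr : ∀ a, DependsBelow (E.tangent.overDom (W ⊕ W)) (tangentLevel l) 1
    fun p => φ (Sum.inr a) p - e a (jetBase (p ∘ Sum.inl)) * p (Sum.inl (jet (Sum.inr a) 0 0))

/-- The terms of lower level in the prolongation of a triangular map. -/
def remainder (C : Cov E W) (e : A → (JetCoord A → ℝ) → ℝ)
    (φ : A ⊕ A → (JetCoord (A ⊕ A) ⊕ (W ⊕ W) → ℝ) → ℝ) (a : A) (i j : ℕ)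
    (p : JetCoord (A ⊕ A) ⊕ (W ⊕ W) → ℝ) : ℝ :=
  C.tangent.prol φ p (jet (Sum.inr a) i j)
    - e a (jetBase (p ∘ Sum.inl)) * p (Sum.inl (jet (Sum.inr a) i j))

open Classical in
/-- One substitution of the equations for the point `p` of the tangent covering whose image under
`φ` and whose fibre coordinates are those of `r`: principal derivatives are computed from the
linearized system, the other ones by dividing by the leading coefficient. -/
def inverseStep (lead : A → ℕ × ℕ) (C : Cov E W) (e : A → (JetCoord A → ℝ) → ℝ)
    (φ : A ⊕ A → (JetCoord (A ⊕ A) ⊕ (W ⊕ W) → ℝ) → ℝ)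
    (r p : JetCoord (A ⊕ A) ⊕ (W ⊕ W) → ℝ) : JetCoord (A ⊕ A) ⊕ (W ⊕ W) → ℝ
  | .inl (jet (.inr a) i j) =>
    if IsPrincipal lead a i j then
      E.tangent.solved (Sum.elim lead lead) (Sum.inr a) i j (p ∘ Sum.inl)
    else (r (.inl (jet (.inr a) i j)) - C.remainder e φ a i j p) / e a (jetBase (p ∘ Sum.inl))
  | c => r c

theorem inverseStep_of_isPrincipal {a : A} {i j : ℕ} (ha : IsPrincipal lead a i j) :
    C.inverseStep lead e φ r p (Sum.inl (jet (Sum.inr a) i j))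
      = E.tangent.solved (Sum.elim lead lead) (Sum.inr a) i j (p ∘ Sum.inl) :=
  if_pos ha

theorem inverseStep_of_not_isPrincipal {a : A} {i j : ℕ} (ha : ¬ IsPrincipal lead a i j) :
    C.inverseStep lead e φ r p (Sum.inl (jet (Sum.inr a) i j))
      = (r (Sum.inl (jet (Sum.inr a) i j)) - C.remainder e φ a i j p)
        / e a (jetBase (p ∘ Sum.inl)) :=
  if_neg ha

/-- The inverse of a triangular map `φ`: the point whose image under `φ` and whose fibre coordinates
are those of `r`. -/
def inverse (lead : A → ℕ × ℕ) (l : W → ℕ) (C : Cov E W) (e : A → (JetCoord A → ℝ) → ℝ)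
    (φ : A ⊕ A → (JetCoord (A ⊕ A) ⊕ (W ⊕ W) → ℝ) → ℝ)
    (r : JetCoord (A ⊕ A) ⊕ (W ⊕ W) → ℝ) : JetCoord (A ⊕ A) ⊕ (W ⊕ W) → ℝ :=
  triangularSolution (tangentLevel l) (C.inverseStep lead e φ r) r

theorem jetBase_inverseStep (r p : JetCoord (A ⊕ A) ⊕ (W ⊕ W) → ℝ) :
    jetBase (C.inverseStep lead e φ r p ∘ Sum.inl) = jetBase (r ∘ Sum.inl) := by
  funext c
  cases c <;> rfl

namespace IsTriangularMap

theorem smoothAt_coef_tangent (h : C.IsTriangularMap l e φ) (d : Axis) :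
    ∀ w, ∀ p ∈ E.tangent.overDom (W ⊕ W), SmoothAt (C.tangent.coef d w) p :=
  fun w p hp => Cov.smoothAt_coef_tangent (fun w => h.smoothAt_coef d w (tangentBase p) hp) w

theorem dependsBelow_field (h : C.IsTriangularMap l e φ) (hE : E.IsSmooth) (d : Axis)
    {c : JetCoord (A ⊕ A) ⊕ (W ⊕ W)} {n : ℕ} (hc : tangentLevel l c < n) :
    DependsBelow (E.tangent.overDom (W ⊕ W)) (tangentLevel l) (n + 1) (C.tangent.field d c) := by
  intro p hp q hq hpq
  have hbase := tangentBase_congr (l := l) fun c hc => hpq c (by omega)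
  rcases c with (_ | _ | ⟨a | a, i, j⟩) | w | w
  · cases d <;> rfl
  · cases d <;> rfl
  · cases d <;> exact hpq _ (Nat.succ_pos n)
  · have hd : d.dx + d.dy = 1 := by cases d <;> rfl
    have hstep := hpq (.inl (jet (.inr a) (i + d.dx) (j + d.dy)))
      (by simp only [tangentLevel] at hc ⊢; omega)
    cases d <;> exact hstep
  · exact (coef_tangent_inl d w p).trans
      ((congrArg (C.coef d w) hbase).trans (coef_tangent_inl d w q).symm)
  · have hw : l w < n := hc
    have hcoef := ((h.dependsBelow_coef d w).mono (by omega : _ ≤ n + 1)).dirDeriv_congr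
      (hE.isOpen_overDom W)
      (h.smoothAt_coef d w) (p := tangentBase p) (q := tangentBase q) hp hq
      (fun c _ => congrFun hbase c) (tangentFibre_congr hpq)
    exact (coef_tangent_inr d w p).trans (hcoef.trans (coef_tangent_inr d w q).symm)

theorem smoothAt_lead_jetBase (h : C.IsTriangularMap l e φ) (a : A) :
    ∀ p ∈ E.tangent.overDom (W ⊕ W), SmoothAt (fun p : JetCoord (A ⊕ A) ⊕ (W ⊕ W) → ℝ =>
      e a (jetBase (p ∘ Sum.inl))) p :=
  fun _ hp => smoothAt_comp_inl (smoothAt_comp_jetBase (h.smoothAt_lead a (jetBase _) hp))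

theorem dependsBelow_along_sub (h : C.IsTriangularMap l e φ) (hE : E.IsSmooth) (d : Axis) {a : A}
    {i j : ℕ} {f : (JetCoord (A ⊕ A) ⊕ (W ⊕ W) → ℝ) → ℝ}
    (hf : ∀ p ∈ E.tangent.overDom (W ⊕ W), SmoothAt f p)
    (hfg : DependsBelow (E.tangent.overDom (W ⊕ W)) (tangentLevel l) (i + j + 1)
      fun p => f p - e a (jetBase (p ∘ Sum.inl)) * p (Sum.inl (jet (Sum.inr a) i j))) :
    DependsBelow (E.tangent.overDom (W ⊕ W)) (tangentLevel l) (i + d.dx + (j + d.dy) + 1)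
      fun p => along (C.tangent.field d) f p - e a (jetBase (p ∘ Sum.inl))
        * p (Sum.inl (jet (Sum.inr a) (i + d.dx) (j + d.dy))) := by
  have hd : d.dx + d.dy = 1 := by cases d <;> rfl
  have hstep := DependsBelow.along_sub_mul (hE.tangent.isOpen_overDom (W ⊕ W))
    (fun c hc => h.dependsBelow_field hE d hc) (h.smoothAt_lead_jetBase a) hf
    (fun p _ q _ hpq => congrArg (e a) (jetBase_congr fun c hc =>
      hpq c (hc.trans_lt (Nat.succ_pos (i + j)))))
    (c := .inl (jet (.inr a) i j)) (Nat.lt_succ_self _) hfg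
  have hcoord : ∀ p, C.tangent.field d (.inl (jet (.inr a) i j)) p
      = p (.inl (jet (.inr a) (i + d.dx) (j + d.dy))) := fun p => totalField_jet d _ i j _
  simp only [hcoord] at hstep
  exact hstep.mono (by omega)

theorem dependsBelow_remainder (h : C.IsTriangularMap l e φ) (hE : E.IsSmooth) (a : A) (i j : ℕ) :
    DependsBelow (E.tangent.overDom (W ⊕ W)) (tangentLevel l) (i + j + 1)
      (C.remainder e φ a i j) := by
  have hsmooth := smoothAt_prol_jet h.smoothAt_coef_tangent (h.smoothAt_inr a)
  induction i with
  | zero =>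
    induction j with
    | zero => exact h.dependsBelow_inr a
    | succ j ih =>
      have hstep := h.dependsBelow_along_sub hE .y (hsmooth 0 j) ih
      intro p hp q hq hpq
      simp only [remainder, prol, Function.iterate_succ_apply']
      exact hstep p hp q hq hpq
  | succ i ih =>
    have hstep := h.dependsBelow_along_sub hE .x (hsmooth i j) ih
    intro p hp q hq hpq
    simp only [remainder, prol, Function.iterate_succ_apply']
    exact hstep p hp q hq hpq

theorem isTriangular_inverseStep (h : C.IsTriangularMap l e φ) (hE : IsNormal E lead)
    (hr : r ∈ E.tangent.overDom (W ⊕ W)) :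
    IsTriangular (E.tangent.overDom (W ⊕ W)) (tangentLevel l)
      (C.inverseStep lead e φ r) where
  mapsTo p _ := (congrArg (· ∈ E.dom) (jetBase_inverseStep r p)).mpr hr
  dependsBelow c p hp q hq hpq := by
    beta_reduce
    rcases c with (_ | _ | ⟨a | a, i, j⟩) | w
    case inl.jet.inr =>
      by_cases ha : IsPrincipal lead a i j
      · rw [inverseStep_of_isPrincipal ha, inverseStep_of_isPrincipal ha]
        exact hE.tangent.dependsBelow_solved (a := Sum.inr a) ha _ hp _ hq fun c hc =>
          hpq _ (tangentLevel_inl_le.trans_lt (Nat.succ_lt_succ hc))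
      · rw [inverseStep_of_not_isPrincipal ha, inverseStep_of_not_isPrincipal ha,
          h.dependsBelow_remainder hE.toIsSmooth a i j p hp q hq hpq,
          jetBase_congr fun c hc => hpq c (hc.trans_lt (Nat.succ_pos _))]
    all_goals rfl

theorem smoothAt_inverseStep (h : C.IsTriangularMap l e φ) (hE : IsNormal E lead)
    {m : (JetCoord (A ⊕ A) ⊕ (W ⊕ W) → ℝ) → JetCoord (A ⊕ A) ⊕ (W ⊕ W) → ℝ}
    (hm : ∀ c, SmoothAt (fun r => m r c) r) (hmr : m r ∈ E.tangent.overDom (W ⊕ W))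
    (c : JetCoord (A ⊕ A) ⊕ (W ⊕ W)) :
    SmoothAt (fun r => C.inverseStep lead e φ r (m r) c) r := by
  rcases c with (_ | _ | ⟨a | a, i, j⟩) | w
  case inl.jet.inr =>
    by_cases ha : IsPrincipal lead a i j
    · simp only [inverseStep_of_isPrincipal ha]
      exact SmoothAt.comp (m := fun r => m r ∘ Sum.inl)
        (hE.tangent.smoothAt_solved (Sum.inr a) i j _ hmr) fun c => hm (Sum.inl c)
    · have hlead := (h.smoothAt_lead_jetBase a _ hmr).comp hm
      have hprol := (smoothAt_prol_jet h.smoothAt_coef_tangent (h.smoothAt_inr a) i j _ hmr).comp hm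
      simp only [inverseStep_of_not_isPrincipal ha]
      exact ((smoothAt_coord _ r).sub (hprol.sub (hlead.mul (hm _)))).div hlead
        (h.lead_ne_zero a (jetBase _) hmr)
  all_goals exact smoothAt_coord _ r

theorem inverse_mem (h : C.IsTriangularMap l e φ) (hE : IsNormal E lead)
    (hr : r ∈ E.tangent.overDom (W ⊕ W)) :
    C.inverse lead l e φ r ∈ E.tangent.overDom (W ⊕ W) :=
  (h.isTriangular_inverseStep hE hr).solution_mem (n := 1) hr fun _ hp _ hpp' =>
    (congrArg (· ∈ E.dom) (jetBase_congr (l := l) fun c hc => hpp' c (by omega))).mp hp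

theorem inverseStep_inverse (h : C.IsTriangularMap l e φ) (hE : IsNormal E lead)
    (hr : r ∈ E.tangent.overDom (W ⊕ W)) :
    C.inverseStep lead e φ r (C.inverse lead l e φ r) = C.inverse lead l e φ r :=
  (h.isTriangular_inverseStep hE hr).apply_solution hr (h.inverse_mem hE hr)

theorem smoothAt_inverse (h : C.IsTriangularMap l e φ) (hE : IsNormal E lead)
    (hr : r ∈ E.tangent.overDom (W ⊕ W)) (c : JetCoord (A ⊕ A) ⊕ (W ⊕ W)) :
    SmoothAt (fun r => C.inverse lead l e φ r c) r :=
  smoothAt_triangularSolution (h.isTriangular_inverseStep hE hr).mapsTo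
    (fun _ => h.smoothAt_inverseStep hE) hr c

theorem inverseStep_prol (h : C.IsTriangularMap l e φ) (hp : p ∈ C.tangent.pts) :
    C.inverseStep lead e φ (Sum.elim (C.tangent.prol φ p) (p ∘ Sum.inr)) p = p := by
  funext c
  rcases c with (_ | _ | ⟨a | a, i, j⟩) | w
  case inl.jet.inl =>
    exact congrFun (C.tangent.jetBase_prol h.apply_inl p) (jet a i j)
  case inl.jet.inr =>
    by_cases ha : IsPrincipal lead a i j
    · exact (inverseStep_of_isPrincipal ha).trans
        (((PDESystem.mem_inf_iff_solved (Sum.elim lead lead)).1 hp.1).2 (Sum.inr a) i j ha)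
    · rw [inverseStep_of_not_isPrincipal ha, div_eq_iff (h.lead_ne_zero a (jetBase _) hp.1.1),
        remainder, Sum.elim_inl, sub_sub_cancel, mul_comm]
  all_goals rfl

theorem mem_pts_of_inverseStep_eq (hE : IsNormal E lead) (hdom : C.dom = Set.univ)
    (hr : r ∘ Sum.inl ∈ E.tangent.inf) (hp : C.inverseStep lead e φ r p = p) :
    p ∈ C.tangent.pts := by
  have hbase : jetBase (p ∘ Sum.inl) = jetBase (r ∘ Sum.inl) := by
    rw [← hp, jetBase_inverseStep]
  have hpdom : p ∘ Sum.inl ∈ E.tangent.dom := (congrArg (· ∈ E.dom) hbase).mpr hr.1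
  refine ⟨(PDESystem.mem_inf_iff_solved (Sum.elim lead lead)).2 ⟨hpdom, ?_⟩,
    (congrArg (tangentBase p ∈ ·) hdom).mpr trivial⟩
  rintro (a | a) i j ha
  · rw [PDESystem.solved, hE.cons_tangent_inl a _ _ _ hpdom, hbase, sub_eq_self]
    exact (hE.mem_tangent_inf_iff.1 hr).1.2 a _ _
  · exact (inverseStep_of_isPrincipal (a := a) ha).symm.trans (congrFun hp _)

theorem prol_of_inverseStep_eq (h : C.IsTriangularMap l e φ) (hE : IsNormal E lead)
    (hφ : C.tangent.IsMorphism E.tangent φ) (hr : r ∘ Sum.inl ∈ E.tangent.inf)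
    (hp : p ∈ C.tangent.pts) (hfix : C.inverseStep lead e φ r p = p) :
    C.tangent.prol φ p = r ∘ Sum.inl := by
  refine hE.tangent.eq_of_mem_inf (hφ.mem_inf p hp) hr (congrFun hfix (Sum.inl x)).symm
    (congrFun hfix (Sum.inl y)).symm ?_
  rintro (a | a) i j ha
  · exact (congrFun (C.tangent.jetBase_prol h.apply_inl p) (jet a i j)).trans
      (congrFun hfix (Sum.inl (jet (Sum.inl a) i j))).symm
  · have hjet := (inverseStep_of_not_isPrincipal (a := a) ha).symm.trans (congrFun hfix _)
    rw [div_eq_iff (h.lead_ne_zero a (jetBase _) hp.1.1), remainder] at hjet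
    rw [Function.comp_apply]
    linarith

theorem isCoveringOver (h : C.IsTriangularMap l e φ) (hE : IsNormal E lead)
    (hdom : C.dom = Set.univ) (hφ : C.tangent.IsMorphism E.tangent φ) :
    C.tangent.IsCoveringOver E.tangent φ (W ⊕ W) := by
  refine ⟨hφ, fun n p => p (Sum.inr n), fun c r => C.inverse lead l e φ r c,
    fun n p _ => smoothAt_coord _ p, fun c r hr => h.smoothAt_inverse hE hr.1 c, ?_, ?_⟩
  · intro p hp
    have hr : Sum.elim (C.tangent.prol φ p) (p ∘ Sum.inr) ∈ E.tangent.overDom (W ⊕ W) :=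
      (hφ.mem_inf p hp).1
    exact (h.isTriangular_inverseStep hE hr).eq_of_eq (h.inverse_mem hE hr) hp.1.1
      (h.inverseStep_inverse hE hr) (h.inverseStep_prol hp)
  · intro r hr
    have hfix := h.inverseStep_inverse hE hr.1
    have hpts := mem_pts_of_inverseStep_eq hE hdom hr hfix
    refine ⟨hpts, funext fun c => ?_⟩
    rcases c with c | w
    · exact congrFun (h.prol_of_inverseStep_eq hE hφ hr hpts hfix) c
    · exact (congrFun hfix (Sum.inr w)).symm

end IsTriangularMap

end Cov

end TriangularMaps

section Backlund

variable {J₁ J₂ : Set ℝ} {η₁ η₂ : ℝ → ℝ}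

/-- The coefficient of the recursion operator at the variation of the same dependent variable. -/
def leadCoef (η₁ η₂ : ℝ → ℝ) : Dep → (JetCoord Dep → ℝ) → ℝ
  | u, q => η₁ (q x)
  | v, q => η₂ (q y)

theorem dependsBelow_coef_covS {U : Set (JetCoord Dep ⊕ Fin 3 → ℝ)} (d : Axis) (w : Fin 3) :
    DependsBelow U (variationLevel ![1, 0, 0]) (![1, 0, 0] w + 2)
      ((covS J₁ J₂ η₁ η₂).coef d w) := by
  intro p _ q _ hpq
  have hu : p (Sum.inl (jet u 0 0)) = q (Sum.inl (jet u 0 0)) := hpq _ (by fin_cases w <;> decide)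
  have hv : p (Sum.inl (jet v 0 0)) = q (Sum.inl (jet v 0 0)) := hpq _ (by fin_cases w <;> decide)
  have hs : p (Sum.inr 0) = q (Sum.inr 0) := hpq _ (by fin_cases w <;> decide)
  fin_cases w
  · have huy : p (Sum.inl (jet u 0 1)) = q (Sum.inl (jet u 0 1)) := hpq _ (by decide)
    have hvx : p (Sum.inl (jet v 1 0)) = q (Sum.inl (jet v 1 0)) := hpq _ (by decide)
    cases d
    · exact congrArg₂ (· / ·) huy hv
    · exact congrArg₂ (fun a b => -(a / b)) hvx hu
  · cases d
    · exact congrArg₂ (fun a b => Real.cos a * b) hs hu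
    · exact congrArg₂ (fun a b => a * Real.sin b) hv hs
  · cases d
    · exact congrArg₂ (fun a b => -Real.sin a * b) hs hu
    · exact congrArg₂ (fun a b => a * Real.cos b) hv hs

theorem dependsBelow_roTangent {U : Set (JetCoord (Dep ⊕ Dep) ⊕ (Fin 3 ⊕ Fin 3) → ℝ)} (a : Dep) :
    DependsBelow U (tangentLevel ![1, 0, 0]) 1 fun p =>
      roTangent η₁ η₂ (Sum.inr a) p
        - leadCoef η₁ η₂ a (jetBase (p ∘ Sum.inl)) * p (Sum.inl (jet (Sum.inr a) 0 0)) := by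
  intro p _ q _ hpq
  have hx : p (Sum.inl x) = q (Sum.inl x) := hpq _ Nat.one_pos
  have hy : p (Sum.inl y) = q (Sum.inl y) := hpq _ Nat.one_pos
  have hs : p (Sum.inr (Sum.inl 0)) = q (Sum.inr (Sum.inl 0)) := hpq _ Nat.one_pos
  have hS₁ : p (Sum.inr (Sum.inr 1)) = q (Sum.inr (Sum.inr 1)) := hpq _ Nat.one_pos
  have hS₂ : p (Sum.inr (Sum.inr 2)) = q (Sum.inr (Sum.inr 2)) := hpq _ Nat.one_pos
  have hbase : jetBase (p ∘ Sum.inl) = jetBase (q ∘ Sum.inl) :=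
    Cov.jetBase_congr (l := ![1, 0, 0]) fun c hc => hpq c (hc.trans_lt Nat.one_pos)
  have hT : rotT p = rotT q := by rw [rotT, rotT, hs, hS₁, hS₂]
  have hZ : rotZ p = rotZ q := by rw [rotZ, rotZ, hs, hS₁, hS₂]
  cases a with
  | u =>
    have hlead : ∀ p : JetCoord (Dep ⊕ Dep) ⊕ (Fin 3 ⊕ Fin 3) → ℝ,
        leadCoef η₁ η₂ u (jetBase (p ∘ Sum.inl)) = η₁ (p (Sum.inl x)) := fun _ => rfl
    simp only [roTangent_inr_u, hlead, hx, hy, hT, hZ, hbase]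
    ring
  | v =>
    have hlead : ∀ p : JetCoord (Dep ⊕ Dep) ⊕ (Fin 3 ⊕ Fin 3) → ℝ,
        leadCoef η₁ η₂ v (jetBase (p ∘ Sum.inl)) = η₂ (p (Sum.inl y)) := fun _ => rfl
    simp only [roTangent_inr_v, hlead, hx, hy, hT, hZ, hbase]
    ring

namespace SmoothData

variable (h : SmoothData J₁ J₂ η₁ η₂)
include h

theorem isTriangularMap_roTangent (h₁ : ∀ t ∈ J₁, η₁ t ≠ 0) (h₂ : ∀ t ∈ J₂, η₂ t ≠ 0) :
    (covS J₁ J₂ η₁ η₂).IsTriangularMap ![1, 0, 0] (leadCoef η₁ η₂) (roTangent η₁ η₂) where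
  smoothAt_coef
    | .x, w, _, hp => (hasDirDerivAt_covS_X (ξ := 0) hp w).smooth
    | .y, w, _, hp => (hasDirDerivAt_covS_Y (ξ := 0) hp w).smooth
  dependsBelow_coef := dependsBelow_coef_covS
  smoothAt_lead
    | u, _, hq => (h.hasDirDerivAt_eta₁ (ξ := 0) hq.1).smooth
    | v, _, hq => (h.hasDirDerivAt_eta₂ (ξ := 0) hq.2.1).smooth
  lead_ne_zero
    | u, _, hq => h₁ _ hq.1
    | v, _, hq => h₂ _ hq.2.1
  apply_inl _ := rfl
  smoothAt_inr a _ hp := h.smoothAt_roTangent hp (Sum.inr a)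
  dependsBelow_inr := dependsBelow_roTangent

theorem isBacklundAuto_roTangent (h₁ : ∀ t ∈ J₁, η₁ t ≠ 0) (h₂ : ∀ t ∈ J₂, η₂ t ≠ 0) :
    (covS J₁ J₂ η₁ η₂).tangent.IsBacklundAuto (roTangent η₁ η₂) (Fin 3 ⊕ Fin 3) :=
  ⟨h.isCovering_tangent_covS,
    h.isCovering_tangent_covS.isCoveringOver_depVar h.isNormal_sysEta.tangent rfl,
    (h.isTriangularMap_roTangent h₁ h₂).isCoveringOver h.isNormal_sysEta rfl
      h.isMorphism_roTangent⟩

end SmoothData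

end Backlund

section Shadows

variable {A W W' : Type*} {E : PDESystem A A} {lead : A → ℕ × ℕ}

namespace Cov

theorem smoothAt_toBase (c : JetCoord A ⊕ W) (p : JetCoord A ⊕ (W ⊕ W') → ℝ) :
    SmoothAt (fun p => toBase p c) p := by
  rcases c with c | w <;> exact smoothAt_coord _ p

theorem along_extend_toBase (B : Cov E W) (dom : Set (JetCoord A ⊕ (W ⊕ W') → ℝ))
    (X Y : W' → (JetCoord A ⊕ (W ⊕ W') → ℝ) → ℝ) (d : Axis) (c : JetCoord A ⊕ W)
    (p : JetCoord A ⊕ (W ⊕ W') → ℝ) :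
    along ((B.extend dom X Y).field d) (fun p => toBase p c) p = B.field d c (toBase p) := by
  rcases c with c | w
  · exact congrFun (along_coord _ (Sum.inl c)) p
  · refine (congrFun (along_coord _ (Sum.inr (Sum.inl w))) p).trans ?_
    cases d <;> rfl

theorem along_extend_comp_toBase (B : Cov E W) (dom : Set (JetCoord A ⊕ (W ⊕ W') → ℝ))
    (X Y : W' → (JetCoord A ⊕ (W ⊕ W') → ℝ) → ℝ) (d : Axis) {f : (JetCoord A ⊕ W → ℝ) → ℝ}
    {p : JetCoord A ⊕ (W ⊕ W') → ℝ} (hf : SmoothAt f (toBase p)) :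
    along ((B.extend dom X Y).field d) (fun p => f (toBase p)) p
      = along (B.field d) f (toBase p) :=
  along_comp (fun c => smoothAt_toBase c p) (fun c => B.along_extend_toBase dom X Y d c p) hf

theorem jetBase_prol_elim (C : Cov E W) (φ : A → (JetCoord A ⊕ W → ℝ) → ℝ)
    (p : JetCoord A ⊕ W → ℝ) : jetBase (C.prol (Sum.elim depVar φ) p) = p ∘ Sum.inl := by
  refine Eq.trans ?_ (C.prol_depVar p)
  funext c
  cases c <;> rfl

theorem IsShadow.isMorphism {C : Cov E W} {φ : A → (JetCoord A ⊕ W → ℝ) → ℝ}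
    (hφ : C.IsShadow φ) (hC : C.IsCovering) (hE : IsNormal E lead) :
    C.IsMorphism E.tangent (Sum.elim depVar φ) := by
  refine hC.isMorphism hE hE.toIsSmooth.tangent
    (Sum.rec (fun a p _ => smoothAt_coord _ p) hφ.smooth) (fun p hp => ?_) ?_
  · change jetBase _ ∈ E.dom
    rw [jetBase_prol_elim]
    exact hp.1.1
  · rintro (a | a) p hp
    · change E.F a (jetBase _) = 0
      rw [jetBase_prol_elim]
      exact hp.1.2 a 0 0
    · change dirDeriv (jetVert _) (E.F a) (jetBase _) = 0
      rw [jetBase_prol_elim]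
      exact hφ.lin a p hp

/-- The map from the covering with adjoined variations to the tangent covering: it substitutes the
tuple `φ` for the variations of the dependent variables. -/
def toTangent (C : Cov E (W ⊕ W')) (φ : A → (JetCoord A ⊕ (W ⊕ W') → ℝ) → ℝ)
    (p : JetCoord A ⊕ ((W ⊕ W') ⊕ W) → ℝ) : JetCoord (A ⊕ A) ⊕ (W ⊕ W) → ℝ :=
  Sum.elim (C.prol (Sum.elim depVar φ) (toBase p))
    (Sum.elim (fun w => p (Sum.inr (Sum.inl (Sum.inl w)))) fun w => p (Sum.inr (Sum.inr w)))

theorem tangentBase_toTangent (C : Cov E (W ⊕ W')) (φ : A → (JetCoord A ⊕ (W ⊕ W') → ℝ) → ℝ)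
    (p : JetCoord A ⊕ ((W ⊕ W') ⊕ W) → ℝ) :
    tangentBase (toTangent C φ p) = toBase (toBase p) :=
  congrArg (Sum.elim · fun w => p (Sum.inr (Sum.inl (Sum.inl w))))
    (C.jetBase_prol_elim φ (toBase p))

variable {B : Cov E W} {dom : Set (JetCoord A ⊕ (W ⊕ W') → ℝ)}
  {X Y : W' → (JetCoord A ⊕ (W ⊕ W') → ℝ) → ℝ} {φ : A → (JetCoord A ⊕ (W ⊕ W') → ℝ) → ℝ}
  {p : JetCoord A ⊕ ((W ⊕ W') ⊕ W) → ℝ}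

theorem coef_adjoinVariations_inr (d : Axis) (w : W) (p : JetCoord A ⊕ ((W ⊕ W') ⊕ W) → ℝ) :
    (adjoinVariations B (B.extend dom X Y) φ).coef d (Sum.inr w) p
      = B.tangent.coef d (Sum.inr w) (toTangent (B.extend dom X Y) φ p) := by
  rw [coef_tangent_inr, tangentBase_toTangent]
  cases d <;> rfl

theorem toBase_mem_pts (hp : p ∈ (adjoinVariations B (B.extend dom X Y) φ).pts) :
    toBase p ∈ (B.extend dom X Y).pts :=
  ⟨hp.1, hp.2.1⟩

namespace IsShadow

variable (hφ : (B.extend dom X Y).IsShadow φ) (hC : (B.extend dom X Y).IsCovering)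
  (hE : IsNormal E lead)
include hφ hC hE

theorem toTangent_mem_pts (hp : p ∈ (adjoinVariations B (B.extend dom X Y) φ).pts) :
    toTangent (B.extend dom X Y) φ p ∈ B.tangent.pts := by
  refine ⟨(hφ.isMorphism hC hE).mem_inf _ (toBase_mem_pts hp), ?_⟩
  change tangentBase _ ∈ B.dom
  rw [tangentBase_toTangent]
  exact hp.2.1.1

theorem smoothAt_toTangent (c : JetCoord (A ⊕ A) ⊕ (W ⊕ W))
    (hp : p ∈ (adjoinVariations B (B.extend dom X Y) φ).pts) :
    SmoothAt (fun p => toTangent (B.extend dom X Y) φ p c) p := by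
  rcases c with c | w | w
  · exact (hC.smoothAt_prol (hφ.isMorphism hC hE).smooth c _ (toBase_mem_pts hp)).comp
      fun c => smoothAt_toBase c p
  all_goals exact smoothAt_coord _ p

theorem along_field_toTangent (d : Axis) (c : JetCoord (A ⊕ A) ⊕ (W ⊕ W))
    (hp : p ∈ (adjoinVariations B (B.extend dom X Y) φ).pts) :
    along ((adjoinVariations B (B.extend dom X Y) φ).field d)
        (fun p => toTangent (B.extend dom X Y) φ p c) p
      = B.tangent.field d c (toTangent (B.extend dom X Y) φ p) := by
  rcases c with c | w | w
  · have hs := (hφ.isMorphism hC hE).smooth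
    exact (along_extend_comp_toBase _ _ _ _ d (hC.smoothAt_prol hs c _ (toBase_mem_pts hp))).trans
      (hC.along_prol hE hs d c (toBase_mem_pts hp))
  · refine (congrFun (along_coord _ (Sum.inr (Sum.inl (Sum.inl w)))) p).trans ?_
    refine Eq.trans ?_ (coef_tangent_inl d w _).symm
    rw [tangentBase_toTangent]
    cases d <;> rfl
  · exact (congrFun (along_coord _ (Sum.inr (Sum.inr w))) p).trans
      (coef_adjoinVariations_inr d w p)

theorem along_field_comp_toTangent (d : Axis) {f : (JetCoord (A ⊕ A) ⊕ (W ⊕ W) → ℝ) → ℝ}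
    (hp : p ∈ (adjoinVariations B (B.extend dom X Y) φ).pts)
    (hf : SmoothAt f (toTangent (B.extend dom X Y) φ p)) :
    along ((adjoinVariations B (B.extend dom X Y) φ).field d)
        (fun p => f (toTangent (B.extend dom X Y) φ p)) p
      = along (B.tangent.field d) f (toTangent (B.extend dom X Y) φ p) :=
  along_comp (fun c => hφ.smoothAt_toTangent hC hE c hp)
    (fun c => hφ.along_field_toTangent hC hE d c hp) hf

theorem smoothAt_coef_adjoinVariations (hT : B.tangent.IsCovering) (d : Axis) :
    ∀ w, ∀ p ∈ (adjoinVariations B (B.extend dom X Y) φ).pts,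
      SmoothAt ((adjoinVariations B (B.extend dom X Y) φ).coef d w) p
  | .inl w, p, hp => by
    have hs := (hC.smoothAt_coef d w _ (toBase_mem_pts hp)).comp fun c => smoothAt_toBase c p
    cases d <;> exact hs
  | .inr w, p, hp =>
    ((hT.smoothAt_coef d (Sum.inr w) _ (hφ.toTangent_mem_pts hC hE hp)).comp
      fun c => hφ.smoothAt_toTangent hC hE c hp).congr
        (.of_forall fun q => coef_adjoinVariations_inr d w q)

theorem isCovering_adjoinVariations (hT : B.tangent.IsCovering) :
    (adjoinVariations B (B.extend dom X Y) φ).IsCovering where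
  isOpen_dom := (hC.isOpen_dom.preimage (continuous_iff_continuousAt.2 fun p =>
    continuousAt_of_smoothAt fun c => smoothAt_toBase c p)).inter isOpen_univ
  smooth_X := hφ.smoothAt_coef_adjoinVariations hC hE hT .x
  smooth_Y := hφ.smoothAt_coef_adjoinVariations hC hE hT .y
  comm := by
    rintro (w | w) p hp
    · have hbase := toBase_mem_pts hp
      exact ((along_extend_comp_toBase _ _ _ _ .x (hC.smooth_Y w _ hbase)).trans
        (hC.comm w _ hbase)).trans
          (along_extend_comp_toBase _ _ _ _ .y (hC.smooth_X w _ hbase)).symm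
    · have ht := hφ.toTangent_mem_pts hC hE hp
      have hcoef := fun d => funext (coef_adjoinVariations_inr (B := B) (dom := dom) (X := X)
        (Y := Y) (φ := φ) d w)
      calc (adjoinVariations B (B.extend dom X Y) φ).Dx
            ((adjoinVariations B (B.extend dom X Y) φ).coef .y (Sum.inr w)) p
          = B.tangent.Dx (B.tangent.coef .y (Sum.inr w)) (toTangent (B.extend dom X Y) φ p) := by
            rw [hcoef]
            exact hφ.along_field_comp_toTangent hC hE .x hp (hT.smooth_Y (Sum.inr w) _ ht)
        _ = B.tangent.Dy (B.tangent.coef .x (Sum.inr w)) (toTangent (B.extend dom X Y) φ p) :=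
          hT.comm (Sum.inr w) _ ht
        _ = (adjoinVariations B (B.extend dom X Y) φ).Dy
            ((adjoinVariations B (B.extend dom X Y) φ).coef .x (Sum.inr w)) p := by
            rw [hcoef]
            exact (hφ.along_field_comp_toTangent hC hE .y hp (hT.smooth_X (Sum.inr w) _ ht)).symm

theorem smoothAt_comp_toTangent {f : (JetCoord (A ⊕ A) ⊕ (W ⊕ W) → ℝ) → ℝ}
    (hf : ∀ p ∈ B.tangent.pts, SmoothAt f p) :
    ∀ p ∈ (adjoinVariations B (B.extend dom X Y) φ).pts,
      SmoothAt (fun p => f (toTangent (B.extend dom X Y) φ p)) p :=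
  fun _ hp => (hf _ (hφ.toTangent_mem_pts hC hE hp)).comp
    fun c => hφ.smoothAt_toTangent hC hE c hp

theorem iterate_comp_toTangent (hT : B.tangent.IsCovering)
    {f : (JetCoord (A ⊕ A) ⊕ (W ⊕ W) → ℝ) → ℝ} (hf : ∀ p ∈ B.tangent.pts, SmoothAt f p)
    (i j : ℕ) (hp : p ∈ (adjoinVariations B (B.extend dom X Y) φ).pts) :
    (adjoinVariations B (B.extend dom X Y) φ).Dx^[i]
        ((adjoinVariations B (B.extend dom X Y) φ).Dy^[j]
          fun p => f (toTangent (B.extend dom X Y) φ p)) p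
      = B.tangent.Dx^[i] (B.tangent.Dy^[j] f) (toTangent (B.extend dom X Y) φ p) := by
  have hC' := hφ.isCovering_adjoinVariations hC hE hT
  have hsmooth := hφ.smoothAt_comp_toTangent hC hE hf
  have hiter : ∀ d : Axis, ∀ {f g}, (∀ p ∈ B.tangent.pts, SmoothAt f p) →
      (∀ p ∈ (adjoinVariations B (B.extend dom X Y) φ).pts, SmoothAt g p) →
      (∀ p ∈ (adjoinVariations B (B.extend dom X Y) φ).pts,
        g p = f (toTangent (B.extend dom X Y) φ p)) → ∀ n,
      ∀ p ∈ (adjoinVariations B (B.extend dom X Y) φ).pts,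
        (along ((adjoinVariations B (B.extend dom X Y) φ).field d))^[n] g p
          = (along (B.tangent.field d))^[n] f (toTangent (B.extend dom X Y) φ p) :=
    fun d _ _ => (hC'.isTangent_field hE d).iterate_comp (smoothAt_field (hT.smoothAt_coef d))
      (fun _ hp => hφ.toTangent_mem_pts hC hE hp)
      (fun c _ hp => hφ.smoothAt_toTangent hC hE c hp)
      (fun c _ hp => hφ.along_field_toTangent hC hE d c hp)
  exact hiter .x (smoothAt_iterate_along (smoothAt_field (hT.smoothAt_coef .y)) hf j)
    (smoothAt_iterate_along (hC'.isTangent_field hE .y).smooth hsmooth j)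
    (hiter .y hf hsmooth (fun _ _ => rfl) j) i p hp

theorem comp_toTangent (hT : B.tangent.IsCovering)
    {Φ : A ⊕ A → (JetCoord (A ⊕ A) ⊕ (W ⊕ W) → ℝ) → ℝ} (hΦ : B.tangent.IsMorphism E.tangent Φ)
    (hΦinl : ∀ a, Φ (Sum.inl a) = depVar (Sum.inl a)) :
    (adjoinVariations B (B.extend dom X Y) φ).IsShadow
      fun a p => Φ (Sum.inr a) (toTangent (B.extend dom X Y) φ p) where
  smooth a := hφ.smoothAt_comp_toTangent hC hE (hΦ.smooth (Sum.inr a))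
  lin k p hp := by
    have hlin : dirDeriv (jetVert _) (E.F k) (jetBase (B.tangent.prol Φ _)) = 0 :=
      (hΦ.mem_inf _ (hφ.toTangent_mem_pts hC hE hp)).2 (Sum.inr k) 0 0
    have hbase : jetBase (toTangent (B.extend dom X Y) φ p ∘ Sum.inl) = p ∘ Sum.inl :=
      (B.extend dom X Y).jetBase_prol_elim φ (toBase p)
    rw [B.tangent.jetBase_prol hΦinl, hbase] at hlin
    simp only [hφ.iterate_comp_toTangent hC hE hT (hΦ.smooth (Sum.inr _)) _ _ hp]
    exact hlin

end IsShadow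

end Cov

theorem roShadow_eq {J₁ J₂ : Set ℝ} {η₁ η₂ : ℝ → ℝ}
    (C : Cov (sysEta J₁ J₂ η₁ η₂) (Fin 3 ⊕ W')) (φ : Dep → (JetCoord Dep ⊕ (Fin 3 ⊕ W') → ℝ) → ℝ) :
    roShadow η₁ η₂ φ = fun a p => roTangent η₁ η₂ (Sum.inr a) (Cov.toTangent C φ p) := by
  funext a p
  have hbase : jetBase (Cov.toTangent C φ p ∘ Sum.inl) = p ∘ Sum.inl :=
    C.jetBase_prol_elim φ (Cov.toBase p)
  rw [roTangent, hbase]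
  rfl

end Shadows

end SDeform

end

theorem mainTheorem3 (J₁ J₂ : Set ℝ) (hJ₁ : IsOpen J₁) (hJ₂ : IsOpen J₂) (η₁ η₂ : ℝ → ℝ)
    (hη₁ : ContDiffOn ℝ ∞ η₁ J₁) (hη₂ : ContDiffOn ℝ ∞ η₂ J₂) :
    (SDeform.covS J₁ J₂ η₁ η₂).IsCovering ∧
    (SDeform.covS J₁ J₂ η₁ η₂).tangent.IsCovering ∧
    (SDeform.covS J₁ J₂ η₁ η₂).tangent.IsMorphism
      (SDeform.sysEta J₁ J₂ η₁ η₂).tangent (SDeform.roTangent η₁ η₂) ∧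
    ((∀ t ∈ J₁, η₁ t ≠ 0) → (∀ t ∈ J₂, η₂ t ≠ 0) →
      (SDeform.covS J₁ J₂ η₁ η₂).tangent.IsBacklundAuto
        (SDeform.roTangent η₁ η₂) (Fin 3 ⊕ Fin 3)) ∧
    ∀ (W : Type*) (dom : Set (SDeform.JetCoord SDeform.Dep ⊕ (Fin 3 ⊕ W) → ℝ))
      (X Y : W → (SDeform.JetCoord SDeform.Dep ⊕ (Fin 3 ⊕ W) → ℝ) → ℝ),
      ((SDeform.covS J₁ J₂ η₁ η₂).extend dom X Y).IsCovering →
      ∀ φ : SDeform.Dep → (SDeform.JetCoord SDeform.Dep ⊕ (Fin 3 ⊕ W) → ℝ) → ℝ,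
        ((SDeform.covS J₁ J₂ η₁ η₂).extend dom X Y).IsShadow φ →
        (SDeform.Cov.adjoinVariations (SDeform.covS J₁ J₂ η₁ η₂)
          ((SDeform.covS J₁ J₂ η₁ η₂).extend dom X Y) φ).IsCovering ∧
        (SDeform.Cov.adjoinVariations (SDeform.covS J₁ J₂ η₁ η₂)
          ((SDeform.covS J₁ J₂ η₁ η₂).extend dom X Y) φ).IsShadow
          (SDeform.roShadow η₁ η₂ φ) := by
  have h : SDeform.SmoothData J₁ J₂ η₁ η₂ := ⟨hJ₁, hJ₂, hη₁, hη₂⟩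
  have hT := h.isCovering_tangent_covS
  have hM := h.isMorphism_roTangent
  have hE := h.isNormal_sysEta
  refine ⟨SDeform.isCovering_covS, hT, hM, h.isBacklundAuto_roTangent, fun W dom X Y hC φ hφ =>
    ⟨hφ.isCovering_adjoinVariations hC hE hT, ?_⟩⟩
  rw [SDeform.roShadow_eq ((SDeform.covS J₁ J₂ η₁ η₂).extend dom X Y) φ]
  exact hφ.comp_toTangent hC hE hT hM fun _ => rfl
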